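/- **Setting.** For a finite nonempty set $X$ write $\mathcal X=\mathbb C^X$, and let $L(\mathcal X)$ be the operators on $\mathcal X$. A super-operator is a linear map $\Psi:L(\mathcal X)\to L(\mathcal Y)$; it is admissible if it is completely positive and trace preserving. Put $\|A\|_1=\operatorname{tr}\sqrt{A^*A}$ and $\|\Psi\|_\diamond=\max_{\|M\|_1\le 1}\|(\Psi\otimes \mathbb 1_{L(\mathcal X)})(M)\|_1$. For a super-operator $\Xi:L(\mathcal X_0\otimes\mathcal X_1)\to L(\mathcal W)$ of the kind below, its equilibrium value is $$\lambda^*(\Xi)=\min_{\rho}\max_{0\le\Pi\le \mathbb 1}\langle \Pi,\Xi(\rho)\rangle=\max_{0\le\Pi\le \mathbb 1}\min_{\rho}\langle \Pi,\Xi(\rho)\rangle ,$$ where $\rho$ ranges over density operators on $\mathcal X_0\otimes\mathcal X_1$, $\mathcal X_0,\mathcal X_1$ are copies of $\mathcal X$, and $\langle A,B\rangle=\operatorname{tr}(A^*B)$. **Construction.** Let $Q_0,Q_1:L(\mathcal X)\to L(\mathcal Y)$ be admissible and let $A_0,A_1:\mathcal X\to\mathcal Y\otimes\mathcal Z$ be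 linear isometries with $Q_i(M)=\operatorname{tr}_{\mathcal Z}(A_iMA_i^*)$ (Stinespring representations with a common auxiliary space). Let $\mathcal Q=\mathbb C^2$, let $C_0=\frac1{\sqrt2}\binom{A_0}{A_1}$ and $C_1=\frac1{\sqrt2}\binom{A_0}{-A_1}$ as maps $\mathcal X\to\mathcal Y\otimes\mathcal Z\otimes\mathcal Q$, and let $\Xi=\widetilde\Phi_A-\widetilde\Phi_B:L(\mathcal X_0\otimes\mathcal X_1)\to L(\mathcal Z\otimes\mathcal Q)$ with $$\widetilde\Phi_A(M)=\operatorname{tr}_{\mathcal Y}\bigl(C_0(\operatorname{tr}_{\mathcal X_1}M)C_0^*\bigr),\qquad \widetilde\Phi_B(M)=\operatorname{tr}_{\mathcal Y}\bigl(C_1(\operatorname{tr}_{\mathcal X_0}M)C_1^*\bigr).$$ **Theorem.** (1) For all admissible $Q_0,Q_1:L(\mathcal X)\to L(\mathcal Y)$ such isometries $A_0,A_1$ exist (for some $\mathcal Z$), and for every choice of them the equilibrium value $\lambda^*(\Xi)$ exists and satisfies, for all reals $0\le b<a\le 2$, $$\lambda^*(\Xi)\le\frac{\sqrt{4-a^2}}2\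 \text{ if }\ \|Q_0-Q_1\|_\diamond\ge a,\qquad \lambda^*(\Xi)\ge\frac{2-b}2\ \text{ if }\ \|Q_0-Q_1\|_\diamond\le b .$$ (2) $\Xi$ can be constructed efficiently in parallel from the description of two circuits. Precisely, fix any finite set of quantum gates, each an admissible operation from some number of qubits to some number of qubits given by a Stinespring isometry whose entries have rational real and imaginary parts. An instance of $\mathrm{QCD}$ (quantum circuit distinguishability) is a pair $Q_0,Q_1$ of mixed-state quantum circuits over this gate set with the same numbers of input and output qubits, described by a bit string $x$; let $Q_0,Q_1$ also denote the channels they compute, which are admissible. Then there is a polynomial-space uniform family of Boolean circuits (of fan-in two) of polynomial depth (an $\mathrm{NC}(\mathrm{poly})$ family) such that for every instance $x$ the circuit for inputs of length $|x|$ outputs on $x$ the exact matrix of a super-operator $\Xi$ as constructed above from Stinespring isometries of $Q_0,Q_1$. Here $\mathcal Z$ consists of polynomially many qubits, and the entries of $\Xi$ are written as $p/q+(p'/q')i$ with integers of polynomially many bits. In particular, the two implications of (1) hold for this $\Xi$. -/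

import Mathlib

open scoped Matrix ComplexOrder

/-! ### Operators and super-operators on complex Euclidean spaces

`Matrix I I ℂ` is the space of operators on `ℂ^I`; the tensor product of `ℂ^I` and `ℂ^J` is
`ℂ^(I × J)`. -/

/-- Partial trace over the second tensor factor. -/
def trRight (I J : Type*) [Fintype J] : Matrix (I × J) (I × J) ℂ →ₗ[ℂ] Matrix I I ℂ where
  toFun M := Matrix.of fun i i' => ∑ j, M (i, j) (i', j)
  map_add' M N := by
    ext i i'
    simp [Finset.sum_add_distrib]
  map_smul' c M := by
    ext i i'
    simp [Finset.mul_sum]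

/-- Partial trace over the first tensor factor. -/
def trLeft (I J : Type*) [Fintype I] : Matrix (I × J) (I × J) ℂ →ₗ[ℂ] Matrix J J ℂ where
  toFun M := Matrix.of fun j j' => ∑ i, M (i, j) (i, j')
  map_add' M N := by
    ext j j'
    simp [Finset.sum_add_distrib]
  map_smul' c M := by
    ext j j'
    simp [Finset.mul_sum]

/-- The super-operator `X ↦ A X A*`. -/
def conjBy {I J : Type*} [Fintype I] (A : Matrix J I ℂ) :
    Matrix I I ℂ →ₗ[ℂ] Matrix J J ℂ where
  toFun M := A * M * Aᴴ
  map_add' M N := by rw [Matrix.mul_add, Matrix.add_mul]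
  map_smul' c M := by simp

/-- `Ψ ⊗ 𝟙` : the super-operator `Ψ` applied to the first factor of `ℂ^I ⊗ ℂ^W`. -/
def tensorId {I J : Type*} (W : Type*) (Ψ : Matrix I I ℂ →ₗ[ℂ] Matrix J J ℂ) :
    Matrix (I × W) (I × W) ℂ →ₗ[ℂ] Matrix (J × W) (J × W) ℂ where
  toFun M := Matrix.of fun p p' => Ψ (Matrix.of fun i i' => M (i, p.2) (i', p'.2)) p.1 p'.1
  map_add' M N := by
    ext p p'
    have h : (Matrix.of fun i i' => (M + N) (i, p.2) (i', p'.2)) =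
        (Matrix.of fun i i' => M (i, p.2) (i', p'.2)) +
          (Matrix.of fun i i' => N (i, p.2) (i', p'.2)) := rfl
    simp only [Matrix.of_apply, Matrix.add_apply]
    rw [← Matrix.add_apply, ← map_add]
    rfl
  map_smul' c M := by
    ext p p'
    simp only [Matrix.of_apply, Matrix.smul_apply, RingHom.id_apply]
    rw [← Matrix.smul_apply, ← map_smul]
    rfl

/-- Density operators. -/
def IsDensity {I : Type*} [Fintype I] (ρ : Matrix I I ℂ) : Prop :=
  ρ.PosSemidef ∧ ρ.trace = 1

/-- Admissible super-operators (quantum channels): completely positive and trace preserving. -/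
def IsAdmissible {I J : Type*} [Fintype I] [Fintype J]
    (Ψ : Matrix I I ℂ →ₗ[ℂ] Matrix J J ℂ) : Prop :=
  (∀ (d : ℕ) (M : Matrix (I × Fin d) (I × Fin d) ℂ),
      M.PosSemidef → (tensorId (Fin d) Ψ M).PosSemidef) ∧
    ∀ M : Matrix I I ℂ, (Ψ M).trace = M.trace

/-- The trace norm `tr √(A* A)`. -/
noncomputable def traceNorm {I : Type*} [Fintype I] [DecidableEq I] (A : Matrix I I ℂ) : ℝ :=
  (cfc Real.sqrt (Aᴴ * A)).trace.re

/-- The diamond norm: the maximum of `‖(Ψ ⊗ 𝟙)(M)‖₁` over `‖M‖₁ ≤ 1`, the auxiliary space being a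
copy of the input space (a supremum over a nonempty compact set). -/
noncomputable def diamondNorm {I J : Type*} [Fintype I] [DecidableEq I] [Fintype J] [DecidableEq J]
    (Ψ : Matrix I I ℂ →ₗ[ℂ] Matrix J J ℂ) : ℝ :=
  sSup ((fun M => traceNorm (tensorId I Ψ M)) '' {M : Matrix (I × I) (I × I) ℂ | traceNorm M ≤ 1})

/-- `0 ≤ Π ≤ 𝟙`. -/
def IsEffect {J : Type*} [Fintype J] [DecidableEq J] (P : Matrix J J ℂ) : Prop :=
  P.PosSemidef ∧ (1 - P).PosSemidef

/-- The real part of the Hilbert-Schmidt inner product `⟨P, A⟩ = tr (P* A)` (the inner product is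
itself real when `P` and `A` are Hermitian). -/
noncomputable def hsInner {J : Type*} [Fintype J] (P A : Matrix J J ℂ) : ℝ :=
  (Pᴴ * A).trace.re

/-- `v` is the equilibrium value of `Ξ`:
`v = min_ρ max_Π ⟨Π, Ξ(ρ)⟩ = max_Π min_ρ ⟨Π, Ξ(ρ)⟩`, all extrema being attained, where `ρ` ranges
over density operators and `Π` over operators with `0 ≤ Π ≤ 𝟙`. -/
def IsEquilibriumValue {I J : Type*} [Fintype I] [Fintype J] [DecidableEq J]
    (Ξ : Matrix I I ℂ →ₗ[ℂ] Matrix J J ℂ) (v : ℝ) : Prop :=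
  IsLeast {u : ℝ | ∃ ρ, IsDensity ρ ∧ IsGreatest ((fun P => hsInner P (Ξ ρ)) '' {P | IsEffect P}) u}
    v ∧
  IsGreatest {u : ℝ | ∃ P, IsEffect P ∧ IsLeast ((fun ρ => hsInner P (Ξ ρ)) '' {ρ | IsDensity ρ}) u}
    v

/-- `A : ℂ^X → ℂ^Y ⊗ ℂ^Z` is a linear isometry with `Ψ(M) = tr_Z (A M A*)`. -/
def IsStinespring {X Y Z : Type*} [Fintype X] [DecidableEq X] [Fintype Y] [Fintype Z]
    (Ψ : Matrix X X ℂ →ₗ[ℂ] Matrix Y Y ℂ) (A : Matrix (Y × Z) X ℂ) : Prop :=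
  Aᴴ * A = 1 ∧ ∀ M, Ψ M = trRight Y Z (A * M * Aᴴ)

/-- `C₀ = (1/√2) (A₀; A₁)`, from `ℂ^X` to `ℂ^Y ⊗ (ℂ^Z ⊗ ℂ²)`. -/
noncomputable def stackPlus {X Y Z : Type*} (A₀ A₁ : Matrix (Y × Z) X ℂ) :
    Matrix (Y × (Z × Fin 2)) X ℂ :=
  Matrix.of fun p x => (1 / (Real.sqrt 2 : ℂ)) *
    (if p.2.2 = 0 then A₀ (p.1, p.2.1) x else A₁ (p.1, p.2.1) x)

/-- `C₁ = (1/√2) (A₀; -A₁)`. -/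
noncomputable def stackMinus {X Y Z : Type*} (A₀ A₁ : Matrix (Y × Z) X ℂ) :
    Matrix (Y × (Z × Fin 2)) X ℂ :=
  stackPlus A₀ (-A₁)

/-- `Ξ = Φ̃_A - Φ̃_B` on `ℂ^X ⊗ ℂ^X`, where `Φ̃_A(M) = tr_Y (C₀ (tr_{X₁} M) C₀*)` and
`Φ̃_B(M) = tr_Y (C₁ (tr_{X₀} M) C₁*)`. -/
noncomputable def xiMap {X Y Z : Type*} [Fintype X] [Fintype Y] (A₀ A₁ : Matrix (Y × Z) X ℂ) :
    Matrix (X × X) (X × X) ℂ →ₗ[ℂ] Matrix (Z × Fin 2) (Z × Fin 2) ℂ :=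
  trLeft Y (Z × Fin 2) ∘ₗ conjBy (stackPlus A₀ A₁) ∘ₗ trRight X X -
    trLeft Y (Z × Fin 2) ∘ₗ conjBy (stackMinus A₀ A₁) ∘ₗ trLeft X X

/-! ### Mixed-state quantum circuits and their descriptions -/

/-- Computational basis states of `n` qubits. -/
abbrev Bits (n : ℕ) : Type := Fin n → Bool

/-- A quantum gate: an admissible operation from `nin` qubits to `nout` qubits, given by a
Stinespring isometry with `nenv` environment qubits (which are traced out). As usual for exact
computation, the entries are complex numbers with rational real and imaginary parts. Unitary gates
have `nenv = 0`; fresh qubits (`nin = 0`) and discarded qubits (`nout = 0`) are allowed. -/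
structure QGate where
  nin : ℕ
  nout : ℕ
  nenv : ℕ
  mat : Matrix (Bits nout × Bits nenv) (Bits nin) ℂ
  rational : ∀ p x, ∃ a b : ℚ, mat p x = (a : ℂ) + (b : ℂ) * Complex.I
  isometry : matᴴ * mat = 1

/-- The isometry of the gate `G` placed on a register of `nin + r` qubits: the gate is applied to
the wires `π 0, …, π (nin - 1)`; its outputs become the first `nout` wires, and they are followed by
the untouched wires `π nin, …, π (nin + r - 1)`. -/
def QGate.op (G : QGate) (r : ℕ) (π : Equiv.Perm (Fin (G.nin + r))) :
    Matrix (Bits (G.nout + r) × Bits G.nenv) (Bits (G.nin + r)) ℂ :=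
  Matrix.of fun p x =>
    if (fun i : Fin r => p.1 (Fin.natAdd G.nout i)) = (fun i : Fin r => x (π (Fin.natAdd G.nin i)))
    then G.mat (fun i => p.1 (Fin.castAdd r i), p.2) (fun i => x (π (Fin.castAdd r i)))
    else 0

/-- The channel on the whole register performed by a gate. -/
def QGate.channel (G : QGate) (r : ℕ) (π : Equiv.Perm (Fin (G.nin + r))) :
    Matrix (Bits (G.nin + r)) (Bits (G.nin + r)) ℂ →ₗ[ℂ]
      Matrix (Bits (G.nout + r)) (Bits (G.nout + r)) ℂ :=
  trRight (Bits (G.nout + r)) (Bits G.nenv) ∘ₗ conjBy (G.op r π)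

/-- Mixed-state quantum circuits over a finite gate set, with `n` input and `m` output qubits: a
sequence of gates (the acyclic network listed in topological order), ending in a permutation of the
output wires. -/
inductive QCircuit {s : ℕ} (𝒢 : Fin s → QGate) : ℕ → ℕ → Type
  | done {n : ℕ} (π : Equiv.Perm (Fin n)) : QCircuit 𝒢 n n
  | step {m : ℕ} (g : Fin s) (r : ℕ) (π : Equiv.Perm (Fin ((𝒢 g).nin + r)))
      (rest : QCircuit 𝒢 ((𝒢 g).nout + r) m) : QCircuit 𝒢 ((𝒢 g).nin + r) m

/-- The relabelling of wires as a super-operator: output wire `i` is the input wire `π i`. -/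
def permChannel {n : ℕ} (π : Equiv.Perm (Fin n)) :
    Matrix (Bits n) (Bits n) ℂ →ₗ[ℂ] Matrix (Bits n) (Bits n) ℂ where
  toFun M := M.submatrix (fun y i => y (π.symm i)) (fun y i => y (π.symm i))
  map_add' _ _ := rfl
  map_smul' _ _ := rfl

/-- The quantum channel computed by a circuit. -/
def QCircuit.channel {s : ℕ} {𝒢 : Fin s → QGate} : {n m : ℕ} → QCircuit 𝒢 n m →
    (Matrix (Bits n) (Bits n) ℂ →ₗ[ℂ] Matrix (Bits m) (Bits m) ℂ)
  | _, _, .done π => permChannel π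
  | _, _, .step g r π rest => rest.channel ∘ₗ (𝒢 g).channel r π

/-- The description of a circuit as a list of numbers. -/
def QCircuit.code {s : ℕ} {𝒢 : Fin s → QGate} : {n m : ℕ} → QCircuit 𝒢 n m → List ℕ
  | _, _, .done π => 0 :: List.ofFn fun i => (π i : ℕ)
  | _, _, .step g r π rest =>
      1 :: (g : ℕ) :: r :: ((List.ofFn fun i => (π i : ℕ)) ++ rest.code)

/-- The description, as a bit string, of the instance formed by two circuits on `n` input qubits:
the number of input qubits, then the two circuits, each number `k` being written as `1ᵏ0`. -/
def encodeInstance {s : ℕ} {𝒢 : Fin s → QGate} {n m : ℕ} (Q₀ Q₁ : QCircuit 𝒢 n m) : List Bool :=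
  (n :: (Q₀.code ++ Q₁.code)).flatMap fun k => List.replicate k true ++ [false]

/-! ### Boolean circuits -/

/-- Gates of a Boolean circuit; wires are named by natural numbers. -/
inductive BGate
  | const (b : Bool)
  | input (i : ℕ)
  | not (u : ℕ)
  | and (u v : ℕ)
  | or (u v : ℕ)

/-- Numerical code of the kind of a gate. -/
def BGate.kind : BGate → ℕ
  | const false => 0
  | const true => 1
  | input _ => 2
  | not _ => 3
  | and _ _ => 4
  | or _ _ => 5

/-- The first wire (or the input position) of a gate. -/
def BGate.fst : BGate → ℕ
  | const _ => 0
  | input i => i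
  | not u => u
  | and u _ => u
  | or u _ => u

/-- The second wire of a gate. -/
def BGate.snd : BGate → ℕ
  | and _ v => v
  | or _ v => v
  | _ => 0

/-- The wires feeding a gate. -/
def BGate.feeds : BGate → List ℕ
  | const _ => []
  | input _ => []
  | not u => [u]
  | and u v => [u, v]
  | or u v => [u, v]

/-- Boolean circuits of fan-in two on `N` input bits, with gates `0, …, size - 1` and `numOut`
output bits. The function `level` increases strictly along wires, so the network is acyclic, and its
maximum bounds the length of every path. -/
structure BoolCircuit (N : ℕ) where
  size : ℕ
  gate : ℕ → BGate
  level : ℕ → ℕ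
  numOut : ℕ
  out : ℕ → ℕ
  feeds_lt : ∀ g < size, ∀ u ∈ (gate g).feeds, u < size ∧ level u < level g
  input_lt : ∀ g < size, ∀ i, gate g = BGate.input i → i < N
  out_lt : ∀ j < numOut, out j < size

/-- The depth of a Boolean circuit. -/
def BoolCircuit.depth {N : ℕ} (C : BoolCircuit N) : ℕ :=
  (Finset.range C.size).sup C.level

/-- The value of gate `g` on input `x`, following wires for at most `fuel` steps. -/
def BoolCircuit.valueAux {N : ℕ} (C : BoolCircuit N) (x : List Bool) : (fuel : ℕ) → (g : ℕ) → Bool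
  | 0, g =>
    match C.gate g with
    | .const b => b
    | .input i => x.getD i false
    | _ => false
  | fuel + 1, g =>
    match C.gate g with
    | .const b => b
    | .input i => x.getD i false
    | .not u => !(C.valueAux x fuel u)
    | .and u v => C.valueAux x fuel u && C.valueAux x fuel v
    | .or u v => C.valueAux x fuel u || C.valueAux x fuel v

/-- The value of gate `g` on input `x` (every path below `g` has length at most `level g`). -/
def BoolCircuit.value {N : ℕ} (C : BoolCircuit N) (x : List Bool) (g : ℕ) : Bool :=
  C.valueAux x (C.level g) g

/-- The output word of a Boolean circuit. -/
def BoolCircuit.output {N : ℕ} (C : BoolCircuit N) (x : List Bool) : List Bool :=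
  (List.range C.numOut).map fun j => C.value x (C.out j)

/-! ### Polynomial space

The machine is a register machine for programs with assignments, branching and loops. Its registers
hold natural numbers, and the space used is the bit length of the registers (a program mentions only
finitely many of them, so the longest register gives the total up to a constant factor). -/

/-- Arithmetic expressions over registers (subtraction is truncated, `a / 0 = 0`, `a % 0 = a`). -/
inductive Expr
  | const (k : ℕ)
  | reg (r : ℕ)
  | add (e f : Expr)
  | sub (e f : Expr)
  | mul (e f : Expr)
  | div (e f : Expr)
  | mod (e f : Expr)

/-- The contents of the registers. -/
abbrev Store : Type := ℕ → ℕ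

/-- The value of an expression. -/
def Expr.eval (σ : Store) : Expr → ℕ
  | const k => k
  | reg r => σ r
  | add e f => e.eval σ + f.eval σ
  | sub e f => e.eval σ - f.eval σ
  | mul e f => e.eval σ * f.eval σ
  | div e f => e.eval σ / f.eval σ
  | mod e f => e.eval σ % f.eval σ

/-- Programs. `branch r c d` runs `c` if register `r` is nonzero and `d` otherwise; `loop r c`
repeats `c` as long as register `r` is nonzero. -/
inductive Prog
  | assign (r : ℕ) (e : Expr)
  | seq (c d : Prog)
  | branch (r : ℕ) (c d : Prog)
  | loop (r : ℕ) (c : Prog)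

/-- All registers hold numbers of at most `S` bits. -/
def Store.Fits (S : ℕ) (σ : Store) : Prop := ∀ r, Nat.size (σ r) ≤ S

/-- `Runs S c σ τ`: the program `c`, started on `σ`, halts with `τ`, and every store that occurs on
the way fits in space `S`. -/
inductive Runs (S : ℕ) : Prog → Store → Store → Prop
  | assign (r : ℕ) (e : Expr) (σ : Store) (h₁ : Store.Fits S σ)
      (h₂ : Store.Fits S (Function.update σ r (e.eval σ))) :
      Runs S (.assign r e) σ (Function.update σ r (e.eval σ))
  | seq {c d : Prog} {σ τ υ : Store} (h₁ : Runs S c σ τ) (h₂ : Runs S d τ υ) :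
      Runs S (.seq c d) σ υ
  | branch_true {r : ℕ} {c d : Prog} {σ τ : Store} (h₀ : σ r ≠ 0) (h₁ : Runs S c σ τ) :
      Runs S (.branch r c d) σ τ
  | branch_false {r : ℕ} {c d : Prog} {σ τ : Store} (h₀ : σ r = 0) (h₁ : Runs S d σ τ) :
      Runs S (.branch r c d) σ τ
  | loop_stop {r : ℕ} {c : Prog} {σ : Store} (h₀ : σ r = 0) (h₁ : Store.Fits S σ) :
      Runs S (.loop r c) σ σ
  | loop_next {r : ℕ} {c : Prog} {σ τ υ : Store} (h₀ : σ r ≠ 0) (h₁ : Runs S c σ τ)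
      (h₂ : Runs S (.loop r c) τ υ) : Runs S (.loop r c) σ υ

/-- The initial store: `N` in register `0`, `a` in register `1`, all other registers `0`. -/
def Store.init (N a : ℕ) : Store := fun r => if r = 0 then N else if r = 1 then a else 0

/-- One program computes `F N a` for all `N` and all `a < bound N`, leaving it in register `0`, in
space polynomial in `N`. -/
def PolySpace (bound : ℕ → ℕ) (F : ℕ → ℕ → ℕ) : Prop :=
  ∃ (c : Prog) (p : Polynomial ℕ), ∀ N, ∀ a < bound N,
    ∃ τ, Runs (p.eval N) c (Store.init N a) τ ∧ τ 0 = F N a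

/-- Polynomial-space uniformity: the number of gates and of outputs, every gate with its wires, and
every output can be computed in space polynomial in the number `N` of input bits. -/
structure PolySpaceUniform (C : (N : ℕ) → BoolCircuit N) : Prop where
  size : PolySpace (fun _ => 1) fun N _ => (C N).size
  kind : PolySpace (fun N => (C N).size) fun N g => ((C N).gate g).kind
  fst : PolySpace (fun N => (C N).size) fun N g => ((C N).gate g).fst
  snd : PolySpace (fun N => (C N).size) fun N g => ((C N).gate g).snd
  numOut : PolySpace (fun _ => 1) fun N _ => (C N).numOut
  out : PolySpace (fun N => (C N).numOut) fun N j => (C N).out j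

/-- `NC(poly)`: polynomial-space uniform families of Boolean circuits of polynomial depth. -/
def IsNCPoly (C : (N : ℕ) → BoolCircuit N) : Prop :=
  PolySpaceUniform C ∧ ∃ p : Polynomial ℕ, ∀ N, (C N).depth ≤ p.eval N

/-! ### Representation of a super-operator by a bit string -/

/-- The number `< 2ⁿ` with the given binary digits. -/
def bitsToNat {n : ℕ} (x : Bits n) : ℕ := ∑ i : Fin n, if x i then 2 ^ (i : ℕ) else 0

/-- The integer stored at position `pos` of `w`: a sign bit, then `L` binary digits. -/
def readInt (w : List Bool) (L pos : ℕ) : ℤ :=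
  (if w.getD pos false then -1 else 1) *
    ((bitsToNat fun i : Fin L => w.getD (pos + 1 + i) false : ℕ) : ℤ)

/-- The `a`-th record of `w` consists of four integers `p, q, p', q'` and stores the complex number
`c = p / q + (p' / q') i`. -/
def StoresComplex (w : List Bool) (L a : ℕ) (c : ℂ) : Prop :=
  let field : ℕ → ℤ := fun t => readInt w L ((4 * a + t) * (L + 1))
  field 1 ≠ 0 ∧ field 3 ≠ 0 ∧
    c = (field 0 : ℂ) / (field 1 : ℂ) + (field 2 : ℂ) / (field 3 : ℂ) * Complex.I

/-- The number with the given digits (most significant first) in base `2ᵏ`. -/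
def address (k : ℕ) (digits : List ℕ) : ℕ := digits.foldl (fun acc d => acc * 2 ^ k + d) 0

/-- The word `w` is a table with `2^(8k)` records, numbers having `L` bits, that contains all entries
of the matrix of `Ξ`. The entry of `Ξ(|x₀x₁⟩⟨x₀'x₁'|)` in row `(z, q)` and column `(z', q')` is the
record whose number has the base-`2ᵏ` digits `x₀, x₁, x₀', x₁', z, q, z', q'`. -/
def RepresentsMap (w : List Bool) (k L : ℕ) {n e : ℕ}
    (Ξ : Matrix (Bits n × Bits n) (Bits n × Bits n) ℂ →ₗ[ℂ]
      Matrix (Bits e × Fin 2) (Bits e × Fin 2) ℂ) : Prop :=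
  n ≤ k ∧ e ≤ k ∧ 1 ≤ k ∧ w.length = 2 ^ (8 * k) * (4 * (L + 1)) ∧
    ∀ (x₀ x₁ x₀' x₁' : Bits n) (z z' : Bits e) (q q' : Fin 2),
      StoresComplex w L
        (address k [bitsToNat x₀, bitsToNat x₁, bitsToNat x₀', bitsToNat x₁',
          bitsToNat z, (q : ℕ), bitsToNat z', (q' : ℕ)])
        (Ξ (Matrix.single (x₀, x₁) (x₀', x₁') 1) (z, q) (z', q'))

/-! ### Polynomially bounded functions -/

/-! Equilibrium value. `Ξ` sees only the two marginals of its argument. Write them as the reduced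
states of `E * Eᴴ` and `F * Fᴴ`, and let `N₀ = spread C₀ E`, `N₁ = spread C₁ F`. Tracing out one
side of `N₀`, `N₁` gives, up to a transpose, the outputs of `Φ̃_A` and `Φ̃_B`
(`trLeft_conjBy_trRight`). Tracing out the other side gives `(Q₀ - Q₁) ⊗ 𝟙` applied to `E * Fᴴ`,
which equals `2 N₀ N₁ᴴ` (`tensorId_sub_mul_conjTranspose`): the sign in `C₁` turns a trace into a
difference. So half of the trace norm entering the diamond norm is a fidelity of the two outputs,
and the two implications are the two Fuchs-van de Graaf inequalities.

If the diamond norm is large, take nearly optimal `E`, `F` and play the product of their reduced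
states. Cauchy-Schwarz, applied to an effect and to its complement, bounds the payoff of every
effect (`hsInner_xiMap_kronecker_le`). If the diamond norm is small, every state has purified
marginals with small fidelity, and the Powers-Størmer inequality (`exists_effect_ge`) supplies an
effect with large payoff (`exists_effect_hsInner_xiMap_ge`). Existence of the value is the minimax
theorem for a bilinear payoff on compact convex sets (`exists_isEquilibriumValue`). Stinespring
isometries come from a square root of the Choi matrix.

Parallel construction. A complete binary decision tree on `N` input bits has depth linear in `N` and
exponentially many leaves. Its leaves are constants, and the uniformity machine may use polynomial
space to determine them. Hence it suffices that each single bit of the output table, as a function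
of the input and of the position of the bit, be computable in polynomial space
(`DecisionTree.isNCPoly`). The closure properties of `PSpace` and `PS` are developed for this
purpose: composition, arithmetic, recursion with short intermediate values, and sums over
exponentially long ranges.

An amplitude of a circuit is a sum over paths of intermediate registers of products of gate entries
(`amp_eq_kraus`, `amp_eq_sum_paths`), and entries of `Ξ` are short combinations of sums of products
of amplitudes (`two_mul_xiMap_single`). A common denominator `D` makes all gate entries Gaussian
integers, and padding both circuits to exactly `N` steps makes the scale `D ^ N` uniform.
Natural-number registers replace Gaussian integers by residues modulo `T ^ 2 + 1`, where `T` is a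
square root of `-1`. Evaluation at `T` and at `-T` separates real and imaginary parts. The isometry
property bounds the entries of `Ξ`, so that for large `T` the residues determine the exact integers
(`fieldRes_eq`, `eq_of_residue`). -/

theorem Polynomial.eval_nat_mono (p : Polynomial ℕ) {m n : ℕ} (h : m ≤ n) :
    p.eval m ≤ p.eval n := by
  rw [Polynomial.eval_eq_sum_range, Polynomial.eval_eq_sum_range]
  exact Finset.sum_le_sum fun i _ => Nat.mul_le_mul_left _ (Nat.pow_le_pow_left h i)

/-- The function `f` is bounded by a polynomial. -/
def PolyBdd (f : ℕ → ℕ) : Prop := ∃ p : Polynomial ℕ, ∀ n, f n ≤ p.eval n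

namespace PolyBdd

theorem eval (p : Polynomial ℕ) : PolyBdd fun n => p.eval n := ⟨p, fun _ => le_rfl⟩

theorem const (k : ℕ) : PolyBdd fun _ => k := ⟨Polynomial.C k, fun n => by simp⟩

theorem id : PolyBdd fun n => n := ⟨Polynomial.X, fun n => by simp⟩

theorem add {f g : ℕ → ℕ} (hf : PolyBdd f) (hg : PolyBdd g) : PolyBdd fun n => f n + g n := by
  obtain ⟨p, hp⟩ := hf
  obtain ⟨q, hq⟩ := hg
  exact ⟨p + q, fun n => by simpa using Nat.add_le_add (hp n) (hq n)⟩

theorem mul {f g : ℕ → ℕ} (hf : PolyBdd f) (hg : PolyBdd g) : PolyBdd fun n => f n * g n := by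
  obtain ⟨p, hp⟩ := hf
  obtain ⟨q, hq⟩ := hg
  exact ⟨p * q, fun n => by simpa using Nat.mul_le_mul (hp n) (hq n)⟩

theorem comp {f : ℕ → ℕ} (p : Polynomial ℕ) (hf : PolyBdd f) : PolyBdd fun n => p.eval (f n) := by
  obtain ⟨q, hq⟩ := hf
  exact ⟨p.comp q, fun n => by simpa using p.eval_nat_mono (hq n)⟩

end PolyBdd

/-! ### Bit lengths -/

theorem Nat.size_add_le (a b : ℕ) : Nat.size (a + b) ≤ Nat.size a + Nat.size b + 1 := by
  rw [Nat.size_le]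
  have ha : a < 2 ^ (a.size + b.size) :=
    (Nat.lt_size_self a).trans_le (Nat.pow_le_pow_right (by norm_num) (Nat.le_add_right _ _))
  have hb : b < 2 ^ (a.size + b.size) :=
    (Nat.lt_size_self b).trans_le (Nat.pow_le_pow_right (by norm_num) (Nat.le_add_left _ _))
  rw [pow_succ]
  omega

theorem Nat.size_mul_le (a b : ℕ) : Nat.size (a * b) ≤ Nat.size a + Nat.size b := by
  rw [Nat.size_le, pow_add]
  exact Nat.mul_lt_mul'' (Nat.lt_size_self a) (Nat.lt_size_self b)

/-- Since `Nat.pair a b < (max a b + 1) ^ 2`, coding tuples by pairing costs only a constant factor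
in bit length. -/
theorem Nat.size_pair_le (a b : ℕ) : Nat.size (Nat.pair a b) ≤ 2 * (Nat.size a + Nat.size b) := by
  rw [Nat.size_le]
  have ha : a < 2 ^ (a.size + b.size) :=
    (Nat.lt_size_self a).trans_le (Nat.pow_le_pow_right (by norm_num) (Nat.le_add_right _ _))
  have hb : b < 2 ^ (a.size + b.size) :=
    (Nat.lt_size_self b).trans_le (Nat.pow_le_pow_right (by norm_num) (Nat.le_add_left _ _))
  refine (Nat.pair_lt_max_add_one_sq a b).trans_le ?_
  rw [mul_comm 2, pow_mul]
  exact Nat.pow_le_pow_left (by rcases max_cases a b with h | h <;> omega) 2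

theorem Nat.size_le_self (a : ℕ) : Nat.size a ≤ a := Nat.size_le.2 Nat.lt_two_pow_self

/-! ### Basic facts on runs -/

theorem Store.Fits.mono {S S' : ℕ} (h : S ≤ S') {σ : Store} (hσ : σ.Fits S) : σ.Fits S' :=
  fun r => (hσ r).trans h

theorem Runs.mono {S S' : ℕ} (h : S ≤ S') {c : Prog} {σ τ : Store} (hr : Runs S c σ τ) :
    Runs S' c σ τ := by
  induction hr with
  | assign r e σ h₁ h₂ => exact .assign r e σ (h₁.mono h) (h₂.mono h)
  | seq _ _ i₁ i₂ => exact .seq i₁ i₂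
  | branch_true h₀ _ i => exact .branch_true h₀ i
  | branch_false h₀ _ i => exact .branch_false h₀ i
  | loop_stop h₀ h₁ => exact Runs.loop_stop h₀ (h₁.mono h)
  | loop_next h₀ _ _ i₁ i₂ => exact .loop_next h₀ i₁ i₂

theorem Runs.fits_right {S : ℕ} {c : Prog} {σ τ : Store} (hr : Runs S c σ τ) : τ.Fits S := by
  induction hr with
  | assign r e σ h₁ h₂ => exact h₂
  | seq _ _ i₁ i₂ => exact i₂
  | branch_true h₀ _ i => exact i
  | branch_false h₀ _ i => exact i
  | loop_stop h₀ h₁ => exact h₁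
  | loop_next h₀ _ _ i₁ i₂ => exact i₂

theorem Runs.fits_left {S : ℕ} {c : Prog} {σ τ : Store} (hr : Runs S c σ τ) : σ.Fits S := by
  induction hr with
  | assign r e σ h₁ h₂ => exact h₁
  | seq _ _ i₁ i₂ => exact i₁
  | branch_true h₀ _ i => exact i
  | branch_false h₀ _ i => exact i
  | loop_stop h₀ h₁ => exact h₁
  | loop_next h₀ _ _ i₁ i₂ => exact i₁

/-- Sums and products have bit length at most about the sum of the lengths of their arguments; the
other operations do not exceed their first argument. As the expression is fixed, an assignment
enlarges the space only polynomially. -/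
theorem Expr.size_eval_le (e : Expr) :
    ∃ p : Polynomial ℕ, ∀ S σ, Store.Fits S σ → Nat.size (e.eval σ) ≤ p.eval S := by
  induction e with
  | const k => exact ⟨Polynomial.C k.size, fun S σ _ => by simp [Expr.eval]⟩
  | reg r => exact ⟨Polynomial.X, fun S σ h => by simpa [Expr.eval] using h r⟩
  | add e f he hf =>
    obtain ⟨p, hp⟩ := he
    obtain ⟨q, hq⟩ := hf
    refine ⟨p + q + 1, fun S σ h => (Nat.size_add_le _ _).trans ?_⟩
    simpa using Nat.add_le_add (hp S σ h) (hq S σ h)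
  | sub e f he hf =>
    obtain ⟨p, hp⟩ := he
    exact ⟨p, fun S σ h => (Nat.size_le_size (Nat.sub_le _ _)).trans (hp S σ h)⟩
  | mul e f he hf =>
    obtain ⟨p, hp⟩ := he
    obtain ⟨q, hq⟩ := hf
    refine ⟨p + q, fun S σ h => (Nat.size_mul_le _ _).trans ?_⟩
    simpa using Nat.add_le_add (hp S σ h) (hq S σ h)
  | div e f he hf =>
    obtain ⟨p, hp⟩ := he
    exact ⟨p, fun S σ h => (Nat.size_le_size (Nat.div_le_self _ _)).trans (hp S σ h)⟩
  | mod e f he hf =>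
    obtain ⟨p, hp⟩ := he
    exact ⟨p, fun S σ h => (Nat.size_le_size (Nat.mod_le _ _)).trans (hp S σ h)⟩

/-! ### Interleaving a main store with a work area -/

/-- Renaming of the registers of an expression. -/
def Expr.rename (ρ : ℕ → ℕ) : Expr → Expr
  | const k => const k
  | reg r => reg (ρ r)
  | add e f => add (e.rename ρ) (f.rename ρ)
  | sub e f => sub (e.rename ρ) (f.rename ρ)
  | mul e f => mul (e.rename ρ) (f.rename ρ)
  | div e f => div (e.rename ρ) (f.rename ρ)
  | mod e f => mod (e.rename ρ) (f.rename ρ)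

theorem Expr.eval_rename (ρ : ℕ → ℕ) (σ : Store) (e : Expr) :
    (e.rename ρ).eval σ = e.eval (fun r => σ (ρ r)) := by
  induction e <;> simp_all [Expr.rename, Expr.eval]

/-- Renaming of the registers of a program. -/
def Prog.rename (ρ : ℕ → ℕ) : Prog → Prog
  | assign r e => assign (ρ r) (e.rename ρ)
  | seq c d => seq (c.rename ρ) (d.rename ρ)
  | branch r c d => branch (ρ r) (c.rename ρ) (d.rename ρ)
  | loop r c => loop (ρ r) (c.rename ρ)

/-- The store with `u` in the even registers and `v` in the odd registers. -/
def Store.mix (u v : Store) : Store := fun r => if r % 2 = 0 then u (r / 2) else v (r / 2)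

theorem Store.mix_even (u v : Store) (i : ℕ) : Store.mix u v (2 * i) = u i := by
  simp [Store.mix]

theorem Store.mix_odd (u v : Store) (i : ℕ) : Store.mix u v (2 * i + 1) = v i := by
  have h₁ : (2 * i + 1) % 2 = 1 := by omega
  have h₂ : (2 * i + 1) / 2 = i := by omega
  simp [Store.mix, h₁, h₂]

theorem Store.update_mix_even (u v : Store) (i a : ℕ) :
    Function.update (Store.mix u v) (2 * i) a = Store.mix (Function.update u i a) v := by
  funext r
  simp only [Function.update_apply, Store.mix]
  have : r = 2 * i ↔ r % 2 = 0 ∧ r / 2 = i := by omega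
  by_cases h : r % 2 = 0 <;> simp [this, h]

theorem Store.update_mix_odd (u v : Store) (i a : ℕ) :
    Function.update (Store.mix u v) (2 * i + 1) a = Store.mix u (Function.update v i a) := by
  funext r
  simp only [Function.update_apply, Store.mix]
  have : r = 2 * i + 1 ↔ r % 2 ≠ 0 ∧ r / 2 = i := by omega
  by_cases h : r % 2 = 0 <;> simp [this, h]

theorem Store.Fits.mix {S : ℕ} {u v : Store} (hu : u.Fits S) (hv : v.Fits S) :
    (Store.mix u v).Fits S := fun r => by
  unfold Store.mix
  split_ifs
  · exact hu _
  · exact hv _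

/-- A program renamed to the even registers cannot touch the odd ones. Together with `Runs.odd` this
provides a main store and a separate work area, hence subroutine calls. -/
theorem Runs.even {S : ℕ} {c : Prog} {u u' v : Store} (h : Runs S c u u') (hv : v.Fits S) :
    Runs S (c.rename (2 * ·)) (Store.mix u v) (Store.mix u' v) := by
  induction h with
  | assign r e σ h₁ h₂ =>
    have := Runs.assign (S := S) (2 * r) (e.rename (2 * ·)) (Store.mix σ v) (h₁.mix hv)
    simp only [Expr.eval_rename, Store.mix_even, Store.update_mix_even] at this
    exact this (h₂.mix hv)
  | seq _ _ i₁ i₂ => exact .seq i₁ i₂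
  | branch_true h₀ _ i => exact .branch_true (by simpa [Store.mix_even] using h₀) i
  | branch_false h₀ _ i => exact .branch_false (by simpa [Store.mix_even] using h₀) i
  | loop_stop h₀ h₁ => exact Runs.loop_stop (by simpa [Store.mix_even] using h₀) (h₁.mix hv)
  | loop_next h₀ _ _ i₁ i₂ => exact .loop_next (by simpa [Store.mix_even] using h₀) i₁ i₂

theorem Runs.odd {S : ℕ} {c : Prog} {u v v' : Store} (h : Runs S c v v') (hu : u.Fits S) :
    Runs S (c.rename (2 * · + 1)) (Store.mix u v) (Store.mix u v') := by
  induction h with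
  | assign r e σ h₁ h₂ =>
    have := Runs.assign (S := S) (2 * r + 1) (e.rename (2 * · + 1)) (Store.mix u σ) (hu.mix h₁)
    simp only [Expr.eval_rename, Store.mix_odd, Store.update_mix_odd] at this
    exact this (hu.mix h₂)
  | seq _ _ i₁ i₂ => exact .seq i₁ i₂
  | branch_true h₀ _ i => exact .branch_true (by simpa [Store.mix_odd] using h₀) i
  | branch_false h₀ _ i => exact .branch_false (by simpa [Store.mix_odd] using h₀) i
  | loop_stop h₀ h₁ => exact Runs.loop_stop (by simpa [Store.mix_odd] using h₀) (hu.mix h₁)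
  | loop_next h₀ _ _ i₁ i₂ => exact .loop_next (by simpa [Store.mix_odd] using h₀) i₁ i₂

/-- The store holding six given numbers in registers `0, …, 5`, followed by zeros. -/
def Store.regs (a b c d e f : ℕ) : Store
  | 0 => a
  | 1 => b
  | 2 => c
  | 3 => d
  | 4 => e
  | 5 => f
  | _ => 0

namespace Store

variable (a b c d e f x : ℕ)

@[simp] theorem regs_zero : regs a b c d e f 0 = a := rfl
@[simp] theorem regs_one : regs a b c d e f 1 = b := rfl
@[simp] theorem regs_two : regs a b c d e f 2 = c := rfl
@[simp] theorem regs_three : regs a b c d e f 3 = d := rfl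
@[simp] theorem regs_four : regs a b c d e f 4 = e := rfl
@[simp] theorem regs_five : regs a b c d e f 5 = f := rfl

@[simp] theorem update_regs_zero :
    Function.update (regs a b c d e f) 0 x = regs x b c d e f := by
  funext r; rcases r with _ | _ | _ | _ | _ | _ | r <;> (simp; try rfl)
@[simp] theorem update_regs_one :
    Function.update (regs a b c d e f) 1 x = regs a x c d e f := by
  funext r; rcases r with _ | _ | _ | _ | _ | _ | r <;> (simp; try rfl)
@[simp] theorem update_regs_two :
    Function.update (regs a b c d e f) 2 x = regs a b x d e f := by
  funext r; rcases r with _ | _ | _ | _ | _ | _ | r <;> (simp; try rfl)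
@[simp] theorem update_regs_three :
    Function.update (regs a b c d e f) 3 x = regs a b c x e f := by
  funext r; rcases r with _ | _ | _ | _ | _ | _ | r <;> (simp; try rfl)
@[simp] theorem update_regs_four :
    Function.update (regs a b c d e f) 4 x = regs a b c d x f := by
  funext r; rcases r with _ | _ | _ | _ | _ | _ | r <;> (simp; try rfl)
@[simp] theorem update_regs_five :
    Function.update (regs a b c d e f) 5 x = regs a b c d e x := by
  funext r; rcases r with _ | _ | _ | _ | _ | _ | r <;> (simp; try rfl)

variable {a b c d e f}

theorem fits_regs {S : ℕ} (ha : a.size ≤ S) (hb : b.size ≤ S) (hc : c.size ≤ S)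
    (hd : d.size ≤ S) (he : e.size ≤ S) (hf : f.size ≤ S) : Fits S (regs a b c d e f) := by
  intro r
  rcases r with _ | _ | _ | _ | _ | _ | r <;> first | assumption | exact Nat.zero_le _

/-- Doubling fixes the index `0`, so a store that is empty outside register `0` looks the same
before and after interleaving. This allows programs built from calls to be called again. -/
theorem mix_regs_zero (a : ℕ) :
    mix (regs a 0 0 0 0 0) (regs 0 0 0 0 0 0) = regs a 0 0 0 0 0 := by
  have h0 : ∀ r, regs 0 0 0 0 0 0 r = 0 := fun r => by
    rcases r with _ | _ | _ | _ | _ | _ | r <;> rfl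
  have h1 : ∀ r, r ≠ 0 → regs a 0 0 0 0 0 r = 0 := fun r hr => by
    rcases r with _ | _ | _ | _ | _ | _ | r <;> first | rfl | exact absurd rfl hr
  funext r
  unfold mix
  rcases Nat.eq_zero_or_pos r with rfl | hr
  · rfl
  · rw [h1 r hr.ne']
    split_ifs with h
    · exact h1 _ (by omega)
    · exact h0 _

end Store

/-! ### Functions computable in polynomial space -/

/-- `g` is computed by a program in space polynomial in the bit length of the argument; the program
leaves all registers but register `0` empty. -/
def PSpace (g : ℕ → ℕ) : Prop :=
  ∃ (c : Prog) (p : Polynomial ℕ), ∀ a,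
    Runs (p.eval a.size) c (Store.regs a 0 0 0 0 0) (Store.regs (g a) 0 0 0 0 0)

/-- Runs of a program whose work area is empty before and after. -/
def MainRuns (S : ℕ) (c : Prog) (u u' : Store) : Prop :=
  Runs S c (Store.mix u (Store.regs 0 0 0 0 0 0)) (Store.mix u' (Store.regs 0 0 0 0 0 0))

theorem Store.fits_zero (S : ℕ) : Store.Fits S (Store.regs 0 0 0 0 0 0) := by
  apply Store.fits_regs <;> simp

theorem Runs.main {S : ℕ} {c : Prog} {u u' : Store} (h : Runs S c u u') :
    MainRuns S (c.rename (2 * ·)) u u' :=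
  h.even (Store.fits_zero S)

theorem MainRuns.seq {S : ℕ} {c d : Prog} {u v w : Store} (h₁ : MainRuns S c u v)
    (h₂ : MainRuns S d v w) : MainRuns S (.seq c d) u w :=
  Runs.seq h₁ h₂

/-- Apply the program `c` to register `i` of the main store and put the result into register `j`. -/
def Prog.call (c : Prog) (i j : ℕ) : Prog :=
  .seq (.assign 1 (.reg (2 * i))) (.seq (c.rename (2 * · + 1))
    (.seq (.assign (2 * j) (.reg 1)) (.assign 1 (.const 0))))

/-- The callee sees the odd registers as its whole memory. It leaves only its result there, in
register `1`; clearing that register restores the empty work area, so calls can be chained. -/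
theorem MainRuns.call {S : ℕ} {c : Prog} {a b : ℕ} {u : Store} (i j : ℕ)
    (h : Runs S c (Store.regs a 0 0 0 0 0) (Store.regs b 0 0 0 0 0)) (hi : u i = a)
    (hu : u.Fits S) (hu' : Store.Fits S (Function.update u j b)) :
    MainRuns S (c.call i j) u (Function.update u j b) := by
  have e1 : ∀ (u v : Store) (x : ℕ), Function.update (Store.mix u v) 1 x =
      Store.mix u (Function.update v 0 x) := fun u v x => Store.update_mix_odd u v 0 x
  have g1 : ∀ u v : Store, Store.mix u v 1 = v 0 := fun u v => Store.mix_odd u v 0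
  refine Runs.seq (τ := Store.mix u (Store.regs a 0 0 0 0 0)) ?_
    (Runs.seq (τ := Store.mix u (Store.regs b 0 0 0 0 0)) (h.odd hu)
      (Runs.seq (τ := Store.mix (Function.update u j b) (Store.regs b 0 0 0 0 0)) ?_ ?_))
  · have := Runs.assign (S := S) 1 (.reg (2 * i)) (Store.mix u (Store.regs 0 0 0 0 0 0))
      (hu.mix (Store.fits_zero S))
    simp only [Expr.eval, Store.mix_even, e1, hi, Store.update_regs_zero] at this
    exact this (hu.mix h.fits_left)
  · have := Runs.assign (S := S) (2 * j) (.reg 1) (Store.mix u (Store.regs b 0 0 0 0 0))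
      (hu.mix h.fits_right)
    simp only [Expr.eval, g1, Store.update_mix_even, Store.regs_zero] at this
    exact this (hu'.mix h.fits_right)
  · have := Runs.assign (S := S) 1 (.const 0)
      (Store.mix (Function.update u j b) (Store.regs b 0 0 0 0 0)) (hu'.mix h.fits_right)
    simp only [Expr.eval, e1, Store.update_regs_zero] at this
    exact this (hu'.mix (Store.fits_zero S))

theorem PSpace.intro {g : ℕ → ℕ} (c : Prog) {B : ℕ → ℕ} (hB : PolyBdd B)
    (h : ∀ a, MainRuns (B a.size) c (Store.regs a 0 0 0 0 0) (Store.regs (g a) 0 0 0 0 0)) :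
    PSpace g := by
  obtain ⟨p, hp⟩ := hB
  refine ⟨c, p, fun a => ?_⟩
  have := (h a).mono (hp _)
  rwa [Store.mix_regs_zero, Store.mix_regs_zero] at this

theorem PSpace.size_le {g : ℕ → ℕ} (h : PSpace g) :
    ∃ p : Polynomial ℕ, ∀ a, (g a).size ≤ p.eval a.size := by
  obtain ⟨c, p, h⟩ := h
  exact ⟨p, fun a => by simpa using (h a).fits_right 0⟩

/-- The intermediate value sits in a register of the first program and is therefore of polynomial
length; the second program then needs the composed polynomial. -/
theorem PSpace.comp {f g : ℕ → ℕ} (hf : PSpace f) (hg : PSpace g) : PSpace fun a => f (g a) := by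
  obtain ⟨c, p, hc⟩ := hf
  obtain ⟨d, q, hd⟩ := hg
  refine ⟨.seq d c, p.comp q + q, fun a => ?_⟩
  have hs : (g a).size ≤ q.eval a.size := by simpa using (hd a).fits_right 0
  refine .seq ((hd a).mono (by simp)) ((hc (g a)).mono ?_)
  simpa using le_add_right (p.eval_nat_mono hs)

/-- Clear the registers `1, …, 5`. -/
def Prog.clear : Prog :=
  .seq (.assign 1 (.const 0)) (.seq (.assign 2 (.const 0)) (.seq (.assign 3 (.const 0))
    (.seq (.assign 4 (.const 0)) (.assign 5 (.const 0)))))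

theorem Runs.clear {S a b c d e f : ℕ} (h : Store.Fits S (Store.regs a b c d e f)) :
    Runs S .clear (Store.regs a b c d e f) (Store.regs a 0 0 0 0 0) := by
  have h0 : a.size ≤ S := h 0
  have h1 : b.size ≤ S := h 1
  have h2 : c.size ≤ S := h 2
  have h3 : d.size ≤ S := h 3
  have h4 : e.size ≤ S := h 4
  have h5 : f.size ≤ S := h 5
  have hz : Nat.size 0 ≤ S := by simp
  refine .seq (τ := Store.regs a 0 c d e f) ?_ (.seq (τ := Store.regs a 0 0 d e f) ?_
    (.seq (τ := Store.regs a 0 0 0 e f) ?_ (.seq (τ := Store.regs a 0 0 0 0 f) ?_ ?_)))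
  · simpa [Expr.eval] using Runs.assign (S := S) 1 (.const 0) (Store.regs a b c d e f) h
      (by simpa [Expr.eval] using Store.fits_regs h0 hz h2 h3 h4 h5)
  · simpa [Expr.eval] using Runs.assign (S := S) 2 (.const 0) (Store.regs a 0 c d e f)
      (Store.fits_regs h0 hz h2 h3 h4 h5)
      (by simpa [Expr.eval] using Store.fits_regs h0 hz hz h3 h4 h5)
  · simpa [Expr.eval] using Runs.assign (S := S) 3 (.const 0) (Store.regs a 0 0 d e f)
      (Store.fits_regs h0 hz hz h3 h4 h5)
      (by simpa [Expr.eval] using Store.fits_regs h0 hz hz hz h4 h5)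
  · simpa [Expr.eval] using Runs.assign (S := S) 4 (.const 0) (Store.regs a 0 0 0 e f)
      (Store.fits_regs h0 hz hz hz h4 h5)
      (by simpa [Expr.eval] using Store.fits_regs h0 hz hz hz hz h5)
  · simpa [Expr.eval] using Runs.assign (S := S) 5 (.const 0) (Store.regs a 0 0 0 0 f)
      (Store.fits_regs h0 hz hz hz hz h5)
      (by simpa [Expr.eval] using Store.fits_regs h0 hz hz hz hz hz)

/-- The binary arithmetic closure properties, as well as pairing and unpairing, are instances of
this: the argument is kept in register `0` and the two computed values in registers `1` and `2`. -/
theorem PSpace.expr {f g : ℕ → ℕ} (e : Expr) (hf : PSpace f) (hg : PSpace g) :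
    PSpace fun a => e.eval (Store.regs a (f a) (g a) 0 0 0) := by
  obtain ⟨c, p, hc⟩ := hf
  obtain ⟨d, q, hd⟩ := hg
  obtain ⟨r, hr⟩ := e.size_eval_le
  refine PSpace.intro (.seq (c.call 0 1) (.seq (d.call 0 2)
      (.seq (Prog.rename (2 * ·) (.assign 0 e)) (Prog.rename (2 * ·) .clear))))
    (B := fun n => (n + p.eval n + q.eval n) + r.eval (n + p.eval n + q.eval n))
    (((PolyBdd.id.add (.eval p)).add (.eval q)).add
      (.comp r ((PolyBdd.id.add (.eval p)).add (.eval q)))) fun a => ?_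
  have hp : (f a).size ≤ p.eval a.size := by simpa using (hc a).fits_right 0
  have hq : (g a).size ≤ q.eval a.size := by simpa using (hd a).fits_right 0
  set S₀ := a.size + p.eval a.size + q.eval a.size with hS₀
  have h0 : Nat.size 0 ≤ S₀ := by simp
  have fits₂ : Store.Fits S₀ (Store.regs a (f a) (g a) 0 0 0) := by
    apply Store.fits_regs <;> first | exact h0 | omega
  have fits₁ : Store.Fits S₀ (Store.regs a (f a) 0 0 0 0) := by
    apply Store.fits_regs <;> first | exact h0 | omega
  have fits₀ : Store.Fits S₀ (Store.regs a 0 0 0 0 0) := by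
    apply Store.fits_regs <;> first | exact h0 | omega
  have he := hr S₀ _ fits₂
  have hle : S₀ ≤ S₀ + r.eval S₀ := by omega
  have fits₃ : Store.Fits (S₀ + r.eval S₀)
      (Store.regs (e.eval (Store.regs a (f a) (g a) 0 0 0)) (f a) (g a) 0 0 0) := by
    apply Store.fits_regs <;> first | simp | omega
  refine .seq (v := Store.regs a (f a) 0 0 0 0) ?_ (.seq (v := Store.regs a (f a) (g a) 0 0 0) ?_
    (.seq (v := Store.regs (e.eval (Store.regs a (f a) (g a) 0 0 0)) (f a) (g a) 0 0 0) ?_ ?_))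
  · have := MainRuns.call (u := Store.regs a 0 0 0 0 0) 0 1
      ((hc a).mono (S' := S₀ + r.eval S₀) (by omega)) rfl
      (fits₀.mono hle) (by simpa using fits₁.mono hle)
    simpa using this
  · have := MainRuns.call (u := Store.regs a (f a) 0 0 0 0) 0 2
      ((hd a).mono (S' := S₀ + r.eval S₀) (by omega)) rfl
      (fits₁.mono hle) (by simpa using fits₂.mono hle)
    simpa using this
  · have := Runs.assign 0 e _ (fits₂.mono hle) (by simpa using fits₃)
    simpa using this.main
  · exact (Runs.clear fits₃).main

theorem PSpace.expr₁ (e : Expr) : PSpace fun a => e.eval (Store.regs a 0 0 0 0 0) := by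
  obtain ⟨r, hr⟩ := e.size_eval_le
  refine ⟨.assign 0 e, .X + r, fun a => ?_⟩
  have h : Store.Fits a.size (Store.regs a 0 0 0 0 0) := by
    apply Store.fits_regs <;> simp
  have h' : Store.Fits (a.size + r.eval a.size) (Store.regs (e.eval (Store.regs a 0 0 0 0 0)) 0 0 0 0 0) := by
    have := hr _ _ h
    apply Store.fits_regs <;> first | simp | omega
  simp only [Polynomial.eval_add, Polynomial.eval_X]
  have := Runs.assign 0 e _ (h.mono (Nat.le_add_right a.size (r.eval a.size))) (by simpa using h')
  simpa using this

theorem PSpace.id : PSpace fun a => a := PSpace.expr₁ (.reg 0)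

theorem PSpace.const (k : ℕ) : PSpace fun _ => k := PSpace.expr₁ (.const k)

/-- The pairing function as an expression. -/
def Expr.pair (e f : Expr) : Expr :=
  .add (.mul (.sub (.const 1) (.sub (.const 1) (.sub f e))) (.add (.mul f f) e))
    (.mul (.sub (.const 1) (.sub f e)) (.add (.add (.mul e e) e) f))

/-- With truncated subtraction `1 - (f - e)` is the indicator of `f ≤ e`; it selects the branch in
the definition of `Nat.pair`. -/
theorem Expr.eval_pair (σ : Store) (e f : Expr) :
    (Expr.pair e f).eval σ = Nat.pair (e.eval σ) (f.eval σ) := by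
  simp only [Expr.pair, Expr.eval, Nat.pair]
  split_ifs with h
  · have h1 : 1 - (f.eval σ - e.eval σ) = 0 := by omega
    simp [h1]
  · have h1 : f.eval σ - e.eval σ = 0 := by omega
    simp [h1]

theorem PSpace.pair {f g : ℕ → ℕ} (hf : PSpace f) (hg : PSpace g) :
    PSpace fun a => Nat.pair (f a) (g a) := by
  simpa [Expr.eval_pair, Expr.eval] using PSpace.expr (.pair (.reg 1) (.reg 2)) hf hg

/-! ### Square roots, unpairing and bounded recursion in polynomial space -/

/-- Integer square root of register `0`, searched for in register `1`. -/
def Prog.sqrt : Prog :=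
  .seq (.assign 1 (.const 0)) (.seq
    (.assign 2 (.sub (.add (.reg 0) (.const 1))
      (.mul (.add (.reg 1) (.const 1)) (.add (.reg 1) (.const 1)))))
    (.seq (.loop 2 (.seq (.assign 1 (.add (.reg 1) (.const 1)))
        (.assign 2 (.sub (.add (.reg 0) (.const 1))
          (.mul (.add (.reg 1) (.const 1)) (.add (.reg 1) (.const 1)))))))
      (.seq (.assign 0 (.reg 1)) .clear)))

/-- A linear search takes exponentially many rounds in the bit length, which is harmless because
only space is charged. -/
theorem PSpace.sqrt : PSpace Nat.sqrt := by
  refine ⟨.sqrt, .X + 1, fun a => ?_⟩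
  simp only [Polynomial.eval_add, Polynomial.eval_X, Polynomial.eval_one]
  have hfit : ∀ x s t, x ≤ a + 1 → s ≤ a + 1 → t ≤ a + 1 →
      Store.Fits (a.size + 1) (Store.regs x s t 0 0 0) := by
    have h : ∀ x, x ≤ a + 1 → x.size ≤ a.size + 1 := fun x hx =>
      (Nat.size_le_size hx).trans (by
        rw [Nat.size_le, pow_succ]
        have := Nat.lt_size_self a
        omega)
    intro x s t hx hs ht
    apply Store.fits_regs <;> apply h <;> omega
  -- Register `2` holds `a + 1 - (s + 1) ^ 2`, which is nonzero exactly when `(s + 1) ^ 2 ≤ a`.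
  -- Hence the loop stops at the square root; `d` is the number of remaining rounds.
  have hloop : ∀ d s, s + d = a.sqrt →
      Runs (a.size + 1) (.loop 2 (.seq (.assign 1 (.add (.reg 1) (.const 1)))
        (.assign 2 (.sub (.add (.reg 0) (.const 1))
          (.mul (.add (.reg 1) (.const 1)) (.add (.reg 1) (.const 1)))))))
        (Store.regs a s (a + 1 - (s + 1) * (s + 1)) 0 0 0)
        (Store.regs a a.sqrt (a + 1 - (a.sqrt + 1) * (a.sqrt + 1)) 0 0 0) := by
    have hsa := Nat.sqrt_le_self a
    intro d
    induction d with
    | zero =>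
      intro s hs
      obtain rfl : s = a.sqrt := by omega
      have := Nat.succ_le_succ_sqrt a
      exact Runs.loop_stop (by simp; omega) (hfit _ _ _ (by omega) (by omega) (by omega))
    | succ d ih =>
      intro s hs
      have h1 : (s + 1) * (s + 1) ≤ a :=
        (Nat.mul_le_mul (by omega) (by omega)).trans (Nat.sqrt_le a)
      refine .loop_next (by simp; omega) (.seq (τ := Store.regs a (s + 1)
        (a + 1 - (s + 1) * (s + 1)) 0 0 0) ?_ ?_) (ih (s + 1) (by omega))
      · simpa [Expr.eval] using Runs.assign (S := a.size + 1) 1 (.add (.reg 1) (.const 1))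
          (Store.regs a s (a + 1 - (s + 1) * (s + 1)) 0 0 0)
          (hfit _ _ _ (by omega) (by omega) (by omega))
          (by simpa [Expr.eval] using hfit _ _ _ (by omega) (by omega) (by omega))
      · simpa [Expr.eval] using Runs.assign (S := a.size + 1) 2
          (.sub (.add (.reg 0) (.const 1))
            (.mul (.add (.reg 1) (.const 1)) (.add (.reg 1) (.const 1))))
          (Store.regs a (s + 1) (a + 1 - (s + 1) * (s + 1)) 0 0 0)
          (hfit _ _ _ (by omega) (by omega) (by omega))
          (by simpa [Expr.eval] using hfit _ _ _ (by omega) (by omega) (by omega))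
  have hsa := Nat.sqrt_le_self a
  refine .seq (τ := Store.regs a 0 0 0 0 0) ?_ (.seq
    (τ := Store.regs a 0 (a + 1 - (0 + 1) * (0 + 1)) 0 0 0) ?_
    (.seq (hloop a.sqrt 0 (by omega)) (.seq
      (τ := Store.regs a.sqrt a.sqrt (a + 1 - (a.sqrt + 1) * (a.sqrt + 1)) 0 0 0) ?_
      (.clear (hfit _ _ _ (by omega) (by omega) (by omega))))))
  · simpa [Expr.eval] using Runs.assign (S := a.size + 1) 1 (.const 0) (Store.regs a 0 0 0 0 0)
      (hfit _ _ _ (by omega) (by omega) (by omega))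
      (by simpa [Expr.eval] using hfit _ _ _ (by omega) (by omega) (by omega))
  · simpa [Expr.eval] using Runs.assign (S := a.size + 1) 2
      (.sub (.add (.reg 0) (.const 1))
        (.mul (.add (.reg 1) (.const 1)) (.add (.reg 1) (.const 1))))
      (Store.regs a 0 0 0 0 0) (hfit _ _ _ (by omega) (by omega) (by omega))
      (by simpa [Expr.eval] using hfit _ _ _ (by omega) (by omega) (by omega))
  · simpa [Expr.eval] using Runs.assign (S := a.size + 1) 0 (.reg 1)
      (Store.regs a a.sqrt (a + 1 - (a.sqrt + 1) * (a.sqrt + 1)) 0 0 0)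
      (hfit _ _ _ (by omega) (by omega) (by omega))
      (by simpa [Expr.eval] using hfit _ _ _ (by omega) (by omega) (by omega))

/-- `e` if `x < y` and `f` otherwise, as an expression. -/
def Expr.iteLt (x y e f : Expr) : Expr :=
  .add (.mul (.sub (.const 1) (.sub (.const 1) (.sub y x))) e)
    (.mul (.sub (.const 1) (.sub y x)) f)

theorem Expr.eval_iteLt (σ : Store) (x y e f : Expr) :
    (Expr.iteLt x y e f).eval σ = if x.eval σ < y.eval σ then e.eval σ else f.eval σ := by
  simp only [Expr.iteLt, Expr.eval]
  split_ifs with h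
  · have h1 : 1 - (y.eval σ - x.eval σ) = 0 := by omega
    simp [h1]
  · have h1 : y.eval σ - x.eval σ = 0 := by omega
    simp [h1]

theorem PSpace.unpair_fst : PSpace fun a => a.unpair.1 := by
  convert PSpace.expr (.iteLt (.sub (.reg 0) (.mul (.reg 1) (.reg 1))) (.reg 1)
    (.sub (.reg 0) (.mul (.reg 1) (.reg 1))) (.reg 1)) PSpace.sqrt PSpace.sqrt using 2 with a
  simp only [Expr.eval_iteLt, Expr.eval, Store.regs_zero, Store.regs_one, Nat.unpair]
  split_ifs with h <;> simp only [if_pos, if_neg, h, not_false_iff]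

theorem PSpace.unpair_snd : PSpace fun a => a.unpair.2 := by
  convert PSpace.expr (.iteLt (.sub (.reg 0) (.mul (.reg 1) (.reg 1))) (.reg 1)
    (.reg 1) (.sub (.sub (.reg 0) (.mul (.reg 1) (.reg 1))) (.reg 1)))
    PSpace.sqrt PSpace.sqrt using 2 with a
  simp only [Expr.eval_iteLt, Expr.eval, Store.regs_zero, Store.regs_one, Nat.unpair]
  split_ifs with h <;> simp only [if_pos, if_neg, h, not_false_iff]

/-- Recursion: with the argument `a` in register `0`, register `1` counts up to the bound in
register `2`, and register `3` holds the current value. -/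
def Prog.recLoop (h : Prog) : Prog :=
  .loop (2 * 4) (.seq (Prog.rename (2 * ·) (.assign 5 (.pair (.reg 0) (.pair (.reg 1) (.reg 3)))))
    (.seq (h.call 5 3) (.seq (Prog.rename (2 * ·) (.assign 1 (.add (.reg 1) (.const 1))))
      (Prog.rename (2 * ·) (.assign 4 (.sub (.reg 2) (.reg 1)))))))

/-- Only the current value and a counter are stored, so the number of rounds may be exponential as
long as every intermediate value has polynomial length, which is what `hq` asks for. -/
theorem PSpace.nat_rec {b s h : ℕ → ℕ} (hb : PSpace b) (hs : PSpace s) (hh : PSpace h)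
    (hq : ∃ q : Polynomial ℕ, ∀ a, ∀ j ≤ b a,
      Nat.size (Nat.rec (s a) (fun i x => h (Nat.pair a (Nat.pair i x))) j) ≤ q.eval a.size) :
    PSpace fun a => Nat.rec (s a) (fun i x => h (Nat.pair a (Nat.pair i x))) (b a) := by
  obtain ⟨cb, pb, hcb⟩ := hb
  obtain ⟨cs, ps, hcs⟩ := hs
  obtain ⟨ch, ph, hch⟩ := hh
  obtain ⟨q, hq⟩ := hq
  -- `A` bounds the length of the argument `Nat.pair a (Nat.pair i x)` of `h`, by two applications
  -- of `Nat.size_pair_le`.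
  let A : ℕ → ℕ := fun n => 2 * (n + 2 * (pb.eval n + q.eval n))
  have hA : PolyBdd A := (PolyBdd.const 2).mul
    (PolyBdd.id.add ((PolyBdd.const 2).mul ((PolyBdd.eval pb).add (.eval q))))
  refine PSpace.intro (.seq (cb.call 0 2) (.seq (cs.call 0 3)
    (.seq (Prog.rename (2 * ·) (.assign 4 (.sub (.reg 2) (.reg 1))))
      (.seq (.recLoop ch) (.seq (Prog.rename (2 * ·) (.assign 0 (.reg 3)))
        (Prog.rename (2 * ·) .clear))))))
    (B := fun n => n + pb.eval n + ps.eval n + A n + ph.eval (A n))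
    ((((PolyBdd.id.add (.eval pb)).add (.eval ps)).add hA).add (hA.comp ph)) fun a => ?_
  let R : ℕ → ℕ := fun j => Nat.rec (s a) (fun i x => h (Nat.pair a (Nat.pair i x))) j
  have hR0 : R 0 = s a := rfl
  have hR : ∀ j, R (j + 1) = h (Nat.pair a (Nat.pair j (R j))) := fun j => rfl
  have hRs : ∀ j ≤ b a, (R j).size ≤ q.eval a.size := hq a
  have hbs : (b a).size ≤ pb.eval a.size := by simpa using (hcb a).fits_right 0
  have hss : (s a).size ≤ ps.eval a.size := by simpa using (hcs a).fits_right 0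
  have hpair : ∀ i ≤ b a, ∀ x, x.size ≤ q.eval a.size →
      (Nat.pair a (Nat.pair i x)).size ≤ A a.size := fun i hi x hx => by
    have h1 := Nat.size_pair_le a (Nat.pair i x)
    have h2 := Nat.size_pair_le i x
    have h3 := Nat.size_le_size hi
    simp only [A]
    omega
  set S := a.size + pb.eval a.size + ps.eval a.size + A a.size + ph.eval (A a.size) with hS
  have hAS : A a.size ≤ S := by omega
  have hqS : q.eval a.size ≤ S := by simp only [A] at hAS; omega
  have hpS : pb.eval a.size ≤ S := by omega
  have hfit : ∀ x0 x1 x2 x3 x4 x5, x0.size ≤ S → x1 ≤ b a → x2 ≤ b a → x3.size ≤ S → x4 ≤ b a →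
      x5.size ≤ S → Store.Fits S (Store.regs x0 x1 x2 x3 x4 x5) := by
    intro x0 x1 x2 x3 x4 x5 h0 h1 h2 h3 h4 h5
    have := Nat.size_le_size h1
    have := Nat.size_le_size h2
    have := Nat.size_le_size h4
    apply Store.fits_regs <;> omega
  have haS : a.size ≤ S := by omega
  have hzS : Nat.size 0 ≤ S := by simp
  have hsS : (s a).size ≤ S := by omega
  -- Register `4` holds the number of remaining rounds and controls the loop. Register `5` keeps the
  -- last argument of `h`, whose value is irrelevant; hence the arbitrary `t` and `t'`.
  have hloop : ∀ d i t, t.size ≤ S → i + d = b a → ∃ t', t'.size ≤ S ∧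
      MainRuns S (.recLoop ch) (Store.regs a i (b a) (R i) (b a - i) t)
        (Store.regs a (b a) (b a) (R (b a)) 0 t') := by
    intro d
    induction d with
    | zero =>
      intro i t ht hi
      obtain rfl : i = b a := by omega
      refine ⟨t, ht, ?_⟩
      rw [Nat.sub_self]
      refine Runs.loop_stop (by rw [Store.mix_even]; rfl)
        ((hfit _ _ _ _ _ _ haS le_rfl le_rfl ((hRs _ le_rfl).trans hqS) (Nat.zero_le _) ht).mix
          (Store.fits_zero S))
    | succ d ih =>
      intro i t ht hi
      have hRi := (hRs i (by omega)).trans hqS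
      have hRi' := (hRs (i + 1) (by omega)).trans hqS
      have hp := hpair i (by omega) (R i) (hRs i (by omega))
      have hpS := hp.trans hAS
      obtain ⟨t', ht', hrun⟩ := ih (i + 1) (Nat.pair a (Nat.pair i (R i))) hpS (by omega)
      refine ⟨t', ht', Runs.loop_next (by rw [Store.mix_even]; simp; omega) ?_ hrun⟩
      refine MainRuns.seq
        (v := Store.regs a i (b a) (R i) (b a - i) (Nat.pair a (Nat.pair i (R i)))) ?_
        (MainRuns.seq
          (v := Store.regs a i (b a) (R (i + 1)) (b a - i) (Nat.pair a (Nat.pair i (R i)))) ?_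
          (MainRuns.seq (v := Store.regs a (i + 1) (b a) (R (i + 1)) (b a - i)
            (Nat.pair a (Nat.pair i (R i)))) ?_ ?_))
      · have := Runs.assign (S := S) 5 (.pair (.reg 0) (.pair (.reg 1) (.reg 3)))
          (Store.regs a i (b a) (R i) (b a - i) t)
          (hfit _ _ _ _ _ _ haS (by omega) le_rfl hRi (by omega) ht)
          (by simpa [Expr.eval, Expr.eval_pair] using
            hfit _ _ _ _ _ _ haS (by omega) le_rfl hRi (by omega) hpS)
        simpa [Expr.eval, Expr.eval_pair] using this.main
      · have := MainRuns.call
          (u := Store.regs a i (b a) (R i) (b a - i) (Nat.pair a (Nat.pair i (R i)))) 5 3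
          ((hch _).mono ((ph.eval_nat_mono hp).trans (by omega : _ ≤ S))) rfl
          (hfit _ _ _ _ _ _ haS (by omega) le_rfl hRi (by omega) hpS)
          (by simpa [← hR] using hfit _ _ _ _ _ _ haS (by omega) le_rfl hRi' (by omega) hpS)
        simpa [← hR] using this
      · have := Runs.assign (S := S) 1 (.add (.reg 1) (.const 1))
          (Store.regs a i (b a) (R (i + 1)) (b a - i) (Nat.pair a (Nat.pair i (R i))))
          (hfit _ _ _ _ _ _ haS (by omega) le_rfl hRi' (by omega) hpS)
          (by simpa [Expr.eval] using
            hfit _ _ _ _ _ _ haS (by omega) le_rfl hRi' (by omega) hpS)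
        simpa [Expr.eval] using this.main
      · have := Runs.assign (S := S) 4 (.sub (.reg 2) (.reg 1))
          (Store.regs a (i + 1) (b a) (R (i + 1)) (b a - i) (Nat.pair a (Nat.pair i (R i))))
          (hfit _ _ _ _ _ _ haS (by omega) le_rfl hRi' (by omega) hpS)
          (by simpa [Expr.eval] using
            hfit _ _ _ _ _ _ haS (by omega) le_rfl hRi' (by omega) hpS)
        simpa [Expr.eval] using this.main
  obtain ⟨t', ht', hrun⟩ := hloop (b a) 0 0 hzS (by omega)
  have hRb := (hRs (b a) le_rfl).trans hqS
  have hbfit : ∀ x, x.size ≤ S → Store.Fits S (Store.regs a 0 (b a) x 0 0) := fun x hx =>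
    hfit _ _ _ _ _ _ haS (Nat.zero_le _) le_rfl hx (Nat.zero_le _) hzS
  have fits₀ : Store.Fits S (Store.regs a 0 0 0 0 0) :=
    hfit _ _ _ _ _ _ haS (Nat.zero_le _) (Nat.zero_le _) hzS (Nat.zero_le _) hzS
  refine MainRuns.seq (v := Store.regs a 0 (b a) 0 0 0) ?_
    (MainRuns.seq (v := Store.regs a 0 (b a) (s a) 0 0) ?_
      (MainRuns.seq (v := Store.regs a 0 (b a) (R 0) (b a - 0) 0) ?_
        (MainRuns.seq hrun
          (MainRuns.seq (v := Store.regs (R (b a)) (b a) (b a) (R (b a)) 0 t') ?_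
            (Runs.clear ?_).main))))
  · have := MainRuns.call (u := Store.regs a 0 0 0 0 0) 0 2 ((hcb a).mono hpS) rfl fits₀
      (by simpa using hbfit 0 hzS)
    simpa using this
  · have := MainRuns.call (u := Store.regs a 0 (b a) 0 0 0) 0 3
      ((hcs a).mono (by omega : _ ≤ S)) rfl (hbfit 0 hzS) (by simpa using hbfit _ hsS)
    simpa using this
  · have := Runs.assign (S := S) 4 (.sub (.reg 2) (.reg 1)) (Store.regs a 0 (b a) (s a) 0 0)
      (hbfit _ hsS)
      (by simpa [Expr.eval] using
        hfit _ _ _ _ _ _ haS (Nat.zero_le _) le_rfl hsS le_rfl hzS)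
    simpa [Expr.eval, hR0] using this.main
  · have := Runs.assign (S := S) 0 (.reg 3) (Store.regs a (b a) (b a) (R (b a)) 0 t')
      (hfit _ _ _ _ _ _ haS le_rfl le_rfl hRb (Nat.zero_le _) ht')
      (by simpa [Expr.eval] using
        hfit _ _ _ _ _ _ hRb le_rfl le_rfl hRb (Nat.zero_le _) ht')
    simpa [Expr.eval] using this.main
  · exact hfit _ _ _ _ _ _ hRb le_rfl le_rfl hRb (Nat.zero_le _) ht'

/-! ### Polynomial-space functions on tuples of numbers -/

/-- Bit length of the code of an element of a denumerable type. -/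
def codeSize {α : Type} [Denumerable α] (a : α) : ℕ := Nat.size (Encodable.encode a)

theorem codeSize_nat (n : ℕ) : codeSize n = n.size := rfl

theorem codeSize_fst_le {α β : Type} [Denumerable α] [Denumerable β] (a : α × β) :
    codeSize a.1 ≤ codeSize a :=
  Nat.size_le_size (by
    rw [show Encodable.encode a = Nat.pair (Encodable.encode a.1) (Encodable.encode a.2) from rfl]
    exact Nat.left_le_pair _ _)

theorem codeSize_mk_le {α β : Type} [Denumerable α] [Denumerable β] (a : α) (b : β) :
    codeSize (a, b) ≤ 2 * (codeSize a + codeSize b) :=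
  Nat.size_pair_le _ _

/-- `f` is computable in polynomial space, up to coding. -/
@[fun_prop]
def PS {α β : Type} [Denumerable α] [Denumerable β] (f : α → β) : Prop :=
  PSpace fun n => Encodable.encode (f (Denumerable.ofNat α n))

namespace PS

variable {α β γ : Type} [Denumerable α] [Denumerable β] [Denumerable γ]

@[fun_prop]
theorem id : PS fun a : α => a := by
  simpa [PS] using PSpace.id

@[fun_prop]
theorem const (b : β) : PS fun _ : α => b := PSpace.const _

@[fun_prop]
theorem comp {g : β → γ} {f : α → β} (hg : PS g) (hf : PS f) : PS fun a => g (f a) := by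
  simpa [PS] using PSpace.comp hg hf

@[fun_prop]
theorem mk {f : α → β} {g : α → γ} (hf : PS f) (hg : PS g) : PS fun a => (f a, g a) :=
  PSpace.pair hf hg

@[fun_prop]
theorem fst : PS fun a : α × β => a.1 := by
  have := PSpace.unpair_fst
  unfold PS
  convert this using 2 with n
  simp

@[fun_prop]
theorem snd : PS fun a : α × β => a.2 := by
  have := PSpace.unpair_snd
  unfold PS
  convert this using 2 with n
  simp

theorem expr {f g : α → ℕ} (e : Expr) (hf : PS f) (hg : PS g) :
    PS fun a => e.eval (Store.regs (Encodable.encode a) (f a) (g a) 0 0 0) := by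
  simpa [PS] using PSpace.expr e hf hg

@[fun_prop]
theorem add {f g : α → ℕ} (hf : PS f) (hg : PS g) : PS fun a => f a + g a :=
  expr (.add (.reg 1) (.reg 2)) hf hg

@[fun_prop]
theorem sub {f g : α → ℕ} (hf : PS f) (hg : PS g) : PS fun a => f a - g a :=
  expr (.sub (.reg 1) (.reg 2)) hf hg

@[fun_prop]
theorem mul {f g : α → ℕ} (hf : PS f) (hg : PS g) : PS fun a => f a * g a :=
  expr (.mul (.reg 1) (.reg 2)) hf hg

@[fun_prop]
theorem div {f g : α → ℕ} (hf : PS f) (hg : PS g) : PS fun a => f a / g a :=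
  expr (.div (.reg 1) (.reg 2)) hf hg

@[fun_prop]
theorem mod {f g : α → ℕ} (hf : PS f) (hg : PS g) : PS fun a => f a % g a :=
  expr (.mod (.reg 1) (.reg 2)) hf hg

theorem codeSize_le {f : α → β} (hf : PS f) :
    ∃ p : Polynomial ℕ, ∀ a, codeSize (f a) ≤ p.eval (codeSize a) := by
  obtain ⟨p, hp⟩ := PSpace.size_le hf
  exact ⟨p, fun a => by simpa [codeSize] using hp (Encodable.encode a)⟩

theorem nat_rec {b s : α → ℕ} {h : α × ℕ × ℕ → ℕ} (hb : PS b) (hs : PS s) (hh : PS h)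
    (hq : ∃ q : Polynomial ℕ, ∀ a, ∀ j ≤ b a,
      Nat.size (Nat.rec (s a) (fun i x => h (a, i, x)) j) ≤ q.eval (codeSize a)) :
    PS fun a => (Nat.rec (s a) (fun i x => h (a, i, x)) (b a) : ℕ) := by
  obtain ⟨q, hq⟩ := hq
  have := PSpace.nat_rec hb hs hh ⟨q, fun a j hj => by
    have := hq (Denumerable.ofNat α a) j hj
    simpa [codeSize] using this⟩
  simpa [PS] using this

/-- Recursion whose values are bounded by a function computable in polynomial space. -/
theorem nat_rec_of_le {b s B : α → ℕ} {h : α × ℕ × ℕ → ℕ} (hb : PS b) (hs : PS s) (hh : PS h)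
    (hB : PS B) (hq : ∀ a, ∀ j ≤ b a, (Nat.rec (s a) (fun i x => h (a, i, x)) j : ℕ) ≤ B a) :
    PS fun a => (Nat.rec (s a) (fun i x => h (a, i, x)) (b a) : ℕ) := by
  obtain ⟨q, hqB⟩ := hB.codeSize_le
  exact nat_rec hb hs hh ⟨q, fun a j hj => (Nat.size_le_size (hq a j hj)).trans (hqB a)⟩

end PS

/-- The predicate `p` is decidable in polynomial space. -/
def PSPred {α : Type} [Denumerable α] (p : α → Prop) [DecidablePred p] : Prop :=
  PS fun a => if p a then 1 else 0

section
variable {α β : Type} [Denumerable α] [Denumerable β]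

/-- The choice is made arithmetically, by multiplying both values with the indicator of `p` and its
complement. -/
theorem PS.ite {p : α → Prop} [DecidablePred p] {f g : α → ℕ} (hp : PSPred p) (hf : PS f)
    (hg : PS g) : PS fun a => if p a then f a else g a := by
  have : PS fun a => (if p a then 1 else 0) * f a + (1 - (if p a then 1 else 0)) * g a :=
    (hp.mul hf).add (((PS.const 1).sub hp).mul hg)
  convert this using 2 with a
  split_ifs <;> simp

theorem PSPred.lt {f g : α → ℕ} (hf : PS f) (hg : PS g) : PSPred fun a => f a < g a := by
  have : PS fun a => 1 - (1 - (g a - f a)) := by fun_prop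
  unfold PSPred
  convert this using 2 with a
  split_ifs <;> omega

theorem PSPred.not {p : α → Prop} [DecidablePred p] (hp : PSPred p) : PSPred fun a => ¬ p a := by
  have : PS fun a => 1 - (if p a then 1 else 0) := (PS.const 1).sub hp
  unfold PSPred
  convert this using 2 with a
  split_ifs <;> simp_all

theorem PSPred.and {p q : α → Prop} [DecidablePred p] [DecidablePred q] (hp : PSPred p)
    (hq : PSPred q) : PSPred fun a => p a ∧ q a := by
  have := PS.mul hp hq
  unfold PSPred
  convert this using 2 with a
  split_ifs <;> simp_all

theorem PSPred.congr {p q : α → Prop} [DecidablePred p] [DecidablePred q] (hp : PSPred p)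
    (h : ∀ a, q a ↔ p a) : PSPred q := by
  unfold PSPred at *
  simpa [h] using hp

theorem PSPred.le {f g : α → ℕ} (hf : PS f) (hg : PS g) : PSPred fun a => f a ≤ g a :=
  (PSPred.lt hg hf).not.congr fun a => by omega

theorem PSPred.eq {f g : α → ℕ} (hf : PS f) (hg : PS g) : PSPred fun a => f a = g a :=
  ((PSPred.le hf hg).and (PSPred.le hg hf)).congr fun a => by omega

/-- Powers with exponents bounded by a polynomial in the bit length of the data. -/
theorem PS.pow {f e : α → ℕ} (hf : PS f) (he : PS e)
    (hs : ∃ q : Polynomial ℕ, ∀ a, e a ≤ q.eval (codeSize a)) : PS fun a => f a ^ e a := by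
  obtain ⟨p, hp⟩ := hf.codeSize_le
  obtain ⟨q, hq⟩ := hs
  have key : ∀ a j, (Nat.rec 1 (fun _ x => x * f a) j : ℕ) = f a ^ j := fun a j => by
    induction j with
    | zero => rfl
    | succ j ih => rw [pow_succ, ← ih]
  have hsz : ∀ x j : ℕ, (x ^ j).size ≤ j * x.size + 1 := fun x j => by
    induction j with
    | zero => simp
    | succ j ih =>
      rw [pow_succ, Nat.succ_mul]
      have := Nat.size_mul_le (x ^ j) x
      omega
  have := PS.nat_rec (b := e) (s := fun _ => 1) (h := fun p => p.2.2 * f p.1) he (by fun_prop)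
    (by fun_prop) ⟨q * p + 1, fun a j hj => by
      dsimp only
      rw [key]
      refine (hsz _ _).trans ?_
      simpa [codeSize_nat] using Nat.mul_le_mul (hj.trans (hq a)) (hp a)⟩
  simpa [key] using this

/-- Exponentially many summands of polynomial length have a sum of polynomial length: if there are
fewer than `2 ^ k` of them, each at most `2 ^ l`, then the sum is below `2 ^ (k + l)`. This is what
makes path sums feasible. -/
theorem PS.sum {b : α → ℕ} {f : α → ℕ → ℕ} (hb : PS b) (hf : PS fun p : α × ℕ => f p.1 p.2) :
    PS fun a => ∑ i ∈ Finset.range (b a), f a i := by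
  obtain ⟨p, hp⟩ := hb.codeSize_le
  obtain ⟨q, hq⟩ := hf.codeSize_le
  have key : ∀ a j, (Nat.rec 0 (fun i x => x + f a i) j : ℕ) = ∑ i ∈ Finset.range j, f a i :=
    fun a j => by
      induction j with
      | zero => rfl
      | succ j ih => rw [Finset.sum_range_succ, ← ih]
  have hh : PS fun p : α × ℕ × ℕ => p.2.2 + f p.1 p.2.1 :=
    PS.add (by fun_prop) (hf.comp (f := fun p : α × ℕ × ℕ => (p.1, p.2.1)) (by fun_prop))
  have := PS.nat_rec (b := b) (s := fun _ => 0) (h := fun p => p.2.2 + f p.1 p.2.1) hb (by fun_prop)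
    hh ⟨p + q.comp (2 * (.X + p)), fun a j hj => by
      dsimp only
      rw [key]
      have h1 : ∀ i ∈ Finset.range j, f a i ≤ 2 ^ q.eval (2 * (codeSize a + p.eval (codeSize a))) :=
        fun i hi => by
          have hi' : codeSize i ≤ p.eval (codeSize a) :=
            (Nat.size_le_size ((Finset.mem_range.1 hi).le.trans hj)).trans (hp a)
          have h2 := (hq (a, i)).trans (q.eval_nat_mono ((codeSize_mk_le a i).trans
            (Nat.mul_le_mul_left 2 (Nat.add_le_add_left hi' _))))
          exact (Nat.size_le.1 h2).le
      rw [Nat.size_le]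
      refine (Finset.sum_le_card_nsmul _ _ _ h1).trans_lt ?_
      simp only [Finset.card_range, smul_eq_mul, Polynomial.eval_add, Polynomial.eval_comp,
        Polynomial.eval_mul, Polynomial.eval_ofNat, Polynomial.eval_X, pow_add]
      refine Nat.mul_lt_mul_of_pos_right ?_ (by positivity)
      exact Nat.size_le.1 ((Nat.size_le_size hj).trans (hp a))⟩
  simpa [key] using this

/-- Bounded iteration. -/
theorem PS.iterate {b s B : α → ℕ} {h : α → ℕ → ℕ} (hb : PS b) (hs : PS s)
    (hh : PS fun p : α × ℕ => h p.1 p.2) (hB : PS B) (hle : ∀ a, ∀ j ≤ b a, (h a)^[j] (s a) ≤ B a) :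
    PS fun a => (h a)^[b a] (s a) := by
  have key : ∀ a j, (Nat.rec (s a) (fun _ x => h a x) j : ℕ) = (h a)^[j] (s a) := fun a j => by
    induction j with
    | zero => rfl
    | succ j ih => rw [Function.iterate_succ_apply', ← ih]
  have := PS.nat_rec_of_le (h := fun p => h p.1 p.2.2) hb hs
    (hh.comp (f := fun p : α × ℕ × ℕ => (p.1, p.2.2)) (by fun_prop)) hB
    (fun a j hj => by simpa [key] using hle a j hj)
  simpa [key] using this

/-- Product over a range, reduced modulo `m` after each factor. -/
def prodMod (m : ℕ) (f : ℕ → ℕ) (n : ℕ) : ℕ := Nat.rec 1 (fun i x => x * f i % m) n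

/-- All partial products are at most `m`, so the number of factors is not restricted. Positivity of
`m` covers the empty product, which is not reduced. -/
theorem PS.prodMod {m b : α → ℕ} {f : α → ℕ → ℕ} (hm : PS m) (hb : PS b)
    (hf : PS fun p : α × ℕ => f p.1 p.2) (hm' : ∀ a, 0 < m a) :
    PS fun a => prodMod (m a) (f a) (b a) := by
  have hf' : PS fun p : α × ℕ × ℕ => f p.1 p.2.1 :=
    hf.comp (f := fun p : α × ℕ × ℕ => (p.1, p.2.1)) (by fun_prop)
  refine PS.nat_rec_of_le (h := fun p => p.2.2 * f p.1 p.2.1 % m p.1) (B := m) hb (by fun_prop)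
    ?_ hm fun a j _ => ?_
  · exact ((PS.snd.comp PS.snd).mul hf').mod (hm.comp PS.fst)
  · cases j with
    | zero => exact hm' a
    | succ j => exact (Nat.mod_lt _ (hm' a)).le

theorem prodMod_cast (m : ℕ) (f : ℕ → ℕ) (n : ℕ) :
    (prodMod m f n : ZMod m) = ∏ i ∈ Finset.range n, (f i : ZMod m) := by
  induction n with
  | zero => simp [prodMod]
  | succ n ih =>
    rw [Finset.prod_range_succ, ← ih]
    simp [prodMod]

/-- The power itself may be too long to store. Dividing `e a` times by `g a` avoids it, and the
values never exceed `f a`. This gives access to digits at arbitrary positions. -/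
theorem PS.div_pow {f g e : α → ℕ} (hf : PS f) (hg : PS g) (he : PS e) :
    PS fun a => f a / g a ^ e a := by
  have key : ∀ a j, (fun x => x / g a)^[j] (f a) = f a / g a ^ j := fun a j => by
    induction j with
    | zero => simp
    | succ j ih => rw [Function.iterate_succ_apply', ih, pow_succ, Nat.div_div_eq_div_mul]
  have := PS.iterate (h := fun a x => x / g a) he hf
    (PS.snd.div (hg.comp PS.fst)) hf (fun a j _ => by simpa [key] using Nat.div_le_self _ _)
  simpa [key] using this

@[fun_prop]
theorem PS.size : PS Nat.size := by
  have h : PS fun n : ℕ => ∑ i ∈ Finset.range n, if 0 < n / 2 ^ i then 1 else 0 :=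
    PS.sum PS.id (PSPred.lt (PS.const 0) (PS.div_pow PS.fst (PS.const 2) PS.snd))
  convert h using 2 with n
  rw [Finset.sum_boole, Nat.cast_id]
  -- The bit length counts the `i` with `2 ^ i ≤ n`, and these satisfy `i < 2 ^ i ≤ n`, so the range
  -- up to `n` contains all of them.
  have : (Finset.range n).filter (fun i => 0 < n / 2 ^ i) = Finset.range n.size := by
    ext i
    simp only [Finset.mem_filter, Finset.mem_range, Nat.lt_size]
    rw [Nat.div_pos_iff]
    have := (Nat.lt_two_pow_self (n := i))
    constructor
    · rintro ⟨-, -, h⟩; exact h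
    · intro h; exact ⟨by omega, by positivity, h⟩
  rw [this, Finset.card_range]

/-- A function with finite support is computable in polynomial space. -/
theorem PS.of_finite_support {f : ℕ → ℕ} (n : ℕ) (h : ∀ k, n ≤ k → f k = 0) : PS f := by
  have : ∀ m, PS fun k => ∑ i ∈ Finset.range m, f i * (if k = i then 1 else 0) := fun m => by
    induction m with
    | zero => simpa using PS.const 0
    | succ m ih =>
      simp only [Finset.sum_range_succ]
      exact ih.add ((PS.const _).mul (PSPred.eq PS.id (PS.const m)))
  convert this n using 2 with k
  by_cases hk : k < n
  · simp [Finset.sum_ite_eq, hk]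
  · simp [Finset.sum_ite_eq, hk, h k (by omega)]

end

/-! ### From polynomial-space functions of `2 ^ N` to `PolySpace` -/

theorem Store.init_eq_regs (N a : ℕ) : Store.init N a = Store.regs N a 0 0 0 0 := by
  funext r
  rcases r with _ | _ | _ | _ | _ | _ | r <;> simp [Store.init, Store.regs]

/-- Starting from `N` and `a` in registers `0` and `1`, leave the pair of `2 ^ N` and `a` in
register `0`. -/
def Prog.pairPow : Prog :=
  .seq (.assign 2 (.const 1)) (.seq
    (.loop 0 (.seq (.assign 2 (.mul (.const 2) (.reg 2))) (.assign 0 (.sub (.reg 0) (.const 1)))))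
    (.seq (.assign 0 (.pair (.reg 2) (.reg 1))) .clear))

theorem Runs.pairPow {S N a : ℕ} (hS : 2 * (N + 1 + a.size) ≤ S) :
    Runs S .pairPow (Store.regs N a 0 0 0 0) (Store.regs (Nat.pair (2 ^ N) a) 0 0 0 0 0) := by
  have hpow : ∀ j, j ≤ N → (2 ^ j).size ≤ S := fun j hj => by rw [Nat.size_pow]; omega
  have hN : ∀ j, j ≤ N → j.size ≤ S := fun j hj => (Nat.size_le_self j).trans (by omega)
  have hfit : ∀ x y, x ≤ N → y ≤ N → Store.Fits S (Store.regs x a (2 ^ y) 0 0 0) := by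
    intro x y hx hy
    have := hpow y hy
    have := hN x hx
    apply Store.fits_regs <;> first | simp | omega
  have hp := Nat.size_pair_le (2 ^ N) a
  rw [Nat.size_pow] at hp
  have hfit' : Store.Fits S (Store.regs (Nat.pair (2 ^ N) a) a (2 ^ N) 0 0 0) := by
    have := hpow N le_rfl
    apply Store.fits_regs <;> first | simp | omega
  have hloop : ∀ d j, j + d = N → Runs S
      (.loop 0 (.seq (.assign 2 (.mul (.const 2) (.reg 2))) (.assign 0 (.sub (.reg 0) (.const 1)))))
      (Store.regs d a (2 ^ j) 0 0 0) (Store.regs 0 a (2 ^ N) 0 0 0) := by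
    intro d
    induction d with
    | zero =>
      intro j hj
      obtain rfl : j = N := by omega
      exact Runs.loop_stop rfl (hfit _ _ (by omega) (by omega))
    | succ d ih =>
      intro j hj
      refine .loop_next (by simp) (.seq (τ := Store.regs (d + 1) a (2 ^ (j + 1)) 0 0 0) ?_ ?_)
        (ih (j + 1) (by omega))
      · have := Runs.assign (S := S) 2 (.mul (.const 2) (.reg 2))
          (Store.regs (d + 1) a (2 ^ j) 0 0 0) (hfit _ _ (by omega) (by omega))
          (by simpa [Expr.eval, ← pow_succ'] using hfit (d + 1) (j + 1) (by omega) (by omega))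
        simpa [Expr.eval, ← pow_succ'] using this
      · have := Runs.assign (S := S) 0 (.sub (.reg 0) (.const 1))
          (Store.regs (d + 1) a (2 ^ (j + 1)) 0 0 0) (hfit _ _ (by omega) (by omega))
          (by simpa [Expr.eval] using hfit d (j + 1) (by omega) (by omega))
        simpa [Expr.eval] using this
  refine .seq (τ := Store.regs N a (2 ^ 0) 0 0 0) ?_ (.seq (hloop N 0 (by omega))
    (.seq (τ := Store.regs (Nat.pair (2 ^ N) a) a (2 ^ N) 0 0 0) ?_ (Runs.clear hfit')))
  · have h0 : Store.Fits S (Store.regs N a 0 0 0 0) := by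
      have := hN N le_rfl
      apply Store.fits_regs <;> first | simp | omega
    have := Runs.assign (S := S) 2 (.const 1) (Store.regs N a 0 0 0 0) h0
      (by simpa [Expr.eval] using hfit N 0 le_rfl (by omega))
    simpa [Expr.eval] using this
  · have := Runs.assign (S := S) 0 (.pair (.reg 2) (.reg 1)) (Store.regs 0 a (2 ^ N) 0 0 0)
      (hfit _ _ (by omega) le_rfl) (by simpa [Expr.eval_pair, Expr.eval] using hfit')
    simpa [Expr.eval_pair, Expr.eval] using this

/-- Space is measured by bit length in `PS` but by the number `N` itself in `PolySpace`. Passing `2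
^ N`, of bit length `N + 1`, in place of `N` reconciles the two; the bound on `a` ensures that its
length is polynomial in `N` as well. -/
theorem PS.polySpace {G : ℕ × ℕ → ℕ} (hG : PS G) {bound : ℕ → ℕ} {F : ℕ → ℕ → ℕ}
    (hb : ∃ p : Polynomial ℕ, ∀ N, bound N ≤ 2 ^ p.eval N)
    (h : ∀ N, ∀ a < bound N, F N a = G (2 ^ N, a)) : PolySpace bound F := by
  obtain ⟨c, q, hc⟩ := hG
  obtain ⟨p, hp⟩ := hb
  obtain ⟨r, hr⟩ : PolyBdd fun N =>
      2 * (N + 1 + p.eval N) + q.eval (2 * (N + 1 + p.eval N)) := by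
    have h1 : PolyBdd fun N => 2 * (N + 1 + p.eval N) :=
      (PolyBdd.const 2).mul ((PolyBdd.id.add (.const 1)).add (.eval p))
    exact h1.add (h1.comp q)
  replace hr : ∀ N, 2 * (N + 1 + p.eval N) + q.eval (2 * (N + 1 + p.eval N)) ≤ r.eval N := hr
  refine ⟨.seq .pairPow c, r, fun N a ha => ⟨_, .seq (τ := Store.regs (Nat.pair (2 ^ N) a) 0 0 0 0 0)
    ?_ ((hc _).mono ?_), ?_⟩⟩
  · rw [Store.init_eq_regs]
    refine Runs.pairPow (le_trans ?_ (hr N))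
    have : a.size ≤ p.eval N := Nat.size_le.2 (ha.trans_le (hp N))
    omega
  · refine le_trans ?_ (hr N)
    have hs : a.size ≤ p.eval N := Nat.size_le.2 (ha.trans_le (hp N))
    have hp := Nat.size_pair_le (2 ^ N) a
    rw [Nat.size_pow] at hp
    have := q.eval_nat_mono (hp.trans (Nat.mul_le_mul_left 2 (Nat.add_le_add_left hs _)))
    exact this.trans (Nat.le_add_left _ _)
  · rw [h N a ha]
    simp

/-! ### Decision-tree circuits

For every output position `j` the circuit is a complete decision tree: the node with position
`(j, i, c)`, where `i ≤ N` and `c < 2 ^ N`, selects between the nodes `(j, i + 1, c + 2 ^ i)` and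
`(j, i + 1, c)` according to the input bit `i`; the nodes with `i = N` are constants. A node consists
of eight gates, some of them unused. -/

namespace BoolCircuit

variable {N : ℕ} {C : BoolCircuit N} {x : List Bool} {f g u v i : ℕ}

theorem valueAux_input (h : C.gate g = .input i) : C.valueAux x f g = x.getD i false := by
  cases f <;> simp [valueAux, h]

theorem valueAux_not (h : C.gate g = .not u) :
    C.valueAux x (f + 1) g = !(C.valueAux x f u) := by
  simp [valueAux, h]

theorem valueAux_and (h : C.gate g = .and u v) :
    C.valueAux x (f + 1) g = (C.valueAux x f u && C.valueAux x f v) := by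
  simp [valueAux, h]

theorem valueAux_or (h : C.gate g = .or u v) :
    C.valueAux x (f + 1) g = (C.valueAux x f u || C.valueAux x f v) := by
  simp [valueAux, h]

end BoolCircuit

namespace DecisionTree

/-- The gate `κ < 8` of the node at position `(j, i, c)`. -/
def gateId (N j i c κ : ℕ) : ℕ := ((j * (N + 1) + i) * 2 ^ N + c) * 8 + κ

/-- The output position of a gate. -/
def outPos (N g : ℕ) : ℕ := g / 8 / 2 ^ N / (N + 1)

/-- The input bit on which the node of a gate branches. -/
def bitPos (N g : ℕ) : ℕ := g / 8 / 2 ^ N % (N + 1)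

/-- The number formed by the bits that have been read at the node of a gate. -/
def prefixOf (N g : ℕ) : ℕ := g / 8 % 2 ^ N

section
variable {N j i c κ : ℕ}

theorem mod_gateId (hκ : κ < 8) : gateId N j i c κ % 8 = κ := by
  unfold gateId; omega

theorem div_gateId (hκ : κ < 8) : gateId N j i c κ / 8 = (j * (N + 1) + i) * 2 ^ N + c := by
  unfold gateId; omega

theorem prefixOf_gateId (hκ : κ < 8) (hc : c < 2 ^ N) : prefixOf N (gateId N j i c κ) = c := by
  rw [prefixOf, div_gateId hκ, mul_comm, Nat.mul_add_mod, Nat.mod_eq_of_lt hc]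

theorem div_div_gateId (hκ : κ < 8) (hc : c < 2 ^ N) :
    gateId N j i c κ / 8 / 2 ^ N = j * (N + 1) + i := by
  rw [div_gateId hκ, mul_comm, Nat.mul_add_div (by positivity), Nat.div_eq_of_lt hc, add_zero]

theorem bitPos_gateId (hκ : κ < 8) (hc : c < 2 ^ N) (hi : i < N + 1) :
    bitPos N (gateId N j i c κ) = i := by
  rw [bitPos, div_div_gateId hκ hc, mul_comm, Nat.mul_add_mod, Nat.mod_eq_of_lt hi]

theorem outPos_gateId (hκ : κ < 8) (hc : c < 2 ^ N) (hi : i < N + 1) :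
    outPos N (gateId N j i c κ) = j := by
  rw [outPos, div_div_gateId hκ hc, mul_comm, Nat.mul_add_div (by positivity),
    Nat.div_eq_of_lt hi, add_zero]

theorem gateId_lt {m : ℕ} (hκ : κ < 8) (hc : c < 2 ^ N) (hi : i < N + 1) (hj : j < m) :
    gateId N j i c κ < m * (N + 1) * 2 ^ N * 8 := by
  have h1 : j * (N + 1) + i + 1 ≤ m * (N + 1) :=
    calc j * (N + 1) + i + 1 ≤ (j + 1) * (N + 1) := by rw [Nat.succ_mul]; omega
      _ ≤ m * (N + 1) := Nat.mul_le_mul_right _ hj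
  have h2 : (j * (N + 1) + i) * 2 ^ N + c + 1 ≤ m * (N + 1) * 2 ^ N :=
    calc (j * (N + 1) + i) * 2 ^ N + c + 1 ≤ (j * (N + 1) + i + 1) * 2 ^ N := by
          rw [Nat.succ_mul]; omega
      _ ≤ m * (N + 1) * 2 ^ N := Nat.mul_le_mul_right _ h1
  unfold gateId
  omega

theorem gateId_decode (N g : ℕ) :
    gateId N (outPos N g) (bitPos N g) (prefixOf N g) (g % 8) = g := by
  unfold gateId outPos bitPos prefixOf
  rw [mul_comm _ (N + 1), Nat.div_add_mod, mul_comm _ (2 ^ N), Nat.div_add_mod, mul_comm _ 8,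
    Nat.div_add_mod]

theorem outPos_lt {m g : ℕ} (hg : g < m * (N + 1) * 2 ^ N * 8) : outPos N g < m := by
  unfold outPos
  refine Nat.div_lt_of_lt_mul (Nat.div_lt_of_lt_mul (Nat.div_lt_of_lt_mul ?_))
  linarith

end

/-- The gates of the decision tree for the functions `V c j`. -/
def gate (N : ℕ) (V : ℕ → ℕ → ℕ) (g : ℕ) : BGate :=
  if g % 8 = 0 then
    if bitPos N g = N then .const (decide (V (prefixOf N g) (outPos N g) ≠ 0))
    else .or (g + 1) (g + 2)
  else if bitPos N g = N then .const false
  else if g % 8 = 1 then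
    .and (g + 2)
      (gateId N (outPos N g) (bitPos N g + 1) ((prefixOf N g + 2 ^ bitPos N g) % 2 ^ N) 0)
  else if g % 8 = 2 then .and (g + 2) (gateId N (outPos N g) (bitPos N g + 1) (prefixOf N g) 0)
  else if g % 8 = 3 then .input (bitPos N g)
  else if g % 8 = 4 then .not (g - 1)
  else .const false

/-- The height of a gate. -/
def level (N g : ℕ) : ℕ :=
  if g % 8 = 0 then 4 * (N - bitPos N g)
  else if g % 8 = 1 ∨ g % 8 = 2 then 4 * (N - bitPos N g) - 1
  else if g % 8 = 4 then 1 else 0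

theorem level_gateId {N j i c κ : ℕ} (hκ : κ < 8) (hc : c < 2 ^ N) (hi : i < N + 1) :
    level N (gateId N j i c κ) = if κ = 0 then 4 * (N - i)
      else if κ = 1 ∨ κ = 2 then 4 * (N - i) - 1 else if κ = 4 then 1 else 0 := by
  unfold level
  rw [mod_gateId hκ, bitPos_gateId hκ hc hi]

theorem gate_gateId {N j i c κ : ℕ} {V : ℕ → ℕ → ℕ} (hκ : κ < 8) (hc : c < 2 ^ N)
    (hi : i < N + 1) : gate N V (gateId N j i c κ) =
      if κ = 0 then
        if i = N then .const (decide (V c j ≠ 0))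
        else .or (gateId N j i c κ + 1) (gateId N j i c κ + 2)
      else if i = N then .const false
      else if κ = 1 then .and (gateId N j i c κ + 2) (gateId N j (i + 1) ((c + 2 ^ i) % 2 ^ N) 0)
      else if κ = 2 then .and (gateId N j i c κ + 2) (gateId N j (i + 1) c 0)
      else if κ = 3 then .input i
      else if κ = 4 then .not (gateId N j i c κ - 1)
      else .const false := by
  unfold gate
  rw [mod_gateId hκ, bitPos_gateId hκ hc hi, outPos_gateId hκ hc hi, prefixOf_gateId hκ hc]

theorem gateId_add (N j i c κ a : ℕ) : gateId N j i c κ + a = gateId N j i c (κ + a) := by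
  unfold gateId; omega

theorem gateId_four_sub (N j i c : ℕ) : gateId N j i c 4 - 1 = gateId N j i c 3 := by
  unfold gateId; omega

/-- Within a node the levels are `0` for the input, `1` for its negation, `4 (N - i) - 1` for the
conjunctions and `4 (N - i)` for the root, while the roots of the two sons have level `4 (N - i) -
4`. -/
theorem feeds_lt {N m : ℕ} (V : ℕ → ℕ → ℕ) {g : ℕ} (hg : g < m * (N + 1) * 2 ^ N * 8) :
    ∀ u ∈ (gate N V g).feeds, u < m * (N + 1) * 2 ^ N * 8 ∧ level N u < level N g := by
  have hc : prefixOf N g < 2 ^ N := Nat.mod_lt _ (by positivity)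
  have hi : bitPos N g < N + 1 := Nat.mod_lt _ (by positivity)
  have hj := outPos_lt hg
  have hκ : g % 8 < 8 := Nat.mod_lt _ (by norm_num)
  rw [← gateId_decode N g]
  generalize prefixOf N g = c at *
  generalize bitPos N g = i at *
  generalize outPos N g = j at *
  generalize g % 8 = κ at *
  have hc' : (c + 2 ^ i) % 2 ^ N < 2 ^ N := Nat.mod_lt _ (by positivity)
  rw [gate_gateId hκ hc hi, level_gateId hκ hc hi]
  have key : ∀ κ' < 8, gateId N j i c κ' < m * (N + 1) * 2 ^ N * 8 := fun κ' h =>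
    gateId_lt h hc hi hj
  by_cases hN : i = N
  · simp only [hN, if_true]
    split_ifs <;> simp [BGate.feeds]
  · have hi' : i + 1 < N + 1 := by omega
    simp only [hN, if_false]
    interval_cases κ <;> simp only [BGate.feeds, gateId_add, gateId_four_sub, List.mem_cons,
      List.not_mem_nil, or_false, forall_eq_or_imp, forall_eq, false_imp_iff, implies_true,
      if_true, if_false, OfNat.ofNat_ne_zero, Nat.reduceEqDiff, Nat.reduceAdd,
      one_ne_zero, OfNat.ofNat_ne_one, or_true, OfNat.one_ne_ofNat]
    · exact ⟨⟨key _ (by norm_num), by rw [level_gateId (by norm_num) hc hi]; norm_num; omega⟩,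
        key _ (by norm_num), by rw [level_gateId (by norm_num) hc hi]; norm_num; omega⟩
    · exact ⟨⟨key _ (by norm_num), by rw [level_gateId (by norm_num) hc hi]; norm_num; omega⟩,
        gateId_lt (by norm_num) hc' hi' hj, by
          rw [level_gateId (by norm_num) hc' hi']; norm_num; omega⟩
    · exact ⟨⟨key _ (by norm_num), by rw [level_gateId (by norm_num) hc hi]; norm_num; omega⟩,
        gateId_lt (by norm_num) hc hi' hj, by
          rw [level_gateId (by norm_num) hc hi']; norm_num; omega⟩
    · exact ⟨key _ (by norm_num), by rw [level_gateId (by norm_num) hc hi]; norm_num⟩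

/-- The decision tree with `m` outputs on `N` input bits. -/
def circuit (N m : ℕ) (V : ℕ → ℕ → ℕ) : BoolCircuit N where
  size := m * (N + 1) * 2 ^ N * 8
  gate := gate N V
  level := level N
  numOut := m
  out j := gateId N j 0 0 0
  feeds_lt g hg := feeds_lt V hg
  input_lt g _ i h := by
    have hi : bitPos N g < N + 1 := Nat.mod_lt _ (by positivity)
    unfold gate at h
    split_ifs at h
    simp only [BGate.input.injEq] at h
    omega
  out_lt j hj := gateId_lt (by norm_num) (by positivity) (by omega) hj

theorem depth_circuit_le (N m : ℕ) (V : ℕ → ℕ → ℕ) : (circuit N m V).depth ≤ 4 * N + 1 := by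
  refine Finset.sup_le fun g _ => ?_
  change level N g ≤ _
  unfold level
  split_ifs <;> omega

/-- The number formed by the bits of `x` from position `i` on. -/
def tailValue (x : List Bool) (N i : ℕ) : ℕ :=
  ∑ t ∈ Finset.Ico i N, if x.getD t false then 2 ^ t else 0

/-- Invariant of the tree: the digits already read are in `c`, and those still unread contribute
`tailValue x N i`. The reduction modulo `2 ^ N` is vacuous on paths from the root; it only gives the
unreachable nodes legal successors. -/
theorem valueAux_circuit {N m : ℕ} {V : ℕ → ℕ → ℕ} (x : List Bool) (j : ℕ) :
    ∀ d i c fuel, i + d = N → c < 2 ^ N → 4 * d ≤ fuel →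
      (circuit N m V).valueAux x fuel (gateId N j i c 0) =
        decide (V ((c + tailValue x N i) % 2 ^ N) j ≠ 0) := by
  intro d
  induction d with
  | zero =>
    intro i c fuel hi hc _
    obtain rfl : i = N := by omega
    have hg : (circuit i m V).gate (gateId i j i c 0) = .const (decide (V c j ≠ 0)) := by
      change gate i V _ = _
      rw [gate_gateId (by norm_num) hc (by omega)]
      simp
    have ht : tailValue x i i = 0 := by simp [tailValue]
    cases fuel <;> simp [BoolCircuit.valueAux, hg, ht, Nat.mod_eq_of_lt hc]
  | succ d ih =>
    intro i c fuel hi hc hf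
    obtain ⟨f, rfl⟩ : ∃ f, fuel = f + 4 := ⟨fuel - 4, by omega⟩
    have hN : i ≠ N := by omega
    have g0 : (circuit N m V).gate (gateId N j i c 0) =
        .or (gateId N j i c 1) (gateId N j i c 2) := by
      change gate N V _ = _
      rw [gate_gateId (by norm_num) hc (by omega)]
      simp [hN, gateId_add]
    have g1 : (circuit N m V).gate (gateId N j i c 1) =
        .and (gateId N j i c 3) (gateId N j (i + 1) ((c + 2 ^ i) % 2 ^ N) 0) := by
      change gate N V _ = _
      rw [gate_gateId (by norm_num) hc (by omega)]
      simp [hN, gateId_add]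
    have g2 : (circuit N m V).gate (gateId N j i c 2) =
        .and (gateId N j i c 4) (gateId N j (i + 1) c 0) := by
      change gate N V _ = _
      rw [gate_gateId (by norm_num) hc (by omega)]
      simp [hN, gateId_add]
    have g3 : (circuit N m V).gate (gateId N j i c 3) = .input i := by
      change gate N V _ = _
      rw [gate_gateId (by norm_num) hc (by omega)]
      simp [hN]
    have g4 : (circuit N m V).gate (gateId N j i c 4) = .not (gateId N j i c 3) := by
      change gate N V _ = _
      rw [gate_gateId (by norm_num) hc (by omega)]
      simp [hN, gateId_four_sub]
    have ht : tailValue x N i = (if x.getD i false then 2 ^ i else 0) + tailValue x N (i + 1) := by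
      unfold tailValue
      rw [Finset.sum_eq_sum_Ico_succ_bot (by omega)]
    have e1 := ih (i + 1) ((c + 2 ^ i) % 2 ^ N) (f + 2) (by omega)
      (Nat.mod_lt _ (by positivity)) (by omega)
    have e2 := ih (i + 1) c (f + 2) (by omega) hc (by omega)
    rw [BoolCircuit.valueAux_or g0, BoolCircuit.valueAux_and g1, BoolCircuit.valueAux_and g2,
      BoolCircuit.valueAux_input g3, BoolCircuit.valueAux_not g4, BoolCircuit.valueAux_input g3, e1,
      e2, ht]
    cases x.getD i false <;> simp [add_assoc]

theorem output_circuit {N m : ℕ} {V : ℕ → ℕ → ℕ} (x : List Bool) :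
    (circuit N m V).output x =
      (List.range m).map fun j => decide (V (tailValue x N 0) j ≠ 0) := by
  have hlt : tailValue x N 0 < 2 ^ N := by
    unfold tailValue
    calc ∑ t ∈ Finset.Ico 0 N, (if x.getD t false then 2 ^ t else 0)
        ≤ ∑ t ∈ Finset.range N, 2 ^ t := by
          rw [← Nat.Ico_zero_eq_range]
          exact Finset.sum_le_sum fun t _ => by split_ifs <;> simp
      _ < 2 ^ N := Nat.geomSum_lt (by norm_num) (fun k hk => by simpa using hk)
  refine List.map_congr_left fun j hj => ?_
  have hl : (circuit N m V).level (gateId N j 0 0 0) = 4 * N := by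
    change level N _ = _
    rw [level_gateId (by norm_num) (by positivity) (by omega)]
    simp
  change (circuit N m V).valueAux x ((circuit N m V).level (gateId N j 0 0 0))
    (gateId N j 0 0 0) = _
  rw [hl, valueAux_circuit x j N 0 0 _ (by omega) (by positivity) le_rfl, zero_add,
    Nat.mod_eq_of_lt hlt]

end DecisionTree

/-! ### Uniformity of decision trees -/

namespace DecisionTree

theorem size_two_pow_sub (N : ℕ) : Nat.size (2 ^ N) - 1 = N := by rw [Nat.size_pow]; rfl

theorem ps_gateId {α : Type} [Denumerable α] {w j i c : α → ℕ} (κ : ℕ) (hw : PS w) (hj : PS j)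
    (hi : PS i) (hc : PS c) :
    PS fun a => ((j a * (w a).size + i a) * w a + c a) * 8 + κ :=
  (((((hj.mul (PS.size.comp hw)).add hi).mul hw).add hc).mul (PS.const 8)).add (PS.const κ)

/-- The tree itself does no computation. The values of `V` are constants at its leaves, and the
uniformity condition grants polynomial space for finding them. -/
theorem isNCPoly {M : ℕ → ℕ} {V : ℕ × ℕ × ℕ → ℕ} (hM : PS M) (hV : PS V) :
    IsNCPoly fun N => circuit N (M (2 ^ N)) fun c j => V (2 ^ N, c, j) := by
  obtain ⟨q, hq⟩ := hM.codeSize_le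
  have hMle : ∀ N, M (2 ^ N) ≤ 2 ^ q.eval (N + 1) := fun N => by
    have := hq (2 ^ N)
    rw [codeSize_nat, codeSize_nat, Nat.size_pow] at this
    exact (Nat.size_le.1 this).le
  have hnum : ∃ p : Polynomial ℕ, ∀ N, M (2 ^ N) ≤ 2 ^ p.eval N :=
    ⟨q.comp (.X + 1), fun N => by simpa using hMle N⟩
  have hsize : ∃ p : Polynomial ℕ, ∀ N, M (2 ^ N) * (N + 1) * 2 ^ N * 8 ≤ 2 ^ p.eval N :=
    ⟨q.comp (.X + 1) + .X + .X + 3, fun N => by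
      have h1 : N + 1 ≤ 2 ^ N := Nat.lt_two_pow_self
      simp only [Polynomial.eval_add, Polynomial.eval_comp, Polynomial.eval_X, Polynomial.eval_one,
        Polynomial.eval_ofNat, pow_add]
      exact Nat.mul_le_mul (Nat.mul_le_mul_right _ (Nat.mul_le_mul (hMle N) h1)) (by norm_num)⟩
  have hone : ∃ p : Polynomial ℕ, ∀ N : ℕ, 1 ≤ 2 ^ p.eval N := ⟨0, fun N => by simp⟩
  -- The coordinates of a gate `g` are recovered from the pair `(2 ^ N, g)`, where `N + 1` is the
  -- bit length of the first component.
  let κ : ℕ × ℕ → ℕ := fun p => p.2 % 8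
  let bp : ℕ × ℕ → ℕ := fun p => p.2 / 8 / p.1 % p.1.size
  let op : ℕ × ℕ → ℕ := fun p => p.2 / 8 / p.1 / p.1.size
  let pr : ℕ × ℕ → ℕ := fun p => p.2 / 8 % p.1
  let n : ℕ × ℕ → ℕ := fun p => p.1.size - 1
  have hκ : PS κ := by simp only [κ]; fun_prop
  have hbp : PS bp := by simp only [bp]; fun_prop
  have hop : PS op := by simp only [op]; fun_prop
  have hpr : PS pr := by simp only [pr]; fun_prop
  have hn : PS n := by simp only [n]; fun_prop
  have hκi : ∀ i, PSPred fun p => κ p = i := fun i => PSPred.eq hκ (PS.const i)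
  have hb : PSPred fun p => bp p = n p := PSPred.eq hbp hn
  have eκ : ∀ N g, κ (2 ^ N, g) = g % 8 := fun N g => rfl
  have ebp : ∀ N g, bp (2 ^ N, g) = bitPos N g := fun N g => by
    simp only [bp, bitPos, Nat.size_pow]
  have eop : ∀ N g, op (2 ^ N, g) = outPos N g := fun N g => by
    simp only [op, outPos, Nat.size_pow]
  have epr : ∀ N g, pr (2 ^ N, g) = prefixOf N g := fun N g => rfl
  have en : ∀ N g, n (2 ^ N, g) = N := fun N g => size_two_pow_sub N
  have hpow : PS fun p => 2 ^ bp p := by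
    refine PS.pow (PS.const 2) hbp ⟨.X, fun p => ?_⟩
    rw [Polynomial.eval_X]
    refine le_trans ?_ (codeSize_fst_le p)
    rw [codeSize_nat]
    -- The bound is required for all pairs, also for `p.1 = 0`, which is not a power of two; there
    -- division by zero gives `bp p = 0`.
    rcases Nat.eq_zero_or_pos p.1 with h | h
    · simp [bp, h]
    · exact (Nat.mod_lt _ (Nat.size_pos.2 h)).le
  have hleft : PS fun p : ℕ × ℕ =>
      ((op p * p.1.size + (bp p + 1)) * p.1 + (pr p + 2 ^ bp p) % p.1) * 8 + 0 :=
    ps_gateId 0 PS.fst hop (hbp.add (PS.const 1)) ((hpr.add hpow).mod PS.fst)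
  have hright : PS fun p : ℕ × ℕ =>
      ((op p * p.1.size + (bp p + 1)) * p.1 + pr p) * 8 + 0 :=
    ps_gateId 0 PS.fst hop (hbp.add (PS.const 1)) hpr
  have hval : PSPred fun p : ℕ × ℕ => V (p.1, pr p, op p) = 0 :=
    PSPred.eq (hV.comp (by fun_prop)) (PS.const 0)
  have hg : PS fun p : ℕ × ℕ => p.2 := PS.snd
  refine ⟨⟨?_, ?_, ?_, ?_, ?_, ?_⟩, ⟨4 * .X + 1, fun N => ?_⟩⟩
  · refine PS.polySpace (G := fun p => M p.1 * p.1.size * p.1 * 8) (by fun_prop) hone fun N a _ => ?_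
    simp only [circuit, Nat.size_pow]
  · refine PS.polySpace
      (PS.ite (hκi 0) (PS.ite hb (PS.ite hval (PS.const 0) (PS.const 1)) (PS.const 5))
        (PS.ite hb (PS.const 0) (PS.ite (hκi 1) (PS.const 4) (PS.ite (hκi 2) (PS.const 4)
          (PS.ite (hκi 3) (PS.const 2) (PS.ite (hκi 4) (PS.const 3) (PS.const 0)))))))
      hsize fun N g _ => ?_
    simp only [eκ, ebp, eop, epr, en, circuit, gate]
    split_ifs <;> simp_all [BGate.kind]
  · refine PS.polySpace
      (PS.ite (hκi 0) (PS.ite hb (PS.const 0) (hg.add (PS.const 1)))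
        (PS.ite hb (PS.const 0) (PS.ite (hκi 1) (hg.add (PS.const 2)) (PS.ite (hκi 2)
          (hg.add (PS.const 2)) (PS.ite (hκi 3) hbp (PS.ite (hκi 4) (hg.sub (PS.const 1))
            (PS.const 0)))))))
      hsize fun N g _ => ?_
    simp only [eκ, ebp, en, circuit, gate]
    split_ifs <;> simp_all [BGate.fst]
  · refine PS.polySpace
      (PS.ite (hκi 0) (PS.ite hb (PS.const 0) (hg.add (PS.const 2)))
        (PS.ite hb (PS.const 0) (PS.ite (hκi 1) hleft (PS.ite (hκi 2) hright (PS.const 0)))))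
      hsize fun N g _ => ?_
    simp only [eκ, ebp, eop, epr, en, circuit, gate, gateId, Nat.size_pow]
    split_ifs <;> simp_all [BGate.snd]
  · exact PS.polySpace (G := fun p => M p.1) (by fun_prop) hone fun N a _ => rfl
  · refine PS.polySpace (ps_gateId 0 PS.fst PS.snd (PS.const 0) (PS.const 0)) hnum fun N j _ => ?_
    simp only [circuit, gateId, Nat.size_pow]
  · simpa using depth_circuit_le N _ _

end DecisionTree

/-! ### Binary digits -/

/-- The binary digit of `X` at position `t`. -/
def bitAt (X t : ℕ) : ℕ := X / 2 ^ t % 2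

theorem bitAt_eq_toNat (X t : ℕ) : bitAt X t = (X.testBit t).toNat := by
  rw [Nat.testBit_eq_decide_div_mod_eq, bitAt]
  rcases Nat.mod_two_eq_zero_or_one (X / 2 ^ t) with h | h <;> simp [h]

theorem bitsToNat_eq_ofBits {n : ℕ} (x : Bits n) : bitsToNat x = Nat.ofBits x := by
  induction n with
  | zero => simp [bitsToNat]
  | succ n ih =>
    rw [Nat.ofBits_succ, ← ih, bitsToNat, Fin.sum_univ_succ, bitsToNat, Finset.mul_sum, add_comm]
    congr 1
    · refine Finset.sum_congr rfl fun i _ => ?_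
      simp only [Function.comp, Fin.val_succ, pow_succ']
      split_ifs <;> simp
    · cases x 0 <;> simp

theorem bitsToNat_lt {n : ℕ} (x : Bits n) : bitsToNat x < 2 ^ n := by
  rw [bitsToNat_eq_ofBits]; exact Nat.ofBits_lt_two_pow x

theorem testBit_bitsToNat {n : ℕ} (x : Bits n) (i : Fin n) : (bitsToNat x).testBit i = x i := by
  rw [bitsToNat_eq_ofBits, Nat.testBit_ofBits_lt x i i.2]

theorem bitAt_bitsToNat {n : ℕ} (x : Bits n) (i : Fin n) :
    bitAt (bitsToNat x) i = (x i).toNat := by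
  rw [bitAt_eq_toNat, testBit_bitsToNat]

theorem bitsToNat_injective {n : ℕ} : Function.Injective (bitsToNat (n := n)) := fun x y h => by
  funext i
  rw [← testBit_bitsToNat x, ← testBit_bitsToNat y, h]

/-- The first `n` binary digits of a number. -/
def natBits (n w : ℕ) : Bits n := fun i => w.testBit i

theorem bitsToNat_natBits (n w : ℕ) : bitsToNat (natBits n w) = w % 2 ^ n := by
  rw [bitsToNat_eq_ofBits]; exact Nat.ofBits_testBit w n

theorem natBits_bitsToNat {n : ℕ} (x : Bits n) : natBits n (bitsToNat x) = x :=
  funext fun i => testBit_bitsToNat x i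

theorem sum_bitsToNat {R : Type*} [AddCommMonoid R] {n : ℕ} (f : ℕ → R) :
    ∑ x : Bits n, f (bitsToNat x) = ∑ w ∈ Finset.range (2 ^ n), f w := by
  refine Finset.sum_bij (fun x _ => bitsToNat x) (fun x _ => Finset.mem_range.2 (bitsToNat_lt x))
    (fun x _ y _ h => bitsToNat_injective h) (fun w hw => ⟨natBits n w, Finset.mem_univ _, ?_⟩)
    (fun x _ => rfl)
  rw [bitsToNat_natBits, Nat.mod_eq_of_lt (Finset.mem_range.1 hw)]

theorem bitsToNat_eq_sum_range {n : ℕ} (x : Bits n) {f : ℕ → ℕ}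
    (h : ∀ i : Fin n, f i = (x i).toNat) :
    bitsToNat x = ∑ i ∈ Finset.range n, f i * 2 ^ i := by
  rw [Finset.sum_range, bitsToNat]
  refine Finset.sum_congr rfl fun i _ => ?_
  rw [h]
  cases x i <;> simp

theorem bitsToNat_append {m n : ℕ} (x : Bits (m + n)) :
    bitsToNat x = bitsToNat (fun i : Fin m => x (Fin.castAdd n i)) +
      2 ^ m * bitsToNat (fun i : Fin n => x (Fin.natAdd m i)) := by
  rw [bitsToNat, Fin.sum_univ_add, bitsToNat, bitsToNat, Finset.mul_sum]
  congr 1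
  refine Finset.sum_congr rfl fun i _ => ?_
  simp only [Fin.val_natAdd, pow_add]
  split_ifs <;> simp

theorem bitAt_tailValue {x : List Bool} {N t : ℕ} (ht : t < N) :
    bitAt (DecisionTree.tailValue x N 0) t = (x.getD t false).toNat := by
  have h : DecisionTree.tailValue x N 0 = bitsToNat (fun i : Fin N => x.getD i false) := by
    rw [DecisionTree.tailValue, Nat.Ico_zero_eq_range, Finset.sum_range, bitsToNat]
  rw [h]
  exact bitAt_bitsToNat _ ⟨t, ht⟩

/-! ### Parsing sequences of numbers in unary notation -/

/-- The number of zeros among the digits of `X` before position `t`. -/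
def zerosBefore (X t : ℕ) : ℕ := ∑ s ∈ Finset.range t, (1 - bitAt X s)

/-- The entry `k` of the sequence of numbers whose unary notation is given by the first `N` binary
digits of `X`: the number of ones that have exactly `k` zeros before them. -/
def numAt (N X k : ℕ) : ℕ :=
  ∑ t ∈ Finset.range N, if zerosBefore X t = k ∧ bitAt X t = 1 then 1 else 0

theorem numAt_le (N X k : ℕ) : numAt N X k ≤ N := by
  unfold numAt
  rw [Finset.sum_boole]
  simpa using Finset.card_filter_le (Finset.range N) _

/-- The unary notation of a sequence of numbers. -/
def unary (l : List ℕ) : List Bool := l.flatMap fun k => List.replicate k true ++ [false]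

theorem unary_cons (a : ℕ) (l : List ℕ) :
    unary (a :: l) = List.replicate a true ++ false :: unary l := by
  simp [unary]

theorem length_unary_cons (a : ℕ) (l : List ℕ) :
    (unary (a :: l)).length = a + 1 + (unary l).length := by
  rw [unary_cons]; simp; ring

theorem length_le_length_unary (l : List ℕ) : l.length ≤ (unary l).length := by
  induction l with
  | nil => simp
  | cons a l ih => rw [length_unary_cons]; simp; omega

theorem getD_unary_lt {a t : ℕ} (l : List ℕ) (h : t < a) :
    (unary (a :: l)).getD t false = true := by
  rw [unary_cons, List.getD_append _ _ _ _ (by simpa using h)]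
  simp [List.getD_eq_getElem?_getD, h]

theorem getD_unary_eq (a : ℕ) (l : List ℕ) : (unary (a :: l)).getD a false = false := by
  rw [unary_cons, List.getD_append_right _ _ _ _ (by simp)]
  simp

theorem getD_unary_gt (a t : ℕ) (l : List ℕ) :
    (unary (a :: l)).getD (a + 1 + t) false = (unary l).getD t false := by
  rw [unary_cons, List.getD_append_right _ _ _ _ (by simp; omega)]
  simp [show a + 1 + t - a = t + 1 by omega]

/-- The leading block consists of `a` ones with no zero before them; its closing zero raises the
count of zeros by one at every later position, which shifts the index `k`. -/
theorem sum_getD_unary (l : List ℕ) : ∀ k, ∑ t ∈ Finset.range (unary l).length,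
    (if ∑ s ∈ Finset.range t, (1 - ((unary l).getD s false).toNat) = k ∧
      ((unary l).getD t false).toNat = 1 then 1 else 0) = l.getD k 0 := by
  induction l with
  | nil => intro k; simp [unary]
  | cons a l ih =>
    intro k
    have hz : ∀ t ≤ a, ∑ s ∈ Finset.range t, (1 - ((unary (a :: l)).getD s false).toNat) = 0 :=
      fun t ht => Finset.sum_eq_zero fun s hs => by
        rw [getD_unary_lt l ((Finset.mem_range.1 hs).trans_le ht)]; rfl
    have hz' : ∀ t, ∑ s ∈ Finset.range (a + 1 + t), (1 - ((unary (a :: l)).getD s false).toNat) =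
        1 + ∑ s ∈ Finset.range t, (1 - ((unary l).getD s false).toNat) := fun t => by
      rw [Finset.sum_range_add, Finset.sum_range_succ, hz a le_rfl, getD_unary_eq]
      simp only [getD_unary_gt]
      rfl
    rw [length_unary_cons, Finset.sum_range_add, Finset.sum_range_succ, getD_unary_eq]
    simp only [hz', getD_unary_gt]
    have h1 : ∑ t ∈ Finset.range a,
        (if ∑ s ∈ Finset.range t, (1 - ((unary (a :: l)).getD s false).toNat) = k ∧
          ((unary (a :: l)).getD t false).toNat = 1 then 1 else 0) = if k = 0 then a else 0 := by
      rw [Finset.sum_congr rfl (g := fun _ => if k = 0 then 1 else 0) fun t ht => ?_]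
      · split_ifs <;> simp
      · rw [hz t (Finset.mem_range.1 ht).le, getD_unary_lt l (Finset.mem_range.1 ht)]
        simp [eq_comm]
    rw [h1]
    cases k with
    | zero => simp [Nat.add_comm 1]
    | succ k => simpa [Nat.add_comm 1] using ih k

theorem numAt_unary {l : List ℕ} {N : ℕ} (hN : N = (unary l).length) (k : ℕ) :
    numAt N (DecisionTree.tailValue (unary l) N 0) k = l.getD k 0 := by
  rw [← sum_getD_unary l k, numAt, ← hN]
  refine Finset.sum_congr rfl fun t ht => ?_
  have ht := Finset.mem_range.1 ht
  rw [bitAt_tailValue ht, zerosBefore, Finset.sum_congr rfl fun s hs => by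
    rw [bitAt_tailValue ((Finset.mem_range.1 hs).trans ht)]]

section
variable {α : Type} [Denumerable α]

theorem PS.bitAt {X t : α → ℕ} (hX : PS X) (ht : PS t) : PS fun a => bitAt (X a) (t a) :=
  (PS.div_pow hX (PS.const 2) ht).mod (PS.const 2)

theorem PS.numAt {N X k : α → ℕ} (hN : PS N) (hX : PS X) (hk : PS k) :
    PS fun a => numAt (N a) (X a) (k a) := by
  refine PS.sum hN (PS.ite (PSPred.and (PSPred.eq (PS.sum PS.snd ?_) (hk.comp PS.fst))
    (PSPred.eq (PS.bitAt (hX.comp PS.fst) PS.snd) (PS.const 1))) (PS.const 1) (PS.const 0))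
  exact (PS.const 1).sub (PS.bitAt (hX.comp (PS.fst.comp PS.fst)) PS.snd)

end

/-! ### Sums over computation paths

A circuit is read from a sequence `ℓ` of numbers; the state of the parser consists of the position in
the sequence and the current number of wires. The gate `g` has `nin g` inputs and `nout g` outputs. At
the end of the circuit the parser stays where it is. -/

section
variable (nin nout ℓ : ℕ → ℕ)

/-- The register formed by the wires `ℓ p, …, ℓ (p + r - 1)` of the register `w`. -/
def gather (w p r : ℕ) : ℕ := ∑ i ∈ Finset.range r, bitAt w (ℓ (p + i)) * 2 ^ i

theorem gather_lt (w p r : ℕ) : gather ℓ w p r < 2 ^ r := by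
  unfold gather
  calc ∑ i ∈ Finset.range r, bitAt w (ℓ (p + i)) * 2 ^ i ≤ ∑ i ∈ Finset.range r, 2 ^ i :=
        Finset.sum_le_sum fun i _ =>
          (Nat.mul_le_mul_right _ (Nat.lt_succ_iff.1 (Nat.mod_lt _ (by norm_num)))).trans
            (one_mul _).le
    _ < 2 ^ r := Nat.geomSum_lt (by norm_num) (fun k hk => by simpa using hk)

/-- One step of the parser. -/
def nextState (st : ℕ × ℕ) : ℕ × ℕ :=
  if ℓ st.1 = 0 then st
  else (st.1 + 3 + nin (ℓ (st.1 + 1)) + ℓ (st.1 + 2), nout (ℓ (st.1 + 1)) + ℓ (st.1 + 2))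

/-- The weight of the step from register `w` to register `w'` with environment digit `ε`, where
`ent g o ε i` is the entry of the gate `g` in row `(o, ε)` and column `i`, and where `D` is the weight
of an idle step. -/
def stepWeight {R : Type*} [Zero R] (ent : ℕ → ℕ → ℕ → ℕ → R) (D : R) (st : ℕ × ℕ) (w w' ε : ℕ) : R :=
  if ℓ st.1 = 0 then (if w' = w ∧ ε = 0 then D else 0)
  else if w' = w' % 2 ^ nout (ℓ (st.1 + 1)) + 2 ^ nout (ℓ (st.1 + 1)) *
      gather ℓ w (st.1 + 3 + nin (ℓ (st.1 + 1))) (ℓ (st.1 + 2)) then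
    ent (ℓ (st.1 + 1)) (w' % 2 ^ nout (ℓ (st.1 + 1))) ε
      (gather ℓ w (st.1 + 3) (nin (ℓ (st.1 + 1))))
  else 0

theorem map_stepWeight {R S F : Type*} [Zero R] [Zero S] [FunLike F R S] [ZeroHomClass F R S] (f : F)
    (ent : ℕ → ℕ → ℕ → ℕ → R) (D : R) (st : ℕ × ℕ) (w w' ε : ℕ) :
    f (stepWeight nin nout ℓ ent D st w w' ε) =
      stepWeight nin nout ℓ (fun g o ε i => f (ent g o ε i)) (f D) st w w' ε := by
  unfold stepWeight
  split_ifs <;> simp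

variable (W B : ℕ)

/-- The sum over all paths of `K` steps from register `x` to the output `y`, with environment
digits `z` in base `B`; the registers are numbers less than `W`. -/
def amp {R : Type*} [CommRing R] (ent : ℕ → ℕ → ℕ → ℕ → R) (D : R) :
    ℕ → ℕ × ℕ → ℕ → ℕ → ℕ → R
  | 0, st, x, y, _ => if y = gather ℓ x (st.1 + 1) st.2 then 1 else 0
  | K + 1, st, x, y, z => ∑ w ∈ Finset.range W, stepWeight nin nout ℓ ent D st x w (z % B) *
      amp ent D K (nextState nin nout ℓ st) w y (z / B)

/-- A path sum is a polynomial in the gate entries, so the same sum can be compared in the Gaussian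
integers, in `ℂ` and in `ZMod m`. -/
theorem map_amp {R S : Type*} [CommRing R] [CommRing S] (f : R →+* S) (ent : ℕ → ℕ → ℕ → ℕ → R)
    (D : R) (K : ℕ) : ∀ (st : ℕ × ℕ) (x y z : ℕ), f (amp nin nout ℓ W B ent D K st x y z) =
      amp nin nout ℓ W B (fun g o ε i => f (ent g o ε i)) (f D) K st x y z := by
  induction K with
  | zero => intro st x y z; simp only [amp]; split_ifs <;> simp
  | succ K ih => intro st x y z; simp only [amp, map_sum, map_mul, map_stepWeight, ih]

/-- The register after `t` steps on the path that starts with `x` and continues with the base-`W`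
digits of `p`. -/
def pathReg (x p t : ℕ) : ℕ := (x + W * p) / W ^ t % W

theorem sum_range_pow_succ {R : Type*} [AddCommMonoid R] {W : ℕ} (hW : 0 < W) (K : ℕ) (f : ℕ → R) :
    ∑ p ∈ Finset.range (W ^ (K + 1)), f p =
      ∑ w ∈ Finset.range W, ∑ p ∈ Finset.range (W ^ K), f (w + W * p) := by
  rw [Finset.sum_comm, ← Finset.sum_product']
  refine Finset.sum_bij' (fun p _ => (p / W, p % W)) (fun q _ => q.2 + W * q.1) ?_ ?_ ?_ ?_ ?_
  · intro p hp
    rw [Finset.mem_range, pow_succ'] at hp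
    exact Finset.mem_product.2 ⟨Finset.mem_range.2 (Nat.div_lt_of_lt_mul hp),
      Finset.mem_range.2 (Nat.mod_lt _ hW)⟩
  · intro q hq
    obtain ⟨h1, h2⟩ := Finset.mem_product.1 hq
    rw [Finset.mem_range] at h1 h2 ⊢
    rw [pow_succ']
    calc q.2 + W * q.1 < W * (q.1 + 1) := by rw [Nat.mul_succ]; omega
      _ ≤ W * W ^ K := Nat.mul_le_mul_left _ h1
  · intro p _; exact Nat.mod_add_div p W
  · intro q hq
    have h2 := Finset.mem_range.1 (Finset.mem_product.1 hq).2
    ext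
    · simp [Nat.add_mul_div_left _ _ hW, Nat.div_eq_of_lt h2]
    · simp [Nat.mod_eq_of_lt h2]
  · intro p _; simp only [Nat.mod_add_div]

/-- A whole path is coded as one number `p < W ^ K` whose base-`W` digits are the intermediate
registers. This flattens `K` nested sums into a single sum of products, the shape to which `PS.sum`
and `PS.prodMod` apply. -/
theorem amp_eq_sum_paths {R : Type*} [CommRing R] (ent : ℕ → ℕ → ℕ → ℕ → R) (D : R) (hW : 0 < W)
    (K : ℕ) : ∀ (st : ℕ × ℕ) (x y z : ℕ), x < W → amp nin nout ℓ W B ent D K st x y z =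
      ∑ p ∈ Finset.range (W ^ K),
        (if y = gather ℓ (pathReg W x p K) (((nextState nin nout ℓ)^[K] st).1 + 1)
          ((nextState nin nout ℓ)^[K] st).2 then 1 else 0) *
        ∏ t ∈ Finset.range K, stepWeight nin nout ℓ ent D ((nextState nin nout ℓ)^[t] st)
          (pathReg W x p t) (pathReg W x p (t + 1)) (z / B ^ t % B) := by
  induction K with
  | zero =>
    intro st x y z hx
    simp [amp, pathReg, Nat.mod_eq_of_lt hx]
  | succ K ih =>
    intro st x y z hx
    have h0 : ∀ p, pathReg W x p 0 = x := fun p => by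
      simp [pathReg, Nat.mod_eq_of_lt hx]
    -- The lowest digit of the code is the register after the first step, so the rest of the path is
    -- the path of `p` started at `w`.
    have hs : ∀ w p t, pathReg W x (w + W * p) (t + 1) = pathReg W w p t := fun w p t => by
      rw [pathReg, pow_succ', ← Nat.div_div_eq_div_mul, Nat.add_mul_div_left _ _ hW,
        Nat.div_eq_of_lt hx, zero_add, pathReg]
    have h1 : ∀ w < W, ∀ p, pathReg W w p 0 = w := fun w hw p => by
      simp [pathReg, Nat.mod_eq_of_lt hw]
    rw [sum_range_pow_succ hW, amp]
    refine Finset.sum_congr rfl fun w hw => ?_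
    rw [ih _ _ _ _ (Finset.mem_range.1 hw), Finset.mul_sum]
    refine Finset.sum_congr rfl fun p _ => ?_
    rw [Finset.prod_range_succ']
    simp only [hs, h0, h1 w (Finset.mem_range.1 hw), Function.iterate_succ_apply, pow_zero,
      Nat.div_one, Function.iterate_zero, id_eq, pow_succ', ← Nat.div_div_eq_div_mul]
    ring

/-- The path sum computed with natural numbers, up to multiples of `m`. -/
def ampNat (m : ℕ) (ent : ℕ → ℕ → ℕ → ℕ → ℕ) (D K : ℕ) (st : ℕ × ℕ) (x y z : ℕ) : ℕ :=
  ∑ p ∈ Finset.range (W ^ K),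
    (if y = gather ℓ (pathReg W x p K) (((nextState nin nout ℓ)^[K] st).1 + 1)
      ((nextState nin nout ℓ)^[K] st).2 then 1 else 0) *
    prodMod m (fun t => stepWeight nin nout ℓ ent D ((nextState nin nout ℓ)^[t] st)
      (pathReg W x p t) (pathReg W x p (t + 1)) (z / B ^ t % B)) K

theorem ampNat_cast (m : ℕ) (ent : ℕ → ℕ → ℕ → ℕ → ℕ) (D K : ℕ) (st : ℕ × ℕ) (x y z : ℕ)
    (hx : x < W) : (ampNat nin nout ℓ W B m ent D K st x y z : ZMod m) =
      amp nin nout ℓ W B (fun g o ε i => (ent g o ε i : ZMod m)) (D : ZMod m) K st x y z := by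
  rw [amp_eq_sum_paths _ _ _ _ _ _ _ (by omega) _ _ _ _ _ hx, ampNat, Nat.cast_sum]
  refine Finset.sum_congr rfl fun p _ => ?_
  rw [Nat.cast_mul, prodMod_cast]
  congr 1
  · split_ifs <;> simp
  · refine Finset.prod_congr rfl fun t _ => ?_
    exact map_stepWeight nin nout ℓ (Nat.castRingHom (ZMod m)) ent D _ _ _ _

end

/-! ### Kraus operators of circuits -/

/-- Stacking the Kraus operators, with the outcome written into the environment, gives the isometry;
tracing out the environment sums over the outcomes. -/
theorem isStinespring_of_kraus {X Y : Type*} [Fintype X] [DecidableEq X] [Fintype Y] {e : ℕ}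
    {Ψ : Matrix X X ℂ →ₗ[ℂ] Matrix Y Y ℂ} {K : ℕ → Matrix Y X ℂ}
    (h₁ : ∑ z ∈ Finset.range (2 ^ e), (K z)ᴴ * K z = 1)
    (h₂ : ∀ M, Ψ M = ∑ z ∈ Finset.range (2 ^ e), K z * M * (K z)ᴴ) :
    IsStinespring Ψ
      (Matrix.of fun (p : Y × Bits e) x => K (bitsToNat p.2) p.1 x) := by
  constructor
  · rw [← h₁, ← sum_bitsToNat fun z => (K z)ᴴ * K z]
    ext x x'
    simp only [Matrix.mul_apply, Matrix.conjTranspose_apply, Matrix.of_apply,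
      Fintype.sum_prod_type_right, Matrix.sum_apply]
  · intro M
    rw [h₂, ← sum_bitsToNat fun z => K z * M * (K z)ᴴ]
    ext y y'
    simp only [trRight, LinearMap.coe_mk, AddHom.coe_mk, Matrix.mul_apply,
      Matrix.conjTranspose_apply, Matrix.of_apply, Matrix.sum_apply]

/-- Gates have environments of different dimensions. Padding with vanishing outcomes gives all of
them the same number `B`, so that outcomes of a circuit are numbers in base `B`. -/
theorem sum_range_natBits {R : Type*} [AddCommMonoid R] {n B : ℕ} (h : 2 ^ n ≤ B)
    (f : Bits n → R) :
    ∑ ε ∈ Finset.range B, (if ε < 2 ^ n then f (natBits n ε) else 0) = ∑ e, f e := by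
  rw [← Finset.sum_filter]
  have h1 : (Finset.range B).filter (· < 2 ^ n) = Finset.range (2 ^ n) := by
    ext i; simp; omega
  rw [h1, ← sum_bitsToNat fun ε => f (natBits n ε)]
  simp only [natBits_bitsToNat]

namespace QGate

variable (G : QGate) (r : ℕ) (π : Equiv.Perm (Fin (G.nin + r)))

/-- The Kraus operators of a gate placed on a register. -/
noncomputable def kraus (ε : ℕ) : Matrix (Bits (G.nout + r)) (Bits (G.nin + r)) ℂ :=
  Matrix.of fun v x => if ε < 2 ^ G.nenv then G.op r π (v, natBits G.nenv ε) x else 0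

/-- Only the rows that copy the untouched wires of `x` contribute. If those of `x'` agree with them,
what remains is the isometry relation of the gate. -/
theorem op_isometry : (G.op r π)ᴴ * G.op r π = 1 := by
  ext x x'
  have hG : ∀ i i', ∑ o, ∑ e, star (G.mat (o, e) i) * G.mat (o, e) i' = if i = i' then 1 else 0 :=
    fun i i' => by
      have := congrFun (congrFun G.isometry i) i'
      simpa [Matrix.mul_apply, Fintype.sum_prod_type, Matrix.one_apply] using this
  let F : Bits G.nout × Bits r → ℂ := fun p => ∑ e,
    (if p.2 = (fun i => x (π (Fin.natAdd G.nin i))) then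
      star (G.mat (p.1, e) fun i => x (π (Fin.castAdd r i))) else 0) *
    (if p.2 = (fun i => x' (π (Fin.natAdd G.nin i))) then
      G.mat (p.1, e) (fun i => x' (π (Fin.castAdd r i))) else 0)
  have hF : ((G.op r π)ᴴ * G.op r π) x x' = ∑ p, F p := by
    rw [Matrix.mul_apply, Fintype.sum_prod_type, ← (Fin.appendEquiv G.nout r).sum_comp]
    refine Finset.sum_congr rfl fun p _ => ?_
    simp only [Matrix.conjTranspose_apply, op, Matrix.of_apply, F, Fin.appendEquiv,
      Equiv.coe_fn_mk, Fin.append_left, Fin.append_right]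
    refine Finset.sum_congr rfl fun e _ => ?_
    congr 1
    split_ifs <;> simp
  rw [hF, Fintype.sum_prod_type_right, Finset.sum_eq_single (fun i => x (π (Fin.natAdd G.nin i)))]
  · by_cases h : (fun i => x (π (Fin.natAdd G.nin i))) = fun i => x' (π (Fin.natAdd G.nin i))
    · simp only [F, if_pos h, if_true]
      rw [hG, Matrix.one_apply]
      refine if_congr ⟨fun h' => ?_, fun h' => by rw [h']⟩ rfl rfl
      funext i
      -- Since `π` is onto, the wires of the gate and the untouched wires together determine the
      -- register.
      obtain ⟨j, rfl⟩ := π.surjective i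
      refine Fin.addCases (fun j => ?_) (fun j => ?_) j
      · exact congrFun h' j
      · exact congrFun h j
    · simp only [F, if_neg h, mul_zero, Finset.sum_const_zero]
      rw [Matrix.one_apply_ne (fun h' => h (by rw [h']))]
  · intro b _ hb
    simp [F, hb]
  · simp

theorem sum_kraus_conjTranspose_mul {B : ℕ} (hB : 2 ^ G.nenv ≤ B) :
    ∑ ε ∈ Finset.range B, (G.kraus r π ε)ᴴ * G.kraus r π ε = 1 := by
  rw [← G.op_isometry r π]
  ext x x'
  rw [Matrix.sum_apply, Matrix.mul_apply, Fintype.sum_prod_type_right, ← sum_range_natBits hB]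
  refine Finset.sum_congr rfl fun ε _ => ?_
  rw [Matrix.mul_apply]
  simp only [kraus, Matrix.conjTranspose_apply, Matrix.of_apply]
  split_ifs <;> simp

theorem sum_kraus_mul {B : ℕ} (hB : 2 ^ G.nenv ≤ B) (M) :
    ∑ ε ∈ Finset.range B, G.kraus r π ε * M * (G.kraus r π ε)ᴴ = G.channel r π M := by
  ext v v'
  simp only [channel, LinearMap.comp_apply, trRight, conjBy, LinearMap.coe_mk, AddHom.coe_mk,
    Matrix.of_apply, Matrix.sum_apply]
  rw [← sum_range_natBits hB]
  refine Finset.sum_congr rfl fun ε _ => ?_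
  simp only [kraus, Matrix.mul_apply, Matrix.conjTranspose_apply, Matrix.of_apply]
  split_ifs <;> simp

end QGate

namespace QCircuit

variable {s : ℕ} {𝒢 : Fin s → QGate} (B : ℕ)

/-- The number of gates. -/
def length : {n m : ℕ} → QCircuit 𝒢 n m → ℕ
  | _, _, .done _ => 0
  | _, _, .step _ _ _ rest => rest.length + 1

/-- The Kraus operators of a circuit with at most `K` gates; the base-`B` digits of `z` are the
environment outcomes of the gates. -/
noncomputable def kraus : {n m : ℕ} → QCircuit 𝒢 n m → ℕ → ℕ → Matrix (Bits m) (Bits n) ℂ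
  | _, _, .done π, _, z => if z = 0 then Matrix.of fun y x => if y = x ∘ π then 1 else 0 else 0
  | _, _, .step _ _ _ _, 0, _ => 0
  | _, _, .step g r π rest, K + 1, z => rest.kraus K (z / B) * (𝒢 g).kraus r π (z % B)

variable {B}

/-- The lowest base-`B` digit of `z` is the outcome of the first gate, so both sums factor through
this gate and the rest of the circuit. `K` may exceed the number of gates: nonzero superfluous
digits give the zero operator. -/
theorem sum_kraus {n m : ℕ} (Q : QCircuit 𝒢 n m) (hB : ∀ g, 2 ^ (𝒢 g).nenv ≤ B) (hB' : 0 < B) :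
    ∀ K, Q.length ≤ K → (∑ z ∈ Finset.range (B ^ K), (Q.kraus B K z)ᴴ * Q.kraus B K z = 1) ∧
      ∀ M, Q.channel M = ∑ z ∈ Finset.range (B ^ K), Q.kraus B K z * M * (Q.kraus B K z)ᴴ := by
  induction Q with
  | @done n π =>
    intro K _
    have h0 : 0 ∈ Finset.range (B ^ K) := Finset.mem_range.2 (by positivity)
    rw [Finset.sum_eq_single_of_mem 0 h0 fun z _ hz => by simp [kraus, hz]]
    constructor
    · ext x x'
      simp only [kraus, if_true, Matrix.mul_apply, Matrix.conjTranspose_apply, Matrix.of_apply,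
        Matrix.one_apply]
      rw [Finset.sum_eq_single (x ∘ π)]
      · have : x ∘ π = x' ∘ π ↔ x = x' :=
          ⟨fun h => π.surjective.injective_comp_right h, fun h => by rw [h]⟩
        simp [this]
      · intro b _ hb; simp [hb]
      · simp
    · intro M
      rw [Finset.sum_eq_single_of_mem 0 h0 fun z _ hz => by simp [kraus, hz]]
      ext y y'
      have hy : ∀ y x : Bits n, y = x ∘ π ↔ x = fun i => y (π.symm i) := fun y x => by
        constructor
        · rintro rfl; funext i; simp
        · rintro rfl; funext i; simp
      simp [kraus, channel, permChannel, Matrix.mul_apply, hy]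
      rfl
  | step g r π rest ih =>
    intro K hK
    obtain ⟨K, rfl⟩ : ∃ k, K = k + 1 := ⟨K - 1, by simp [length] at hK; omega⟩
    obtain ⟨ih₁, ih₂⟩ := ih K (by simpa [length] using hK)
    have hk : ∀ ε < B, ∀ z, (QCircuit.step g r π rest).kraus B (K + 1) (ε + B * z) =
        rest.kraus B K z * (𝒢 g).kraus r π ε := fun ε hε z => by
      rw [kraus, Nat.add_mul_div_left _ _ hB', Nat.div_eq_of_lt hε, zero_add,
        Nat.add_mul_mod_self_left, Nat.mod_eq_of_lt hε]
    constructor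
    · rw [sum_range_pow_succ hB', ← (𝒢 g).sum_kraus_conjTranspose_mul r π (hB g)]
      refine Finset.sum_congr rfl fun ε hε => ?_
      simp only [hk ε (Finset.mem_range.1 hε), Matrix.conjTranspose_mul]
      calc ∑ z ∈ Finset.range (B ^ K), ((𝒢 g).kraus r π ε)ᴴ * (rest.kraus B K z)ᴴ *
            (rest.kraus B K z * (𝒢 g).kraus r π ε)
          = ((𝒢 g).kraus r π ε)ᴴ * (∑ z ∈ Finset.range (B ^ K),
              (rest.kraus B K z)ᴴ * rest.kraus B K z) * (𝒢 g).kraus r π ε := by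
            rw [Matrix.mul_sum, Matrix.sum_mul]
            simp only [Matrix.mul_assoc]
        _ = _ := by rw [ih₁, Matrix.mul_one]
    · intro M
      rw [sum_range_pow_succ hB', channel, LinearMap.comp_apply,
        ← (𝒢 g).sum_kraus_mul r π (hB g), map_sum]
      refine Finset.sum_congr rfl fun ε hε => ?_
      simp only [hk ε (Finset.mem_range.1 hε), Matrix.conjTranspose_mul, ih₂]
      simp only [Matrix.mul_assoc]

theorem isStinespring_kraus {n m e K : ℕ} (Q : QCircuit 𝒢 n m) (hB : ∀ g, 2 ^ (𝒢 g).nenv ≤ B)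
    (hB' : 0 < B) (hK : Q.length ≤ K) (he : 2 ^ e = B ^ K) : IsStinespring Q.channel
      (Matrix.of fun (p : Bits m × Bits e) x => Q.kraus B K (bitsToNat p.2) p.1 x) := by
  obtain ⟨h₁, h₂⟩ := Q.sum_kraus hB hB' K hK
  rw [← he] at h₁ h₂
  exact isStinespring_of_kraus h₁ h₂

end QCircuit

/-! ### The path sum of the description of a circuit -/

section
variable {s : ℕ} (𝒢 : Fin s → QGate)

/-- Number of inputs of the gate with a given index. -/
def gateIn (g : ℕ) : ℕ := if h : g < s then (𝒢 ⟨g, h⟩).nin else 0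

/-- Number of outputs of the gate with a given index. -/
def gateOut (g : ℕ) : ℕ := if h : g < s then (𝒢 ⟨g, h⟩).nout else 0

/-- Entries of the gate isometries, with rows and columns indexed by numbers. -/
noncomputable def gateEntry (g o ε i : ℕ) : ℂ :=
  if h : g < s then
    if o < 2 ^ (𝒢 ⟨g, h⟩).nout ∧ ε < 2 ^ (𝒢 ⟨g, h⟩).nenv ∧ i < 2 ^ (𝒢 ⟨g, h⟩).nin then
      (𝒢 ⟨g, h⟩).mat (natBits _ o, natBits _ ε) (natBits _ i)
    else 0
  else 0

theorem gateIn_val (g : Fin s) : gateIn 𝒢 g = (𝒢 g).nin := by simp [gateIn]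

theorem gateOut_val (g : Fin s) : gateOut 𝒢 g = (𝒢 g).nout := by simp [gateOut]

theorem gateEntry_val (g : Fin s) (o : Bits (𝒢 g).nout) (ε : ℕ) (i : Bits (𝒢 g).nin) :
    gateEntry 𝒢 g (bitsToNat o) ε (bitsToNat i) =
      if ε < 2 ^ (𝒢 g).nenv then (𝒢 g).mat (o, natBits _ ε) i else 0 := by
  simp [gateEntry, bitsToNat_lt, natBits_bitsToNat]

end

namespace QCircuit

variable {s : ℕ} {𝒢 : Fin s → QGate}

/-- The description lists a permutation of all wires at every step. Therefore each register that
occurs is narrower than the description, and `2 ^ N` bounds all register values. -/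
theorem lt_length_code {n m : ℕ} (Q : QCircuit 𝒢 n m) : n < Q.code.length := by
  induction Q with
  | done π => simp [code]
  | step g r π rest ih => simp [code]; omega

theorem lt_length_code' {n m : ℕ} (Q : QCircuit 𝒢 n m) : m < Q.code.length := by
  induction Q with
  | done π => simp [code]
  | step g r π rest ih => simp [code]; omega

theorem length_le_length_code {n m : ℕ} (Q : QCircuit 𝒢 n m) : Q.length ≤ Q.code.length := by
  induction Q with
  | done π => simp [length]
  | step g r π rest ih => simp [length, code]; omega

/-- The sequence `ℓ` contains the description of `Q` from position `p` on. -/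
def CodeAt {n m : ℕ} (Q : QCircuit 𝒢 n m) (ℓ : ℕ → ℕ) (p : ℕ) : Prop :=
  ∀ k < Q.code.length, ℓ (p + k) = Q.code.getD k 0

variable {ℓ : ℕ → ℕ} {p : ℕ}

theorem codeAt_done {n : ℕ} {π : Equiv.Perm (Fin n)} (h : (done (𝒢 := 𝒢) π).CodeAt ℓ p) :
    ℓ p = 0 ∧ ∀ i : Fin n, ℓ (p + 1 + i) = π i := by
  constructor
  · simpa [code] using h 0 (by simp [code])
  · intro i
    have := h (1 + i) (by simp [code]; omega)
    rw [add_assoc, this]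
    simp [code, Nat.add_comm 1]

theorem codeAt_step {m : ℕ} {g : Fin s} {r : ℕ} {π : Equiv.Perm (Fin ((𝒢 g).nin + r))}
    {rest : QCircuit 𝒢 ((𝒢 g).nout + r) m} (h : (step g r π rest).CodeAt ℓ p) :
    ℓ p = 1 ∧ ℓ (p + 1) = g ∧ ℓ (p + 2) = r ∧ (∀ i : Fin ((𝒢 g).nin + r), ℓ (p + 3 + i) = π i) ∧
      rest.CodeAt ℓ (p + 3 + (𝒢 g).nin + r) := by
  refine ⟨?_, ?_, ?_, fun i => ?_, fun k hk => ?_⟩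
  · simpa [code] using h 0 (by simp [code])
  · simpa [code] using h 1 (by simp [code])
  · simpa [code] using h 2 (by simp [code])
  · have := h (3 + i) (by simp [code]; omega)
    rw [add_assoc, this, code, Nat.add_comm 3, List.getD_cons_succ, List.getD_cons_succ,
      List.getD_cons_succ, List.getD_append _ _ _ _ (by simp)]
    simp
  · have := h (3 + ((𝒢 g).nin + r) + k) (by simp [code]; omega)
    rw [show p + 3 + (𝒢 g).nin + r + k = p + (3 + ((𝒢 g).nin + r) + k) by ring, this, code,
      show 3 + ((𝒢 g).nin + r) + k = ((𝒢 g).nin + r) + k + 1 + 1 + 1 by ring,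
      List.getD_cons_succ, List.getD_cons_succ, List.getD_cons_succ,
      List.getD_append_right _ _ _ _ (by simp)]
    simp

theorem gather_eq {n r : ℕ} (x : Bits n) (q : ℕ) (f : Fin r → Fin n)
    (h : ∀ i : Fin r, ℓ (q + i) = f i) :
    gather ℓ (bitsToNat x) q r = bitsToNat (fun i => x (f i)) := by
  rw [gather]
  refine (bitsToNat_eq_sum_range (fun i => x (f i)) (fun i => ?_)).symm
  rw [h, bitAt_bitsToNat]

/-- The parser waits at the end marker, so any sufficiently large number of steps leads to the same
state. The final position also reveals where the description ends, that is, where the second circuit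
begins. -/
theorem iterate_nextState {n m : ℕ} (Q : QCircuit 𝒢 n m) : ∀ p, Q.CodeAt ℓ p → ∀ K, Q.length ≤ K →
    ((nextState (gateIn 𝒢) (gateOut 𝒢) ℓ)^[K] (p, n)).1 + 1 + m = p + Q.code.length ∧
    ((nextState (gateIn 𝒢) (gateOut 𝒢) ℓ)^[K] (p, n)).2 = m := by
  induction Q with
  | @done n π =>
    intro p h K _
    have hfix : nextState (gateIn 𝒢) (gateOut 𝒢) ℓ (p, n) = (p, n) := by
      simp [nextState, (codeAt_done h).1]
    rw [Function.iterate_fixed hfix]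
    simp [code]; ring
  | step g r π rest ih =>
    intro p h K hK
    obtain ⟨K, rfl⟩ : ∃ k, K = k + 1 := ⟨K - 1, by simp [length] at hK; omega⟩
    obtain ⟨h0, h1, h2, -, h4⟩ := codeAt_step h
    have hn : nextState (gateIn 𝒢) (gateOut 𝒢) ℓ (p, (𝒢 g).nin + r) =
        (p + 3 + (𝒢 g).nin + r, (𝒢 g).nout + r) := by
      simp [nextState, h0, h1, h2, gateIn_val, gateOut_val]
    rw [Function.iterate_succ_apply, hn]
    obtain ⟨i1, i2⟩ := ih _ h4 K (by simpa [length] using hK)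
    refine ⟨?_, i2⟩
    rw [i1]
    simp [code]; ring

/-- An idle step has weight `D` instead of `1`, so the total scale `D ^ K` depends on the number of
steps only and not on the number of gates. -/
theorem amp_idle {R : Type*} [CommRing R] {W B : ℕ} (nin nout : ℕ → ℕ)
    (ent : ℕ → ℕ → ℕ → ℕ → R) (D : R) {n x : ℕ} (y : ℕ) (hℓ : ℓ p = 0) (hx : x < W) :
    ∀ K z, z < B ^ K → amp nin nout ℓ W B ent D K (p, n) x y z =
      if z = 0 ∧ y = gather ℓ x (p + 1) n then D ^ K else 0 := by
  intro K
  induction K with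
  | zero => intro z hz; simp at hz; simp [amp, hz]
  | succ K ih =>
    intro z hz
    have hst : nextState nin nout ℓ (p, n) = (p, n) := by simp [nextState, hℓ]
    have hz' : z / B < B ^ K := Nat.div_lt_of_lt_mul (by rwa [← pow_succ'])
    rw [amp, Finset.sum_eq_single_of_mem x (Finset.mem_range.2 hx) fun w _ hw => by
      simp [stepWeight, hℓ, hw], hst, ih _ hz']
    have hz0 : z = 0 ↔ z % B = 0 ∧ z / B = 0 := by
      constructor
      · rintro rfl; simp
      · rintro ⟨h1, h2⟩
        rw [← Nat.div_add_mod z B, h1, h2]; simp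
    simp only [stepWeight, hℓ, if_true, true_and, hz0]
    by_cases h1 : z % B = 0 <;> by_cases h2 : z / B = 0 <;> simp [h1, h2, pow_succ']

/-- The sum over the next register is a matrix product with the Kraus operator of the gate; each
step, idle or not, contributes one factor `D`. -/
theorem amp_eq_kraus {B w : ℕ} (D : ℂ) {n m : ℕ} (Q : QCircuit 𝒢 n m) :
    ∀ p, Q.CodeAt ℓ p → Q.code.length ≤ w → ∀ K, Q.length ≤ K → ∀ (x : Bits n) (y : Bits m) (z : ℕ),
      z < B ^ K → amp (gateIn 𝒢) (gateOut 𝒢) ℓ (2 ^ w) B (fun g o ε i => D * gateEntry 𝒢 g o ε i) D K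
        (p, n) (bitsToNat x) (bitsToNat y) z = D ^ K * Q.kraus B K z y x := by
  induction Q with
  | @done n π =>
    intro p h hw K _ x y z hz
    obtain ⟨h0, h1⟩ := codeAt_done h
    have hx : bitsToNat x < 2 ^ w := (bitsToNat_lt x).trans_le
      (Nat.pow_le_pow_right (by norm_num) ((lt_length_code _).le.trans hw))
    rw [amp_idle _ _ _ _ _ h0 hx K z hz, gather_eq x (p + 1) π h1]
    simp only [kraus, bitsToNat_injective.eq_iff]
    by_cases h2 : z = 0 <;> simp [h2, Function.comp_def]
  | step g r π rest ih =>
    intro p h hw K hK x y z hz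
    obtain ⟨K, rfl⟩ : ∃ k, K = k + 1 := ⟨K - 1, by simp [length] at hK; omega⟩
    obtain ⟨h0, h1, h2, h3, h4⟩ := codeAt_step h
    have hz' : z / B < B ^ K := Nat.div_lt_of_lt_mul (by rwa [← pow_succ'])
    have hn : nextState (gateIn 𝒢) (gateOut 𝒢) ℓ (p, (𝒢 g).nin + r) =
        (p + 3 + (𝒢 g).nin + r, (𝒢 g).nout + r) := by
      simp [nextState, h0, h1, h2, gateIn_val, gateOut_val]
    have hwr : rest.code.length ≤ w := by simp [code] at hw; omega
    have hle : 2 ^ ((𝒢 g).nout + r) ≤ 2 ^ w :=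
      Nat.pow_le_pow_right (by norm_num) ((lt_length_code rest).le.trans hwr)
    have g1 : gather ℓ (bitsToNat x) (p + 3) (𝒢 g).nin =
        bitsToNat (fun i => x (π (Fin.castAdd r i))) :=
      gather_eq x (p + 3) (fun i => π (Fin.castAdd r i)) fun i => h3 (Fin.castAdd r i)
    have g2 : gather ℓ (bitsToNat x) (p + 3 + (𝒢 g).nin) r =
        bitsToNat (fun i => x (π (Fin.natAdd _ i))) :=
      gather_eq x (p + 3 + (𝒢 g).nin) (fun i => π (Fin.natAdd _ i)) fun i => by
        rw [← h3 (Fin.natAdd _ i)]; simp [add_assoc]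
    -- Numbers too large for the current register violate the consistency condition in `stepWeight`,
    -- because the gathered part is below `2 ^ r`. This permits a summation range that does not
    -- depend on the step.
    have hzero : ∀ v, 2 ^ ((𝒢 g).nout + r) ≤ v →
        stepWeight (gateIn 𝒢) (gateOut 𝒢) ℓ (fun g o ε i => D * gateEntry 𝒢 g o ε i) D
          (p, (𝒢 g).nin + r) (bitsToNat x) v (z % B) = 0 := by
      intro v hv
      simp only [stepWeight, h0, h1, h2, gateIn_val, gateOut_val, one_ne_zero, if_false]
      rw [if_neg]
      intro hv'
      have := gather_lt ℓ (bitsToNat x) (p + 3 + (𝒢 g).nin) r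
      have h5 : v % 2 ^ (𝒢 g).nout < 2 ^ (𝒢 g).nout := Nat.mod_lt _ (by positivity)
      have h6 : 2 ^ (𝒢 g).nout * (gather ℓ (bitsToNat x) (p + 3 + (𝒢 g).nin) r + 1) ≤
          2 ^ (𝒢 g).nout * 2 ^ r := Nat.mul_le_mul_left _ this
      rw [pow_add] at hv
      rw [Nat.mul_succ] at h6
      omega
    have hstep : ∀ v : Bits ((𝒢 g).nout + r),
        stepWeight (gateIn 𝒢) (gateOut 𝒢) ℓ (fun g o ε i => D * gateEntry 𝒢 g o ε i) D
          (p, (𝒢 g).nin + r) (bitsToNat x) (bitsToNat v) (z % B) =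
            D * (𝒢 g).kraus r π (z % B) v x := by
      intro v
      have hv := bitsToNat_append v
      have h5 : bitsToNat v % 2 ^ (𝒢 g).nout = bitsToNat (fun i => v (Fin.castAdd r i)) := by
        rw [hv, Nat.add_mul_mod_self_left, Nat.mod_eq_of_lt (bitsToNat_lt _)]
      simp only [stepWeight, h0, h1, h2, gateIn_val, gateOut_val, one_ne_zero, if_false, h5, g1, g2,
        gateEntry_val]
      have h6 : bitsToNat v = bitsToNat (fun i => v (Fin.castAdd r i)) + 2 ^ (𝒢 g).nout *
          bitsToNat (fun i => x (π (Fin.natAdd _ i))) ↔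
            (fun i => v (Fin.natAdd _ i)) = fun i => x (π (Fin.natAdd _ i)) := by
        rw [hv, Nat.add_left_cancel_iff, Nat.mul_right_inj (by positivity),
          bitsToNat_injective.eq_iff]
      simp only [h6, QGate.kraus, QGate.op, Matrix.of_apply]
      split_ifs <;> simp
    rw [amp, ← Finset.sum_subset (Finset.range_subset_range.2 hle) fun v _ hv => by
      rw [hzero v (by simpa using hv), zero_mul]]
    rw [← sum_bitsToNat fun v => stepWeight (gateIn 𝒢) (gateOut 𝒢) ℓ
      (fun g o ε i => D * gateEntry 𝒢 g o ε i) D (p, (𝒢 g).nin + r) (bitsToNat x) v (z % B) *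
      amp (gateIn 𝒢) (gateOut 𝒢) ℓ (2 ^ w) B (fun g o ε i => D * gateEntry 𝒢 g o ε i) D K
        (nextState (gateIn 𝒢) (gateOut 𝒢) ℓ (p, (𝒢 g).nin + r)) v (bitsToNat y) (z / B)]
    rw [kraus, Matrix.mul_apply, Finset.mul_sum]
    refine Finset.sum_congr rfl fun v _ => ?_
    rw [hstep, hn, ih _ h4 hwr K (by simpa [length] using hK) v y _ hz', pow_succ]
    ring

end QCircuit

/-! ### Matrix entries of the super-operator -/

/-- The combination of amplitudes that forms the matrix entries of the super-operator `Ξ`. -/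
def xiSum {R : Type*} [CommRing R] (W : ℕ) (A A' : ℕ → ℕ → ℕ → ℕ → R)
    (x₀ x₁ x₀' x₁' z q z' q' : ℕ) : R :=
  (if x₁ = x₁' then ∑ y ∈ Finset.range W, A q x₀ y z * A' q' x₀' y z' else 0) +
    (if q = q' then -1 else 1) *
      (if x₀ = x₀' then ∑ y ∈ Finset.range W, A q x₁ y z * A' q' x₁' y z' else 0)

theorem map_xiSum {R S : Type*} [CommRing R] [CommRing S] (f : R →+* S) (W : ℕ)
    (A A' : ℕ → ℕ → ℕ → ℕ → R) (x₀ x₁ x₀' x₁' z q z' q' : ℕ) :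
    f (xiSum W A A' x₀ x₁ x₀' x₁' z q z' q') =
      xiSum W (fun q x y z => f (A q x y z)) (fun q x y z => f (A' q x y z))
        x₀ x₁ x₀' x₁' z q z' q' := by
  unfold xiSum
  split_ifs <;> simp

theorem xiSum_congr {R : Type*} [CommRing R] {W : ℕ} {A A' C C' : ℕ → ℕ → ℕ → ℕ → R}
    {x₀ x₁ x₀' x₁' z q z' q' : ℕ} (h₀ : ∀ y, A q x₀ y z = C q x₀ y z)
    (h₁ : ∀ y, A q x₁ y z = C q x₁ y z) (h₀' : ∀ y, A' q' x₀' y z' = C' q' x₀' y z')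
    (h₁' : ∀ y, A' q' x₁' y z' = C' q' x₁' y z') :
    xiSum W A A' x₀ x₁ x₀' x₁' z q z' q' = xiSum W C C' x₀ x₁ x₀' x₁' z q z' q' := by
  simp only [xiSum, h₀, h₁, h₀', h₁']

/-- The same combination, computed with natural numbers up to multiples of `m`. -/
def xiNat (m W : ℕ) (A A' : ℕ → ℕ → ℕ → ℕ → ℕ) (x₀ x₁ x₀' x₁' z q z' q' : ℕ) : ℕ :=
  (if x₁ = x₁' then ∑ y ∈ Finset.range W, A q x₀ y z * A' q' x₀' y z' else 0) +
    (if q = q' then m - 1 else 1) *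
      (if x₀ = x₀' then ∑ y ∈ Finset.range W, A q x₁ y z * A' q' x₁' y z' else 0)

theorem xiNat_cast {m : ℕ} (hm : 0 < m) (W : ℕ) (A A' : ℕ → ℕ → ℕ → ℕ → ℕ)
    (x₀ x₁ x₀' x₁' z q z' q' : ℕ) :
    (xiNat m W A A' x₀ x₁ x₀' x₁' z q z' q' : ZMod m) =
      xiSum W (fun q x y z => (A q x y z : ZMod m)) (fun q x y z => (A' q x y z : ZMod m))
        x₀ x₁ x₀' x₁' z q z' q' := by
  unfold xiNat xiSum
  have : ((m - 1 : ℕ) : ZMod m) = -1 := by rw [Nat.cast_sub hm]; simp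
  split_ifs <;> simp [this]

theorem conjBy_single {I J : Type*} [Fintype I] [DecidableEq I] (A : Matrix J I ℂ) (i i' : I)
    (j j' : J) : conjBy A (Matrix.single i i' 1) j j' = A j i * star (A j' i') := by
  simp only [conjBy, LinearMap.coe_mk, AddHom.coe_mk, Matrix.mul_apply, Matrix.single_apply,
    Matrix.conjTranspose_apply]
  rw [Finset.sum_eq_single i' (fun b _ hb => by simp [Ne.symm hb]) (by simp)]
  simp

theorem trRight_single {I J : Type*} [Fintype J] [DecidableEq I] [DecidableEq J] (i i' : I)
    (j j' : J) : trRight I J (Matrix.single (i, j) (i', j') 1) =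
      if j = j' then Matrix.single i i' 1 else 0 := by
  ext a a'
  simp only [trRight, LinearMap.coe_mk, AddHom.coe_mk, Matrix.of_apply, Matrix.single_apply,
    Prod.mk.injEq]
  split_ifs with h
  · subst h; simp [Matrix.single_apply, and_assoc, ite_and]
  · rw [Finset.sum_eq_zero fun x _ => if_neg (by rintro ⟨⟨-, rfl⟩, -, rfl⟩; exact h rfl)]; rfl

theorem trLeft_single {I J : Type*} [Fintype I] [DecidableEq I] [DecidableEq J] (i i' : I)
    (j j' : J) : trLeft I J (Matrix.single (i, j) (i', j') 1) =
      if i = i' then Matrix.single j j' 1 else 0 := by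
  ext a a'
  simp only [trLeft, LinearMap.coe_mk, AddHom.coe_mk, Matrix.of_apply, Matrix.single_apply,
    Prod.mk.injEq]
  split_ifs with h
  · subst h; simp [Matrix.single_apply, and_assoc, ite_and]
  · rw [Finset.sum_eq_zero fun x _ => if_neg (by rintro ⟨⟨rfl, -⟩, rfl, -⟩; exact h rfl)]; rfl

theorem stackPlus_mul_star {X Y Z : Type*} (A₀ A₁ : Matrix (Y × Z) X ℂ) (y y' : Y) (z z' : Z)
    (q q' : Fin 2) (x x' : X) :
    stackPlus A₀ A₁ (y, (z, q)) x * star (stackPlus A₀ A₁ (y', (z', q')) x') =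
      1 / 2 * ((if q = 0 then A₀ (y, z) x else A₁ (y, z) x) *
        star (if q' = 0 then A₀ (y', z') x' else A₁ (y', z') x')) := by
  have h : (1 / (Real.sqrt 2 : ℂ)) * star (1 / (Real.sqrt 2 : ℂ)) = 1 / 2 := by
    simp only [star_div₀, star_one, RCLike.star_def, Complex.conj_ofReal]
    rw [div_mul_div_comm, one_mul, ← Complex.ofReal_mul, Real.mul_self_sqrt (by norm_num)]
    simp
  simp only [stackPlus, Matrix.of_apply, star_mul']
  rw [← h]
  ring

/-- The factor `2` removes the two factors `1 / √2`. In the second term the minus sign of the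
difference meets the sign of `C₁`, which is `-1` exactly when `q ≠ q'`; hence `-1` for `q = q'` and
`1` otherwise. -/
theorem two_mul_xiMap_single {X Y Z : Type*} [Fintype X] [DecidableEq X] [Fintype Y]
    (A₀ A₁ : Matrix (Y × Z) X ℂ) (x₀ x₁ x₀' x₁' : X) (z z' : Z) (q q' : Fin 2) :
    2 * xiMap A₀ A₁ (Matrix.single (x₀, x₁) (x₀', x₁') 1) (z, q) (z', q') =
      (if x₁ = x₁' then ∑ y, (if q = 0 then A₀ (y, z) x₀ else A₁ (y, z) x₀) *
        star (if q' = 0 then A₀ (y, z') x₀' else A₁ (y, z') x₀') else 0) +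
      (if q = q' then -1 else 1) *
        (if x₀ = x₀' then ∑ y, (if q = 0 then A₀ (y, z) x₁ else A₁ (y, z) x₁) *
          star (if q' = 0 then A₀ (y, z') x₁' else A₁ (y, z') x₁') else 0) := by
  simp only [xiMap, LinearMap.sub_apply, LinearMap.comp_apply, trRight_single, trLeft_single,
    Matrix.sub_apply, mul_sub]
  rw [sub_eq_add_neg]
  congr 1
  · by_cases h : x₁ = x₁'
    · rw [if_pos h, if_pos h]
      simp only [trLeft, LinearMap.coe_mk, AddHom.coe_mk, Matrix.of_apply, conjBy_single,
        stackPlus_mul_star, Finset.mul_sum]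
      refine Finset.sum_congr rfl fun y _ => ?_
      rw [← mul_assoc]
      norm_num
    · rw [if_neg h, if_neg h]
      simp
  · have hs : ∀ y, stackMinus A₀ A₁ (y, (z, q)) x₁ * star (stackMinus A₀ A₁ (y, (z', q')) x₁') =
        1 / 2 * ((if q = q' then 1 else -1) * ((if q = 0 then A₀ (y, z) x₁ else A₁ (y, z) x₁) *
          star (if q' = 0 then A₀ (y, z') x₁' else A₁ (y, z') x₁'))) := fun y => by
      rw [stackMinus, stackPlus_mul_star]
      fin_cases q <;> fin_cases q' <;> simp
    by_cases h : x₀ = x₀'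
    · rw [if_pos h, if_pos h]
      simp only [trLeft, LinearMap.coe_mk, AddHom.coe_mk, Matrix.of_apply, conjBy_single]
      rw [Finset.sum_congr rfl fun y _ => hs y, Finset.mul_sum, Finset.mul_sum,
        ← Finset.sum_neg_distrib]
      refine Finset.sum_congr rfl fun y _ => ?_
      generalize (if q = 0 then A₀ (y, z) x₁ else A₁ (y, z) x₁) *
        star (if q' = 0 then A₀ (y, z') x₁' else A₁ (y, z') x₁') = c
      by_cases h' : q = q'
      · rw [if_pos h', if_pos h']; ring
      · rw [if_neg h', if_neg h']; ring
    · rw [if_neg h, if_neg h]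
      simp

/-! ### Gaussian integers modulo `T ^ 2 + 1` -/

/-- The homomorphism from the Gaussian integers that maps `i` to a given square root of `-1`. -/
noncomputable def gaussianLift {R : Type*} [CommRing R] (t : R) (ht : t * t = -1) :
    GaussianInt →+* R :=
  Zsqrtd.lift ⟨t, by simpa using ht⟩

theorem gaussianLift_apply {R : Type*} [CommRing R] (t : R) (ht : t * t = -1) (a : GaussianInt) :
    gaussianLift t ht a = a.re + a.im * t := rfl

/-- A number congruent modulo `m` to `a + b t`, where `a` and `b` are the real and the imaginary part
of a Gaussian integer. -/
def gaussianRes (m t : ℕ) (a : GaussianInt) : ℕ :=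
  (a.re.toNat + a.im.toNat * t) + ((-a.re).toNat + (-a.im).toNat * t) * (m - 1)

theorem gaussianRes_cast {m : ℕ} (hm : 0 < m) (t : ℕ) (a : GaussianInt) :
    (gaussianRes m t a : ZMod m) = a.re + a.im * (t : ZMod m) := by
  have h1 : ((m - 1 : ℕ) : ZMod m) = -1 := by rw [Nat.cast_sub hm]; simp
  have h2 : ∀ n : ℤ, (n : ZMod m) = (n.toNat : ZMod m) - ((-n).toNat : ZMod m) := fun n => by
    conv_lhs => rw [← Int.toNat_sub_toNat_neg n]
    rw [Int.cast_sub, Int.cast_natCast, Int.cast_natCast]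
  rw [gaussianRes, h2 a.re, h2 a.im]
  push_cast
  rw [h1]
  ring

/-- If `2 |v| < m`, then `v - r` is `0` or `-m`, and comparing `2 r` with `m` tells which. -/
theorem eq_of_residue {m r : ℕ} {v : ℤ} (hr : r < m) (hv : (r : ZMod m) = (v : ZMod m))
    (hb : 2 * |v| < m) :
    (if m < 2 * r then (-1 : ℤ) else 1) * ((if m < 2 * r then m - r else r : ℕ) : ℤ) = v := by
  have h1 : ((r : ℤ) : ZMod m) = (v : ZMod m) := by simpa using hv
  rw [ZMod.intCast_eq_intCast_iff_dvd_sub] at h1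
  obtain ⟨k, hk⟩ := h1
  rw [abs_eq_max_neg] at hb
  have hb1 : 2 * v < m := by have := le_max_left v (-v); omega
  have hb2 : - 2 * v < m := by have := le_max_right v (-v); omega
  have hm : (0 : ℤ) < m := by omega
  have hk1 : k < 1 := by
    by_contra h
    have : (m : ℤ) * 1 ≤ m * k := mul_le_mul_of_nonneg_left (by omega) hm.le
    omega
  have hk2 : -2 < k := by
    by_contra h
    have : (m : ℤ) * k ≤ m * (-2) := mul_le_mul_of_nonneg_left (by omega) hm.le
    omega
  obtain rfl | rfl : k = 0 ∨ k = -1 := by omega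
  · rw [mul_zero] at hk
    rw [if_neg (by omega), if_neg (by omega)]
    omega
  · rw [if_pos (by omega), if_pos (by omega)]
    omega

/-! ### Tables of signed integers -/

/-- The bit at position `j` of the table with fields of `L + 1` bits, the field `f` consisting of the
sign `sgn f` and the digits of `mag f`. -/
def tableBit (L : ℕ) (sgn mag : ℕ → ℕ) (j : ℕ) : ℕ :=
  if j % (L + 1) = 0 then sgn (j / (L + 1)) else bitAt (mag (j / (L + 1))) (j % (L + 1) - 1)

theorem readInt_table {L n f : ℕ} {sgn mag : ℕ → ℕ} (hf : f * (L + 1) + L < n)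
    (hmag : mag f < 2 ^ L) :
    readInt ((List.range n).map fun j => decide (tableBit L sgn mag j ≠ 0)) L (f * (L + 1)) =
      (if sgn f ≠ 0 then -1 else 1) * (mag f : ℤ) := by
  have hget : ∀ j < n, ((List.range n).map fun j => decide (tableBit L sgn mag j ≠ 0)).getD j false =
      decide (tableBit L sgn mag j ≠ 0) := fun j hj => by
    simp [List.getD_eq_getElem?_getD, hj]
  unfold readInt
  have h0 : tableBit L sgn mag (f * (L + 1)) = sgn f := by simp [tableBit]
  have h1 : (fun i : Fin L => ((List.range n).map fun j =>
      decide (tableBit L sgn mag j ≠ 0)).getD (f * (L + 1) + 1 + i) false) = natBits L (mag f) := by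
    funext i
    have hi := i.2
    have h2 : (f * (L + 1) + 1 + i) % (L + 1) = 1 + i := by
      rw [add_assoc, mul_comm, Nat.mul_add_mod, Nat.mod_eq_of_lt (by omega)]
    have h3 : (f * (L + 1) + 1 + i) / (L + 1) = f := by
      rw [add_assoc, mul_comm, Nat.mul_add_div (by omega), Nat.div_eq_of_lt (by omega), add_zero]
    rw [hget _ (by omega), tableBit, h2, h3, if_neg (by omega), Nat.add_sub_cancel_left,
      bitAt_eq_toNat, natBits]
    cases (mag f).testBit i <;> simp
  rw [hget _ (by omega), h0, h1, bitsToNat_natBits, Nat.mod_eq_of_lt hmag]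
  simp

/-! ### Common denominators -/

theorem exists_common_denominator {ι : Type*} [Fintype ι] (f : ι → ℂ)
    (hf : ∀ i, ∃ a b : ℚ, f i = (a : ℂ) + (b : ℂ) * Complex.I) :
    ∃ D : ℕ, 0 < D ∧ ∀ i, ∃ w : GaussianInt, GaussianInt.toComplex w = D * f i := by
  classical
  choose a b hab using hf
  refine ⟨∏ i, (a i).den * (b i).den, Finset.prod_pos fun i _ =>
    Nat.mul_pos (a i).den_pos (b i).den_pos, fun i => ?_⟩
  have key : ∀ (q : ℚ) (D : ℕ), q.den ∣ D → ∃ n : ℤ, ((D : ℚ) * q) = n := by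
    rintro q D ⟨k, rfl⟩
    refine ⟨k * q.num, ?_⟩
    push_cast
    rw [mul_comm (q.den : ℚ), mul_assoc, mul_comm (q.den : ℚ), Rat.mul_den_eq_num]
  have hd := Finset.dvd_prod_of_mem (fun i => (a i).den * (b i).den) (Finset.mem_univ i)
  obtain ⟨n₁, h₁⟩ := key (a i) _ ((Dvd.intro _ rfl).trans hd)
  obtain ⟨n₂, h₂⟩ := key (b i) _ ((Dvd.intro_left _ rfl).trans hd)
  refine ⟨⟨n₁, n₂⟩, ?_⟩
  rw [hab, GaussianInt.toComplex_def', mul_add, ← mul_assoc]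
  have h₁' := congrArg (fun q : ℚ => (q : ℂ)) h₁
  have h₂' := congrArg (fun q : ℚ => (q : ℂ)) h₂
  push_cast at h₁' h₂' ⊢
  rw [h₁', h₂']

/-- Finiteness of the support is recorded because it makes the table of gate entries computable by a
fixed program, via `PS.of_finite`. -/
theorem exists_integral_entries {s : ℕ} (𝒢 : Fin s → QGate) :
    ∃ (D : ℕ) (E : ℕ → ℕ → ℕ → ℕ → GaussianInt), 0 < D ∧
      (∀ g o ε i, GaussianInt.toComplex (E g o ε i) = D * gateEntry 𝒢 g o ε i) ∧
      {p : ℕ × ℕ × ℕ × ℕ | E p.1 p.2.1 p.2.2.1 p.2.2.2 ≠ 0}.Finite := by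
  obtain ⟨D, hD, h⟩ := exists_common_denominator
    (fun p : (g : Fin s) × ((Bits (𝒢 g).nout × Bits (𝒢 g).nenv) × Bits (𝒢 g).nin) =>
      (𝒢 p.1).mat p.2.1 p.2.2) (fun p => (𝒢 p.1).rational _ _)
  have h' : ∀ g o ε i, ∃ w : GaussianInt, GaussianInt.toComplex w = D * gateEntry 𝒢 g o ε i := by
    intro g o ε i
    unfold gateEntry
    split_ifs with hg hlt
    · exact h ⟨⟨g, hg⟩, (natBits _ o, natBits _ ε), natBits _ i⟩
    · exact ⟨0, by simp⟩
    · exact ⟨0, by simp⟩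
  choose E hE using h'
  refine ⟨D, E, hD, hE, ?_⟩
  obtain ⟨c, hc⟩ : ∃ c, ∀ g : Fin s, 2 ^ (𝒢 g).nout ≤ c ∧ 2 ^ (𝒢 g).nenv ≤ c ∧ 2 ^ (𝒢 g).nin ≤ c :=
    ⟨∑ g, (2 ^ (𝒢 g).nout + 2 ^ (𝒢 g).nenv + 2 ^ (𝒢 g).nin), fun g => by
      have : 2 ^ (𝒢 g).nout + 2 ^ (𝒢 g).nenv + 2 ^ (𝒢 g).nin ≤
          ∑ g, (2 ^ (𝒢 g).nout + 2 ^ (𝒢 g).nenv + 2 ^ (𝒢 g).nin) :=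
        Finset.single_le_sum
          (f := fun g => 2 ^ (𝒢 g).nout + 2 ^ (𝒢 g).nenv + 2 ^ (𝒢 g).nin)
          (fun i _ => Nat.zero_le _) (Finset.mem_univ g)
      exact ⟨by linarith [Nat.zero_le (2 ^ (𝒢 g).nenv), Nat.zero_le (2 ^ (𝒢 g).nin)],
        by linarith [Nat.zero_le (2 ^ (𝒢 g).nout), Nat.zero_le (2 ^ (𝒢 g).nin)],
        by linarith [Nat.zero_le (2 ^ (𝒢 g).nout), Nat.zero_le (2 ^ (𝒢 g).nenv)]⟩⟩
  refine Set.Finite.subset ((Set.finite_Iio s).prod ((Set.finite_Iio c).prod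
    ((Set.finite_Iio c).prod (Set.finite_Iio c)))) ?_
  rintro ⟨g, o, ε, i⟩ hp
  have hne : gateEntry 𝒢 g o ε i ≠ 0 := fun h0 => hp (by
    have := hE g o ε i
    rwa [h0, mul_zero, GaussianInt.toComplex_eq_zero] at this)
  unfold gateEntry at hne
  split_ifs at hne with hg hlt
  · have := hc ⟨g, hg⟩
    exact ⟨hg, hlt.1.trans_le this.1, hlt.2.1.trans_le this.2.1, hlt.2.2.trans_le this.2.2⟩
  all_goals exact absurd rfl hne

/-! ### Path sums in polynomial space -/

section
variable {α β γ δ : Type} [Denumerable α] [Denumerable β] [Denumerable γ] [Denumerable δ]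

theorem PS.comp₂ {f : β → γ → δ} {g : α → β} {h : α → γ} (hf : PS fun p : β × γ => f p.1 p.2)
    (hg : PS g) (hh : PS h) : PS fun a => f (g a) (h a) :=
  hf.comp (hg.mk hh)

/-- The values of `f` are bounded by a polynomial in the bit length of the argument. -/
def PolySmall (f : α → ℕ) : Prop := ∃ q : Polynomial ℕ, ∀ a, f a ≤ q.eval (codeSize a)

namespace PolySmall

theorem const (c : ℕ) : PolySmall fun _ : α => c := ⟨.C c, fun a => by simp⟩

theorem comp {f : β → ℕ} {g : α → β} (hf : PolySmall f) (hg : PS g) : PolySmall fun a => f (g a) := by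
  obtain ⟨p, hp⟩ := hf
  obtain ⟨q, hq⟩ := hg.codeSize_le
  refine ⟨p.comp q, fun a => (hp _).trans ?_⟩
  rw [Polynomial.eval_comp]
  exact p.eval_nat_mono (hq a)

theorem add {f g : α → ℕ} (hf : PolySmall f) (hg : PolySmall g) : PolySmall fun a => f a + g a := by
  obtain ⟨p, hp⟩ := hf
  obtain ⟨q, hq⟩ := hg
  exact ⟨p + q, fun a => by rw [Polynomial.eval_add]; exact add_le_add (hp a) (hq a)⟩

theorem mul {f g : α → ℕ} (hf : PolySmall f) (hg : PolySmall g) : PolySmall fun a => f a * g a := by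
  obtain ⟨p, hp⟩ := hf
  obtain ⟨q, hq⟩ := hg
  exact ⟨p * q, fun a => by rw [Polynomial.eval_mul]; exact Nat.mul_le_mul (hp a) (hq a)⟩

theorem mono {f g : α → ℕ} (hg : PolySmall g) (h : ∀ a, f a ≤ g a) : PolySmall f := by
  obtain ⟨q, hq⟩ := hg
  exact ⟨q, fun a => (h a).trans (hq a)⟩

theorem size {f : α → ℕ} (hf : PS f) : PolySmall fun a => (f a).size := hf.codeSize_le

end PolySmall

theorem PS.encode : PS fun b : β => Encodable.encode b := by
  simpa [PS] using PSpace.id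

theorem PS.ofNat : PS (Denumerable.ofNat β) := by
  simpa [PS] using PSpace.id

/-- Bounded iteration on a denumerable type. -/
theorem PS.iterate_encodable {b B : α → ℕ} {s : α → β} {h : α → β → β} (hb : PS b) (hs : PS s)
    (hh : PS fun p : α × β => h p.1 p.2) (hB : PS B)
    (hle : ∀ a, ∀ j ≤ b a, Encodable.encode ((h a)^[j] (s a)) ≤ B a) :
    PS fun a => (h a)^[b a] (s a) := by
  have key : ∀ a j, (fun x => Encodable.encode (h a (Denumerable.ofNat β x)))^[j]
      (Encodable.encode (s a)) = Encodable.encode ((h a)^[j] (s a)) := fun a j => by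
    induction j with
    | zero => rfl
    | succ j ih => rw [Function.iterate_succ_apply', ih, Function.iterate_succ_apply']; simp
  have := PS.iterate (h := fun a x => Encodable.encode (h a (Denumerable.ofNat β x))) hb
    (PS.encode.comp hs) (PS.encode.comp (hh.comp (PS.fst.mk (PS.ofNat.comp PS.snd)))) hB
    (fun a j hj => by rw [key]; exact hle a j hj)
  simpa [key] using PS.ofNat.comp (β := ℕ) (g := Denumerable.ofNat β) this

/-- A function that vanishes outside a finite set is computable in polynomial space. -/
theorem PS.of_finite {f : α → ℕ} (h : {a | f a ≠ 0}.Finite) : PS f := by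
  obtain ⟨n, hn⟩ : ∃ n, ∀ k, n ≤ k → f (Denumerable.ofNat α k) = 0 := by
    obtain ⟨n, hn⟩ := (h.image Encodable.encode).bddAbove
    refine ⟨n + 1, fun k hk => ?_⟩
    by_contra h0
    have := hn ⟨_, h0, rfl⟩
    simp at this
    omega
  simpa using (PS.of_finite_support n hn).comp (PS.encode (β := α))

theorem PS.gather {ℓ : α → ℕ → ℕ} {w p r : α → ℕ} (hℓ : PS fun p : α × ℕ => ℓ p.1 p.2) (hw : PS w)
    (hp : PS p) (hr : PS r) (hs : PolySmall r) :
    PS fun a => gather (ℓ a) (w a) (p a) (r a) := by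
  -- The exponent `i - (i - r a)` is the minimum of `i` and `r a`. It equals `i` in the range of
  -- summation, but it is polynomially small for every `i`, as `PS.pow` requires.
  have h : PS fun a => ∑ i ∈ Finset.range (r a),
      _root_.bitAt (w a) (ℓ a (p a + i)) * 2 ^ (i - (i - r a)) := by
    refine PS.sum hr ((PS.bitAt (hw.comp PS.fst) (PS.comp₂ hℓ PS.fst (by fun_prop))).mul
      (PS.pow (PS.const 2) (by fun_prop)
        ((hs.comp PS.fst).mono fun a => ?_)))
    omega
  convert h using 2 with a
  refine Finset.sum_congr rfl fun i hi => ?_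
  rw [Nat.sub_eq_zero_of_le (Finset.mem_range.1 hi).le, Nat.sub_zero]

section
variable {nin nout : ℕ → ℕ} {c : ℕ} {ℓ : α → ℕ → ℕ} {M : α → ℕ}

/-- Programs must respect the space bound on every input, so the state is bounded for arbitrary
sequences, not only for descriptions of circuits. -/
theorem iterate_nextState_le (hc : ∀ g, nin g ≤ c) (hc' : ∀ g, nout g ≤ c) {l : ℕ → ℕ} {M : ℕ}
    (hM : ∀ k, l k ≤ M) (st : ℕ × ℕ) (t : ℕ) :
    ((nextState nin nout l)^[t] st).1 ≤ st.1 + t * (3 + c + M) ∧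
      ((nextState nin nout l)^[t] st).2 ≤ st.2 + c + M := by
  induction t with
  | zero => simp; omega
  | succ t ih =>
    rw [Function.iterate_succ_apply']
    generalize (nextState nin nout l)^[t] st = u at ih
    have h1 := hc (l (u.1 + 1))
    have h2 := hc' (l (u.1 + 1))
    have h3 := hM (u.1 + 2)
    unfold nextState
    rw [add_mul, one_mul]
    generalize t * (3 + c + M) = v at ih ⊢
    split_ifs <;> refine ⟨?_, ?_⟩ <;> try simp only
    all_goals omega

theorem PS.nextState (hin : PS nin) (hout : PS nout) (hℓ : PS fun p : α × ℕ => ℓ p.1 p.2)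
    {st : α → ℕ × ℕ} (hst : PS st) : PS fun a => nextState nin nout (ℓ a) (st a) := by
  have h0 : PS fun a => ℓ a (st a).1 := PS.comp₂ hℓ PS.id (by fun_prop)
  have h1 : PS fun a => ℓ a ((st a).1 + 1) := PS.comp₂ hℓ PS.id (by fun_prop)
  have h2 : PS fun a => ℓ a ((st a).1 + 2) := PS.comp₂ hℓ PS.id (by fun_prop)
  have hp := PSPred.eq h0 (PS.const 0)
  have := (PS.ite hp (PS.fst.comp hst)
    ((((PS.fst.comp hst).add (PS.const 3)).add (hin.comp h1)).add h2)).mk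
    (PS.ite hp (PS.snd.comp hst) ((hout.comp h1).add h2))
  convert this using 2 with a
  unfold _root_.nextState
  split_ifs <;> rfl

theorem PS.iterate_nextState (hin : PS nin) (hout : PS nout) (hc : ∀ g, nin g ≤ c)
    (hc' : ∀ g, nout g ≤ c) (hℓ : PS fun p : α × ℕ => ℓ p.1 p.2) (hM : PS M) (hle : ∀ a k, ℓ a k ≤ M a)
    {st : α → ℕ × ℕ} (hst : PS st) {t : α → ℕ} (ht : PS t) :
    PS fun a => (_root_.nextState nin nout (ℓ a))^[t a] (st a) := by
  have hu : PS fun a => (st a).1 + (st a).2 + (t a + 1) * (3 + c + M a) + 1 := by fun_prop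
  refine PS.iterate_encodable ht hst
    (PS.nextState (ℓ := fun p : α × ℕ × ℕ => ℓ p.1) hin hout
      (hℓ.comp (f := fun p : (α × ℕ × ℕ) × ℕ => (p.1.1, p.2)) (by fun_prop)) PS.snd) (hu.mul hu)
    fun a j hj => ?_
  obtain ⟨h1, h2⟩ := iterate_nextState_le hc hc' (hle a) (st a) j
  generalize (_root_.nextState nin nout (ℓ a))^[j] (st a) = u at *
  have h3 : j * (3 + c + M a) ≤ t a * (3 + c + M a) := Nat.mul_le_mul_right _ hj
  rw [show Encodable.encode u = Nat.pair u.1 u.2 from rfl, ← sq]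
  refine (Nat.pair_lt_max_add_one_sq _ _).le.trans (Nat.pow_le_pow_left ?_ 2)
  rw [add_mul, one_mul]
  generalize t a * (3 + c + M a) = v at *
  omega

theorem PS.stepWeight (hin : PS nin) (hout : PS nout) (hc : ∀ g, nin g ≤ c)
    (hc' : ∀ g, nout g ≤ c) (hℓ : PS fun p : α × ℕ => ℓ p.1 p.2) (hM : PolySmall M)
    (hle : ∀ a k, ℓ a k ≤ M a) {ent : α → ℕ → ℕ → ℕ → ℕ → ℕ}
    (hent : PS fun p : α × ℕ × ℕ × ℕ × ℕ => ent p.1 p.2.1 p.2.2.1 p.2.2.2.1 p.2.2.2.2) {D : α → ℕ}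
    (hD : PS D) {st : α → ℕ × ℕ} (hst : PS st) {w w' ε : α → ℕ} (hw : PS w) (hw' : PS w')
    (hε : PS ε) :
    PS fun a => stepWeight nin nout (ℓ a) (ent a) (D a) (st a) (w a) (w' a) (ε a) := by
  have h0 : PS fun a => ℓ a (st a).1 := PS.comp₂ hℓ PS.id (by fun_prop)
  have h1 : PS fun a => ℓ a ((st a).1 + 1) := PS.comp₂ hℓ PS.id (by fun_prop)
  have h2 : PS fun a => ℓ a ((st a).1 + 2) := PS.comp₂ hℓ PS.id (by fun_prop)
  have hi := hin.comp h1
  have ho := hout.comp h1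
  have hpow : PS fun a => 2 ^ nout (ℓ a ((st a).1 + 1)) :=
    PS.pow (PS.const 2) ho ((PolySmall.const c).mono fun a => hc' _)
  have hmod := hw'.mod hpow
  have hg1 := PS.gather hℓ hw (((PS.fst.comp hst).add (PS.const 3)).add hi) h2
    (hM.mono fun a => hle _ _)
  have hg2 := PS.gather hℓ hw ((PS.fst.comp hst).add (PS.const 3)) hi
    ((PolySmall.const c).mono fun a => hc _)
  exact PS.ite (PSPred.eq h0 (PS.const 0))
    (PS.ite ((PSPred.eq hw' hw).and (PSPred.eq hε (PS.const 0))) hD (PS.const 0))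
    (PS.ite (PSPred.eq hw' (hmod.add (hpow.mul hg1)))
      (hent.comp (f := fun a => (a, _, _, _, _)) (PS.id.mk (h1.mk (hmod.mk (hε.mk hg2)))))
      (PS.const 0))

theorem PS.pathReg {W x p t : α → ℕ} (hW : PS W) (hx : PS x) (hp : PS p) (ht : PS t) :
    PS fun a => pathReg (W a) (x a) (p a) (t a) :=
  (PS.div_pow (hx.add (hW.mul hp)) hW ht).mod hW

/-- The number of steps `K` and the bound `M` on the parsed numbers must be polynomially small: then
the path codes below `W ^ K` and the gathered registers have polynomial length. The number of paths
is still exponential. -/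
theorem PS.ampNat (hin : PS nin) (hout : PS nout) (hc : ∀ g, nin g ≤ c)
    (hc' : ∀ g, nout g ≤ c) (hℓ : PS fun p : α × ℕ => ℓ p.1 p.2) (hM : PS M) (hM' : PolySmall M)
    (hle : ∀ a k, ℓ a k ≤ M a) {ent : α → ℕ → ℕ → ℕ → ℕ → ℕ}
    (hent : PS fun p : α × ℕ × ℕ × ℕ × ℕ => ent p.1 p.2.1 p.2.2.1 p.2.2.2.1 p.2.2.2.2)
    {D W B m K x y z : α → ℕ} (hD : PS D) (hW : PS W) (hB : PS B) (hm : PS m) (hm' : ∀ a, 0 < m a)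
    (hK : PS K) (hK' : PolySmall K) {st : α → ℕ × ℕ} (hst : PS st) (hst' : PolySmall fun a => (st a).2)
    (hx : PS x) (hy : PS y) (hz : PS z) :
    PS fun a => ampNat nin nout (ℓ a) (W a) (B a) (m a) (ent a) (D a) (K a) (st a) (x a) (y a)
      (z a) := by
  have f1 : PS fun p : α × ℕ => p.1 := PS.fst
  have f2 : PS fun p : (α × ℕ) × ℕ => p.1.1 := PS.fst.comp PS.fst
  have hℓ1 : PS fun p : (α × ℕ) × ℕ => ℓ p.1.1 p.2 :=
    hℓ.comp (f := fun p : (α × ℕ) × ℕ => (p.1.1, p.2)) (by fun_prop)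
  have hℓ2 : PS fun p : ((α × ℕ) × ℕ) × ℕ => ℓ p.1.1.1 p.2 :=
    hℓ.comp (f := fun p : ((α × ℕ) × ℕ) × ℕ => (p.1.1.1, p.2)) (by fun_prop)
  have hend : PS fun p : α × ℕ => (_root_.nextState nin nout (ℓ p.1))^[K p.1] (st p.1) :=
    (PS.iterate_nextState hin hout hc hc' hℓ hM hle hst hK).comp PS.fst
  have hcur : PS fun p : (α × ℕ) × ℕ => (_root_.nextState nin nout (ℓ p.1.1))^[p.2] (st p.1.1) :=
    PS.iterate_nextState (M := fun p : (α × ℕ) × ℕ => M p.1.1) hin hout hc hc'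
      (ℓ := fun p : (α × ℕ) × ℕ => ℓ p.1.1) hℓ2 (hM.comp f2) (fun _ => hle _) (hst.comp f2) PS.snd
  refine PS.sum (PS.pow hW hK hK') (PS.mul
    (PS.ite (PSPred.eq (hy.comp f1) (PS.gather (ℓ := fun p : α × ℕ => ℓ p.1) hℓ1
      (PS.pathReg (hW.comp f1) (hx.comp f1) PS.snd (hK.comp f1)) ((PS.fst.comp hend).add (PS.const 1))
      (PS.snd.comp hend) ?_)) (PS.const 1) (PS.const 0))
    (PS.prodMod (hm.comp f1) (hK.comp f1) ?_ fun a => hm' _))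
  · exact ((((hst'.add (PolySmall.const c)).add hM').comp f1).mono fun a =>
      (iterate_nextState_le hc hc' (hle a.1) (st a.1) _).2)
  · exact PS.stepWeight hin hout hc hc' (ℓ := fun p : (α × ℕ) × ℕ => ℓ p.1.1) hℓ2
      (M := fun p : (α × ℕ) × ℕ => M p.1.1) (hM'.comp f2) (fun _ => hle _)
      (ent := fun p : (α × ℕ) × ℕ => ent p.1.1)
      (hent.comp (f := fun p : ((α × ℕ) × ℕ) × ℕ × ℕ × ℕ × ℕ => (p.1.1.1, p.2)) (by fun_prop))
      (hD.comp f2) hcur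
      (PS.pathReg (hW.comp f2) (hx.comp f2) (PS.snd.comp PS.fst) PS.snd)
      (PS.pathReg (hW.comp f2) (hx.comp f2) (PS.snd.comp PS.fst) (PS.snd.add (PS.const 1)))
      ((PS.div_pow (hz.comp f2) (hB.comp f2) PS.snd).mod (hB.comp f2))

theorem PS.xiNat {m W : α → ℕ} {A A' : α → ℕ → ℕ → ℕ → ℕ → ℕ} (hm : PS m) (hW : PS W)
    (hA : PS fun p : α × ℕ × ℕ × ℕ × ℕ => A p.1 p.2.1 p.2.2.1 p.2.2.2.1 p.2.2.2.2)
    (hA' : PS fun p : α × ℕ × ℕ × ℕ × ℕ => A' p.1 p.2.1 p.2.2.1 p.2.2.2.1 p.2.2.2.2)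
    {x₀ x₁ x₀' x₁' z q z' q' : α → ℕ} (h₁ : PS x₀) (h₂ : PS x₁) (h₃ : PS x₀') (h₄ : PS x₁')
    (h₅ : PS z) (h₆ : PS q) (h₇ : PS z') (h₈ : PS q') :
    PS fun a => xiNat (m a) (W a) (A a) (A' a) (x₀ a) (x₁ a) (x₀' a) (x₁' a) (z a) (q a) (z' a)
      (q' a) := by
  have hsum : ∀ {x x' : α → ℕ}, PS x → PS x' → PS fun a => ∑ y ∈ Finset.range (W a),
      A a (q a) (x a) y (z a) * A' a (q' a) (x' a) y (z' a) := fun {x x'} hx hx' => by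
    refine PS.sum hW (PS.mul
      (hA.comp (f := fun p : α × ℕ => (p.1, q p.1, x p.1, p.2, z p.1)) ?_)
      (hA'.comp (f := fun p : α × ℕ => (p.1, q' p.1, x' p.1, p.2, z' p.1)) ?_))
    · exact PS.fst.mk ((h₆.comp PS.fst).mk ((hx.comp PS.fst).mk (PS.snd.mk (h₅.comp PS.fst))))
    · exact PS.fst.mk ((h₈.comp PS.fst).mk ((hx'.comp PS.fst).mk (PS.snd.mk (h₇.comp PS.fst))))
  exact (PS.ite (PSPred.eq h₂ h₄) (hsum h₁ h₃) (PS.const 0)).add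
    ((PS.ite (PSPred.eq h₆ h₈) (hm.sub (PS.const 1)) (PS.const 1)).mul
      (PS.ite (PSPred.eq h₁ h₃) (hsum h₂ h₄) (PS.const 0)))

end

end

/-! ### The bits of the table -/

/-- Number of inputs and outputs and integral multiples (by the factor `den`) of the matrix entries of
a finite set of gates. -/
structure GateTable where
  nin : ℕ → ℕ
  nout : ℕ → ℕ
  ent : ℕ → ℕ → ℕ → ℕ → GaussianInt
  den : ℕ
  c : ℕ
  nin_le : ∀ g, nin g ≤ c
  nout_le : ∀ g, nout g ≤ c
  den_le : den ≤ 2 ^ c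
  finite_nin : {g | nin g ≠ 0}.Finite
  finite_nout : {g | nout g ≠ 0}.Finite
  finite_ent : {p : ℕ × ℕ × ℕ × ℕ | ent p.1 p.2.1 p.2.2.1 p.2.2.2 ≠ 0}.Finite

namespace GateTable

/-- The input length `N`, computed from `2 ^ N`. -/
def len (W : ℕ) : ℕ := W.size - 1

theorem len_two_pow (N : ℕ) : len (2 ^ N) = N := by simp [len, Nat.size_pow]

/-- The sequence of numbers in the input `X`. -/
def seq (W X k : ℕ) : ℕ := numAt (len W) X k

variable (S : GateTable)

/-- The state in which the parser starts to read the circuit number `q`. -/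
def start (W X q : ℕ) : ℕ × ℕ :=
  (if q = 0 then 1 else
    ((nextState S.nin S.nout (seq W X))^[len W] (1, seq W X 0)).1 + 1 +
      ((nextState S.nin S.nout (seq W X))^[len W] (1, seq W X 0)).2, seq W X 0)

/-- The residue that represents the imaginary unit. -/
def unit (W : ℕ) : ℕ := 2 ^ (S.c * len W + 2)

/-- The modulus of the computation. -/
def modulus (W : ℕ) : ℕ := S.unit W * S.unit W + 1

/-- Amplitudes of the circuit `q` modulo `modulus W`, the imaginary unit being represented by `t`. -/
def ampRes (t W X q x y z : ℕ) : ℕ :=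
  ampNat S.nin S.nout (seq W X) W (2 ^ S.c) (S.modulus W)
    (fun g o ε i => gaussianRes (S.modulus W) t (S.ent g o ε i)) S.den (len W) (S.start W X q) x y z

/-- The number of bits of an address digit. -/
def width (W : ℕ) : ℕ := S.c * len W + len W + 1

/-- The digits of an address, the most significant one having the index `7`. -/
def digit (W a i : ℕ) : ℕ := a / (2 ^ S.width W) ^ i % 2 ^ S.width W

/-- The entry of the table at the address `a`, modulo `modulus W`. -/
def entryRes (t t' W X a : ℕ) : ℕ :=
  xiNat (S.modulus W) W (S.ampRes t W X) (S.ampRes t' W X) (S.digit W a 7) (S.digit W a 6)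
    (S.digit W a 5) (S.digit W a 4) (S.digit W a 3) (S.digit W a 2) (S.digit W a 1) (S.digit W a 0)

/-- The integer in the field `f` of the table, modulo `modulus W`. -/
def fieldRes (W X f : ℕ) : ℕ :=
  if f % 4 = 0 then
    (S.entryRes (S.unit W) (S.modulus W - S.unit W) W X (f / 4) +
      S.entryRes (S.modulus W - S.unit W) (S.unit W) W X (f / 4)) % S.modulus W
  else if f % 4 = 2 then
    ((S.entryRes (S.unit W) (S.modulus W - S.unit W) W X (f / 4) +
      (S.modulus W - 1) * S.entryRes (S.modulus W - S.unit W) (S.unit W) W X (f / 4)) *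
        (S.modulus W - S.unit W)) % S.modulus W
  else 4 * S.den ^ (2 * len W)

/-- The sign bit of the field `f`. -/
def sign (W X f : ℕ) : ℕ := if S.modulus W < 2 * S.fieldRes W X f then 1 else 0

/-- The absolute value of the integer in the field `f`. -/
def magnitude (W X f : ℕ) : ℕ :=
  if S.modulus W < 2 * S.fieldRes W X f then S.modulus W - S.fieldRes W X f else S.fieldRes W X f

/-- The number of digits of an integer in the table. -/
def digits (W : ℕ) : ℕ := 2 * (S.c * len W + 2) + 1

/-- The bit of the table at the position `j`. -/
def bit (p : ℕ × ℕ × ℕ) : ℕ :=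
  tableBit (S.digits p.1) (S.sign p.1 p.2.1) (S.magnitude p.1 p.2.1) p.2.2

/-- The length of the table. -/
def total (W : ℕ) : ℕ := 2 ^ (8 * S.width W) * (4 * (S.digits W + 1))

/-! ### The bits of the table in polynomial space -/

section
variable {α : Type} [Denumerable α] {W X q x y z t f a i : α → ℕ}

theorem ps_len (hW : PS W) : PS fun a => len (W a) := by unfold len; fun_prop

theorem polySmall_len (hW : PS W) : PolySmall fun a => len (W a) :=
  (PolySmall.size hW).mono fun _ => Nat.sub_le _ _

theorem ps_seq (hW : PS W) (hX : PS X) (hi : PS i) : PS fun a => seq (W a) (X a) (i a) :=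
  PS.numAt (ps_len hW) hX hi

theorem ps_nin : PS S.nin := PS.of_finite S.finite_nin

theorem ps_nout : PS S.nout := PS.of_finite S.finite_nout

theorem ps_seq_uncurried (hW : PS W) (hX : PS X) : PS fun p : α × ℕ => seq (W p.1) (X p.1) p.2 :=
  ps_seq (hW.comp PS.fst) (hX.comp PS.fst) PS.snd

theorem ps_start (hW : PS W) (hX : PS X) (hq : PS q) : PS fun a => S.start (W a) (X a) (q a) := by
  have h0 : PS fun a => seq (W a) (X a) 0 := ps_seq hW hX (PS.const 0)
  have h := PS.iterate_nextState (ℓ := fun a => seq (W a) (X a)) S.ps_nin S.ps_nout S.nin_le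
    S.nout_le (ps_seq_uncurried hW hX) (ps_len hW) (fun a k => numAt_le _ _ _)
    ((PS.const 1).mk h0) (ps_len hW)
  exact (PS.ite (PSPred.eq hq (PS.const 0)) (PS.const 1)
    (((PS.fst.comp h).add (PS.const 1)).add (PS.snd.comp h))).mk h0

theorem ps_unit (hW : PS W) : PS fun a => S.unit (W a) :=
  PS.pow (PS.const 2) (((PS.const S.c).mul (ps_len hW)).add (PS.const 2))
    (((PolySmall.const S.c).mul (polySmall_len hW)).add (PolySmall.const 2))

theorem ps_modulus (hW : PS W) : PS fun a => S.modulus (W a) :=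
  ((S.ps_unit hW).mul (S.ps_unit hW)).add (PS.const 1)

theorem ps_gaussianRes (hW : PS W) (ht : PS t) :
    PS fun p : α × ℕ × ℕ × ℕ × ℕ => gaussianRes (S.modulus (W p.1)) (t p.1)
      (S.ent p.2.1 p.2.2.1 p.2.2.2.1 p.2.2.2.2) := by
  have htab : ∀ F : GaussianInt → ℕ, F 0 = 0 →
      PS fun p : α × ℕ × ℕ × ℕ × ℕ => F (S.ent p.2.1 p.2.2.1 p.2.2.2.1 p.2.2.2.2) := fun F hF =>
    (PS.of_finite (f := fun p : ℕ × ℕ × ℕ × ℕ => F (S.ent p.1 p.2.1 p.2.2.1 p.2.2.2))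
      (S.finite_ent.subset fun p hp h0 => hp (by simp only [h0, hF]))).comp PS.snd
  have ht' : PS fun p : α × ℕ × ℕ × ℕ × ℕ => t p.1 := ht.comp PS.fst
  exact ((htab (fun a => a.re.toNat) rfl).add ((htab (fun a => a.im.toNat) rfl).mul ht')).add
    (((htab (fun a => (-a.re).toNat) rfl).add ((htab (fun a => (-a.im).toNat) rfl).mul ht')).mul
      ((S.ps_modulus (hW.comp PS.fst)).sub (PS.const 1)))

theorem ps_ampRes (ht : PS t) (hW : PS W) (hX : PS X) (hq : PS q) (hx : PS x) (hy : PS y)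
    (hz : PS z) : PS fun a => S.ampRes (t a) (W a) (X a) (q a) (x a) (y a) (z a) :=
  PS.ampNat S.ps_nin S.ps_nout S.nin_le S.nout_le (ps_seq_uncurried hW hX) (ps_len hW)
    (polySmall_len hW) (fun _ _ => numAt_le _ _ _) (S.ps_gaussianRes hW ht) (PS.const _) hW
    (PS.const _) (S.ps_modulus hW) (fun _ => Nat.succ_pos _) (ps_len hW) (polySmall_len hW)
    (S.ps_start hW hX hq) ((polySmall_len hW).mono fun _ => numAt_le _ _ _) hx hy hz

theorem ps_width (hW : PS W) : PS fun a => S.width (W a) :=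
  (((PS.const S.c).mul (ps_len hW)).add (ps_len hW)).add (PS.const 1)

theorem polySmall_width (hW : PS W) : PolySmall fun a => S.width (W a) :=
  (((PolySmall.const S.c).mul (polySmall_len hW)).add (polySmall_len hW)).add (PolySmall.const 1)

theorem ps_digit (hW : PS W) (ha : PS a) (i : ℕ) : PS fun x => S.digit (W x) (a x) i := by
  have h := PS.pow (PS.const 2) (S.ps_width hW) (S.polySmall_width hW)
  exact (PS.div_pow ha h (PS.const i)).mod h

theorem ps_entryRes {t' : α → ℕ} (ht : PS t) (ht' : PS t') (hW : PS W) (hX : PS X) (ha : PS a) :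
    PS fun x => S.entryRes (t x) (t' x) (W x) (X x) (a x) := by
  have hA : ∀ {u : α → ℕ}, PS u → PS fun p : α × ℕ × ℕ × ℕ × ℕ =>
      S.ampRes (u p.1) (W p.1) (X p.1) p.2.1 p.2.2.1 p.2.2.2.1 p.2.2.2.2 := fun {u} hu =>
    S.ps_ampRes (hu.comp PS.fst) (hW.comp PS.fst) (hX.comp PS.fst) (by fun_prop) (by fun_prop)
      (by fun_prop) (by fun_prop)
  exact PS.xiNat (S.ps_modulus hW) hW (hA ht) (hA ht') (S.ps_digit hW ha 7) (S.ps_digit hW ha 6)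
    (S.ps_digit hW ha 5) (S.ps_digit hW ha 4) (S.ps_digit hW ha 3) (S.ps_digit hW ha 2)
    (S.ps_digit hW ha 1) (S.ps_digit hW ha 0)

theorem ps_fieldRes (hW : PS W) (hX : PS X) (hf : PS f) :
    PS fun x => S.fieldRes (W x) (X x) (f x) := by
  have hm := S.ps_modulus hW
  have hu := S.ps_unit hW
  have hf4 := hf.div (PS.const 4)
  have hr := hf.mod (PS.const 4)
  have h1 := S.ps_entryRes hu (hm.sub hu) hW hX hf4
  have h2 := S.ps_entryRes (hm.sub hu) hu hW hX hf4
  exact PS.ite (PSPred.eq hr (PS.const 0)) ((h1.add h2).mod hm)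
    (PS.ite (PSPred.eq hr (PS.const 2))
      (((h1.add ((hm.sub (PS.const 1)).mul h2)).mul (hm.sub hu)).mod hm)
      ((PS.const 4).mul (PS.pow (PS.const _) ((PS.const 2).mul (ps_len hW))
        ((PolySmall.const 2).mul (polySmall_len hW)))))

end

theorem ps_bit : PS S.bit := by
  have hW : PS fun p : ℕ × ℕ × ℕ => p.1 := by fun_prop
  have hL : PS fun p : ℕ × ℕ × ℕ => S.digits p.1 + 1 :=
    (((PS.const 2).mul (((PS.const S.c).mul (ps_len hW)).add (PS.const 2))).add (PS.const 1)).add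
      (PS.const 1)
  have hj : PS fun p : ℕ × ℕ × ℕ => p.2.2 := by fun_prop
  have hr := S.ps_fieldRes hW (by fun_prop) (hj.div hL) (X := fun p : ℕ × ℕ × ℕ => p.2.1)
  have hm := S.ps_modulus hW
  have hlt := PSPred.lt hm ((PS.const 2).mul hr)
  exact PS.ite (PSPred.eq (hj.mod hL) (PS.const 0)) (PS.ite hlt (PS.const 1) (PS.const 0))
    (PS.bitAt (PS.ite hlt (hm.sub hr) hr) ((hj.mod hL).sub (PS.const 1)))

theorem ps_total : PS S.total :=
  (PS.pow (PS.const 2) ((PS.const 8).mul (S.ps_width PS.id))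
    ((PolySmall.const 8).mul (S.polySmall_width PS.id))).mul
    ((PS.const 4).mul ((((PS.const 2).mul (((PS.const S.c).mul (ps_len PS.id)).add
      (PS.const 2))).add (PS.const 1)).add (PS.const 1)))

/-- The circuits that compute the tables. -/
def circuit (N : ℕ) : BoolCircuit N :=
  DecisionTree.circuit N (S.total (2 ^ N)) fun c j => S.bit (2 ^ N, c, j)

theorem isNCPoly_circuit : IsNCPoly S.circuit :=
  DecisionTree.isNCPoly S.ps_total S.ps_bit

end GateTable

/-! ### Correctness of the table -/

theorem address_lt {k : ℕ} {l : List ℕ} (h : ∀ d ∈ l, d < 2 ^ k) :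
    address k l < 2 ^ (l.length * k) := by
  have : ∀ (l : List ℕ) (v s : ℕ), v < 2 ^ s → (∀ d ∈ l, d < 2 ^ k) →
      l.foldl (fun acc d => acc * 2 ^ k + d) v < 2 ^ (s + l.length * k) := by
    intro l
    induction l with
    | nil => intro v s hv _; simpa using hv
    | cons d l ih =>
      intro v s hv hd
      rw [List.foldl_cons, List.length_cons, add_mul, one_mul, add_comm (_ * k), ← add_assoc]
      refine ih _ _ ?_ fun e he => hd e (List.mem_cons_of_mem _ he)
      calc v * 2 ^ k + d < v * 2 ^ k + 2 ^ k := by have := hd d List.mem_cons_self; omega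
        _ = (v + 1) * 2 ^ k := by ring
        _ ≤ 2 ^ s * 2 ^ k := Nat.mul_le_mul_right _ hv
        _ = 2 ^ (s + k) := (pow_add _ _ _).symm
  have := this l 0 0 (by simp) h
  rwa [zero_add] at this

theorem sum_norm_sq_column {X Y Z : Type*} [Fintype X] [DecidableEq X] [Fintype Y] [Fintype Z]
    {A : Matrix (Y × Z) X ℂ} (hA : Aᴴ * A = 1) (x : X) : ∑ p, ‖A p x‖ ^ 2 = 1 := by
  have h := congrFun (congrFun hA x) x
  rw [Matrix.mul_apply, Matrix.one_apply_eq] at h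
  have h2 : ((∑ p, ‖A p x‖ ^ 2 : ℝ) : ℂ) = 1 := by
    rw [← h]
    push_cast
    refine Finset.sum_congr rfl fun p _ => ?_
    rw [Matrix.conjTranspose_apply, RCLike.star_def, mul_comm, Complex.mul_conj,
      Complex.normSq_eq_norm_sq]
    push_cast; rfl
  exact_mod_cast h2

/-- The columns of an isometry are unit vectors, and the sum is an inner product of parts of two
columns; `ab ≤ (a² + b²) / 2` suffices. -/
theorem norm_sum_mul_star_le {X Y Z : Type*} [Fintype X] [DecidableEq X] [Fintype Y] [Fintype Z]
    {A A' : Matrix (Y × Z) X ℂ} (hA : Aᴴ * A = 1) (hA' : A'ᴴ * A' = 1) (x x' : X) (z z' : Z) :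
    ‖∑ y, A (y, z) x * star (A' (y, z') x')‖ ≤ 1 := by
  have hle : ∀ {B : Matrix (Y × Z) X ℂ}, Bᴴ * B = 1 → ∀ x z, ∑ y, ‖B (y, z) x‖ ^ 2 ≤ 1 := by
    intro B hB x z
    rw [← sum_norm_sq_column hB x, Fintype.sum_prod_type]
    exact Finset.sum_le_sum fun y _ =>
      Finset.single_le_sum (f := fun z => ‖B (y, z) x‖ ^ 2) (fun _ _ => by positivity)
        (Finset.mem_univ z)
  calc ‖∑ y, A (y, z) x * star (A' (y, z') x')‖ ≤ ∑ y, ‖A (y, z) x * star (A' (y, z') x')‖ :=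
        norm_sum_le _ _
    _ ≤ ∑ y, (‖A (y, z) x‖ ^ 2 / 2 + ‖A' (y, z') x'‖ ^ 2 / 2) := by
        refine Finset.sum_le_sum fun y _ => ?_
        rw [norm_mul, norm_star]
        nlinarith [sq_nonneg (‖A (y, z) x‖ - ‖A' (y, z') x'‖)]
    _ ≤ 1 := by
        rw [Finset.sum_add_distrib, ← Finset.sum_div, ← Finset.sum_div]
        linarith [hle hA x z, hle hA' x' z']

/-- This a priori bound is what allows exact entries to be recovered from residues: it does not grow
with the number of paths. -/
theorem norm_two_mul_xiMap_single_le {X Y Z : Type*} [Fintype X] [DecidableEq X] [Fintype Y]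
    [Fintype Z] {A₀ A₁ : Matrix (Y × Z) X ℂ} (h₀ : A₀ᴴ * A₀ = 1) (h₁ : A₁ᴴ * A₁ = 1)
    (x₀ x₁ x₀' x₁' : X) (z z' : Z) (q q' : Fin 2) :
    ‖2 * xiMap A₀ A₁ (Matrix.single (x₀, x₁) (x₀', x₁') 1) (z, q) (z', q')‖ ≤ 2 := by
  have key : ∀ x x', ‖∑ y, (if q = 0 then A₀ (y, z) x else A₁ (y, z) x) *
      star (if q' = 0 then A₀ (y, z') x' else A₁ (y, z') x')‖ ≤ 1 := fun x x' => by
    have e : ∀ (q : Fin 2) p x, (if q = 0 then A₀ p x else A₁ p x) =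
        (if q = 0 then A₀ else A₁) p x := fun q p x => by split_ifs <;> rfl
    have h : ∀ q : Fin 2, (if q = 0 then A₀ else A₁)ᴴ * (if q = 0 then A₀ else A₁) = 1 := fun q => by
      split_ifs <;> assumption
    simp only [e]
    exact norm_sum_mul_star_le (h q) (h q') x x' z z'
  have hite : ∀ (p : Prop) [Decidable p] (a : ℂ), ‖a‖ ≤ 1 → ‖if p then a else 0‖ ≤ 1 :=
    fun p _ a ha => by
      split_ifs
      · exact ha
      · simp
  rw [two_mul_xiMap_single]
  refine (norm_add_le _ _).trans ?_
  rw [norm_mul]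
  have e1 : ‖(if q = q' then -1 else 1 : ℂ)‖ = 1 := by split_ifs <;> simp
  rw [e1, one_mul]
  linarith [hite (x₁ = x₁') _ (key x₀ x₀'), hite (x₀ = x₀') _ (key x₁ x₁')]

/-- Sums over the outputs of a circuit. -/
theorem sum_range_amp {R : Type*} [CommRing R] {nin nout ℓ : ℕ → ℕ} {B K m N x z : ℕ}
    (ent : ℕ → ℕ → ℕ → ℕ → R) (D : R) (st : ℕ × ℕ) (hx : x < 2 ^ N) (hmN : m ≤ N)
    (hst : ((nextState nin nout ℓ)^[K] st).2 = m) (f : ℕ → R) :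
    ∑ y ∈ Finset.range (2 ^ N), amp nin nout ℓ (2 ^ N) B ent D K st x y z * f y =
      ∑ y : Bits m, amp nin nout ℓ (2 ^ N) B ent D K st x (bitsToNat y) z * f (bitsToNat y) := by
  rw [sum_bitsToNat (fun y => amp nin nout ℓ (2 ^ N) B ent D K st x y z * f y)]
  refine (Finset.sum_subset (Finset.range_subset_range.2 (Nat.pow_le_pow_right (by norm_num) hmN))
    fun y _ hy => ?_).symm
  -- For `y ≥ 2 ^ m` no path ends in `y`, since the final register is gathered from `m` wires.
  rw [amp_eq_sum_paths _ _ _ _ _ _ _ (by positivity) _ _ _ _ _ hx, Finset.sum_eq_zero, zero_mul]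
  intro p _
  rw [if_neg, zero_mul]
  rintro rfl
  exact hy (Finset.mem_range.2 (hst ▸ gather_lt _ _ _ _))

/-! ### Amplitudes as Gaussian integers and their residues -/

namespace GateTable

/-- The table describes the gate set `𝒢`. -/
structure Describes (S : GateTable) {s : ℕ} (𝒢 : Fin s → QGate) : Prop where
  nin : S.nin = gateIn 𝒢
  nout : S.nout = gateOut 𝒢
  den_pos : 0 < S.den
  ent : ∀ g o ε i, GaussianInt.toComplex (S.ent g o ε i) = S.den * gateEntry 𝒢 g o ε i
  nenv_le : ∀ g, (𝒢 g).nenv ≤ S.c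

theorem exists_describes {s : ℕ} (𝒢 : Fin s → QGate) : ∃ S : GateTable, S.Describes 𝒢 := by
  obtain ⟨D, E, hD, hE, hfin⟩ := exists_integral_entries 𝒢
  have hle : ∀ (f : Fin s → ℕ) g, f g ≤ ∑ g, f g := fun f g =>
    Finset.single_le_sum (fun _ _ => Nat.zero_le _) (Finset.mem_univ g)
  -- One constant `c` dominates the widths of all gates. The summand `D` in it ensures `D ≤ 2 ^ c`.
  refine ⟨{ nin := gateIn 𝒢, nout := gateOut 𝒢, ent := E, den := D,
            c := ∑ g, (𝒢 g).nin + ∑ g, (𝒢 g).nout + ∑ g, (𝒢 g).nenv + D,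
            nin_le := fun g => ?_, nout_le := fun g => ?_, den_le := ?_,
            finite_nin := (Set.finite_Iio s).subset fun g hg => ?_,
            finite_nout := (Set.finite_Iio s).subset fun g hg => ?_,
            finite_ent := hfin }, rfl, rfl, hD, hE, fun g => ?_⟩
  · unfold gateIn
    split_ifs with h
    · have := hle (fun g => (𝒢 g).nin) ⟨g, h⟩
      beta_reduce at this
      omega
    · exact Nat.zero_le _
  · unfold gateOut
    split_ifs with h
    · have := hle (fun g => (𝒢 g).nout) ⟨g, h⟩
      beta_reduce at this
      omega
    · exact Nat.zero_le _
  · exact (Nat.lt_two_pow_self (n := D)).le.trans (Nat.pow_le_pow_right (by norm_num) (by omega))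
  · by_contra h; exact hg (dif_neg h)
  · by_contra h; exact hg (dif_neg h)
  · have := hle (fun g => (𝒢 g).nenv) g
    beta_reduce at this
    show (𝒢 g).nenv ≤ ∑ g, (𝒢 g).nin + ∑ g, (𝒢 g).nout + ∑ g, (𝒢 g).nenv + D
    omega

variable (S : GateTable)

/-- The amplitudes of the circuits, multiplied by a power of the common denominator. -/
def ampInt (W X q x y z : ℕ) : GaussianInt :=
  amp S.nin S.nout (seq W X) W (2 ^ S.c) S.ent S.den (len W) (S.start W X q) x y z

theorem unit_mul_self (W : ℕ) : (S.unit W : ZMod (S.modulus W)) * S.unit W = -1 := by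
  rw [eq_neg_iff_add_eq_zero]
  have : ((S.unit W * S.unit W + 1 : ℕ) : ZMod (S.modulus W)) = 0 := ZMod.natCast_self (S.modulus W)
  push_cast at this
  exact this

theorem neg_unit_mul_self (W : ℕ) : (-S.unit W : ZMod (S.modulus W)) * -S.unit W = -1 := by
  rw [neg_mul_neg, unit_mul_self]

theorem modulus_pos (W : ℕ) : 0 < S.modulus W := Nat.succ_pos _

theorem unit_le_modulus (W : ℕ) : S.unit W ≤ S.modulus W :=
  (Nat.le_mul_self _).trans (Nat.le_succ _)

theorem cast_modulus_sub_unit (W : ℕ) :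
    ((S.modulus W - S.unit W : ℕ) : ZMod (S.modulus W)) = -S.unit W := by
  rw [Nat.cast_sub (S.unit_le_modulus W)]
  simp

theorem ampRes_cast {t W : ℕ} {u : ZMod (S.modulus W)} (ht : (t : ZMod (S.modulus W)) = u)
    (hu : u * u = -1) (X q y z : ℕ) {x : ℕ} (hx : x < W) :
    (S.ampRes t W X q x y z : ZMod (S.modulus W)) = gaussianLift u hu (S.ampInt W X q x y z) := by
  rw [ampRes, ampNat_cast _ _ _ _ _ _ _ _ _ _ _ _ _ hx, ampInt, map_amp, map_natCast]
  congr
  funext g o ε i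
  rw [gaussianRes_cast (S.modulus_pos W), gaussianLift_apply, ht]

/-- Replacing the square root of `-1` by its negative amounts to complex conjugation. Thus the
conjugated amplitudes in the entries of `Ξ` are the same path sums evaluated at the other root. -/
theorem gaussianLift_neg {R : Type*} [CommRing R] (t : R) (ht : t * t = -1) (ht' : -t * -t = -1)
    (a : GaussianInt) : gaussianLift (-t) ht' a = gaussianLift t ht (star a) := by
  simp [gaussianLift_apply]

/-- The Gaussian integer that is stored, up to a factor, at an address. -/
def entryInt (W X x₀ x₁ x₀' x₁' z q z' q' : ℕ) : GaussianInt :=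
  xiSum W (S.ampInt W X) (fun q x y z => star (S.ampInt W X q x y z)) x₀ x₁ x₀' x₁' z q z' q'

theorem xiNat_ampRes_cast {t t' W : ℕ} {u : ZMod (S.modulus W)} (ht : (t : ZMod (S.modulus W)) = u)
    (ht' : (t' : ZMod (S.modulus W)) = -u) (hu : u * u = -1) (X z q z' q' : ℕ) {x₀ x₁ x₀' x₁' : ℕ}
    (h₀ : x₀ < W) (h₁ : x₁ < W) (h₀' : x₀' < W) (h₁' : x₁' < W) :
    (xiNat (S.modulus W) W (S.ampRes t W X) (S.ampRes t' W X) x₀ x₁ x₀' x₁' z q z' q' :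
      ZMod (S.modulus W)) = gaussianLift u hu (S.entryInt W X x₀ x₁ x₀' x₁' z q z' q') := by
  have hu' : -u * -u = -1 := by rw [neg_mul_neg, hu]
  rw [xiNat_cast (S.modulus_pos W), entryInt, map_xiSum]
  refine xiSum_congr (fun y => ?_) (fun y => ?_) (fun y => ?_) (fun y => ?_)
  · exact S.ampRes_cast ht hu _ _ _ _ h₀
  · exact S.ampRes_cast ht hu _ _ _ _ h₁
  · rw [S.ampRes_cast ht' hu' _ _ _ _ h₀', gaussianLift_neg u hu]
  · rw [S.ampRes_cast ht' hu' _ _ _ _ h₁', gaussianLift_neg u hu]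

end GateTable

/-! ### The amplitudes of an encoded pair of circuits -/

namespace GateTable

variable (S : GateTable) {s : ℕ} {𝒢 : Fin s → QGate} {n m N : ℕ}

/-- The Stinespring isometry whose entries are computed by the circuit family. -/
noncomputable def isometry (Q : QCircuit 𝒢 n m) (N e : ℕ) : Matrix (Bits m × Bits e) (Bits n) ℂ :=
  Matrix.of fun p x => Q.kraus (2 ^ S.c) N (bitsToNat p.2) p.1 x

/-- The number with the given binary digits. -/
def inputOf (Q₀ Q₁ : QCircuit 𝒢 n m) : ℕ :=
  DecisionTree.tailValue (encodeInstance Q₀ Q₁) (encodeInstance Q₀ Q₁).length 0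

theorem seq_inputOf (Q₀ Q₁ : QCircuit 𝒢 n m) (hN : N = (encodeInstance Q₀ Q₁).length) (k : ℕ) :
    seq (2 ^ N) (inputOf Q₀ Q₁) k = (n :: (Q₀.code ++ Q₁.code)).getD k 0 := by
  rw [seq, len_two_pow, inputOf, ← hN]
  exact numAt_unary (l := n :: (Q₀.code ++ Q₁.code)) hN k

theorem length_code_add_le (Q₀ Q₁ : QCircuit 𝒢 n m) (hN : N = (encodeInstance Q₀ Q₁).length) :
    Q₀.code.length + Q₁.code.length < N := by
  have := length_le_length_unary (n :: (Q₀.code ++ Q₁.code))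
  simp only [List.length_cons, List.length_append] at this
  rw [hN]
  exact this

theorem codeAt_fst (Q₀ Q₁ : QCircuit 𝒢 n m) (hN : N = (encodeInstance Q₀ Q₁).length) :
    Q₀.CodeAt (seq (2 ^ N) (inputOf Q₀ Q₁)) 1 := fun k hk => by
  rw [seq_inputOf Q₀ Q₁ hN, Nat.add_comm 1, List.getD_cons_succ, List.getD_append _ _ _ _ hk]

theorem codeAt_snd (Q₀ Q₁ : QCircuit 𝒢 n m) (hN : N = (encodeInstance Q₀ Q₁).length) :
    Q₁.CodeAt (seq (2 ^ N) (inputOf Q₀ Q₁)) (1 + Q₀.code.length) := fun k _ => by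
  rw [seq_inputOf Q₀ Q₁ hN, show 1 + Q₀.code.length + k = Q₀.code.length + k + 1 by ring,
    List.getD_cons_succ, List.getD_append_right _ _ _ _ (by omega), Nat.add_sub_cancel_left]

variable {S}

theorem start_inputOf (hS : S.Describes 𝒢) (Q₀ Q₁ : QCircuit 𝒢 n m)
    (hN : N = (encodeInstance Q₀ Q₁).length) (q : ℕ) :
    S.start (2 ^ N) (inputOf Q₀ Q₁) q = (if q = 0 then 1 else 1 + Q₀.code.length, n) := by
  have h0 : seq (2 ^ N) (inputOf Q₀ Q₁) 0 = n := by rw [seq_inputOf Q₀ Q₁ hN]; rfl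
  have hlt := length_code_add_le Q₀ Q₁ hN
  obtain ⟨h1, h2⟩ := Q₀.iterate_nextState 1 (codeAt_fst Q₀ Q₁ hN) N
    (by have := Q₀.length_le_length_code; omega)
  rw [start, len_two_pow, h0, hS.nin, hS.nout, h2, h1]

/-- Both circuits are run for exactly `N` steps. Hence both isometries share an environment of `c *
N` qubits and both amplitudes carry the same factor. -/
theorem toComplex_ampInt (hS : S.Describes 𝒢) (Q₀ Q₁ : QCircuit 𝒢 n m)
    (hN : N = (encodeInstance Q₀ Q₁).length) (q : ℕ) (x : Bits n) (y : Bits m)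
    (z : Bits (S.c * N)) :
    GaussianInt.toComplex
        (S.ampInt (2 ^ N) (inputOf Q₀ Q₁) q (bitsToNat x) (bitsToNat y) (bitsToNat z)) =
      S.den ^ N * (if q = 0 then S.isometry Q₀ N (S.c * N) (y, z) x
        else S.isometry Q₁ N (S.c * N) (y, z) x) := by
  have hlt := length_code_add_le Q₀ Q₁ hN
  have l0 := Q₀.length_le_length_code
  have l1 := Q₁.length_le_length_code
  have hz : bitsToNat z < (2 ^ S.c) ^ N := by rw [← pow_mul]; exact bitsToNat_lt z
  rw [ampInt, map_amp, start_inputOf hS Q₀ Q₁ hN, len_two_pow, map_natCast, hS.nin, hS.nout]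
  simp only [hS.ent]
  split_ifs
  · exact Q₀.amp_eq_kraus (S.den : ℂ) 1 (codeAt_fst Q₀ Q₁ hN) (by omega) N (by omega) x y _ hz
  · exact Q₁.amp_eq_kraus (S.den : ℂ) _ (codeAt_snd Q₀ Q₁ hN) (by omega) N (by omega) x y _ hz

theorem sum_ampInt (hS : S.Describes 𝒢) (Q₀ Q₁ : QCircuit 𝒢 n m)
    (hN : N = (encodeInstance Q₀ Q₁).length) (q q' : ℕ) (x x' : Bits n) (z z' : Bits (S.c * N)) :
    ∑ y ∈ Finset.range (2 ^ N),
        GaussianInt.toComplex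
          (S.ampInt (2 ^ N) (inputOf Q₀ Q₁) q (bitsToNat x) y (bitsToNat z)) *
        GaussianInt.toComplex
          (star (S.ampInt (2 ^ N) (inputOf Q₀ Q₁) q' (bitsToNat x') y (bitsToNat z'))) =
      S.den ^ (2 * N) * ∑ y, (if q = 0 then S.isometry Q₀ N (S.c * N) (y, z) x
          else S.isometry Q₁ N (S.c * N) (y, z) x) *
        star (if q' = 0 then S.isometry Q₀ N (S.c * N) (y, z') x'
          else S.isometry Q₁ N (S.c * N) (y, z') x') := by
  have hlt := length_code_add_le Q₀ Q₁ hN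
  have l0 := Q₀.length_le_length_code
  have l1 := Q₁.length_le_length_code
  have hx : bitsToNat x < 2 ^ N := (bitsToNat_lt x).trans_le
    (Nat.pow_le_pow_right (by norm_num) (by have := Q₀.lt_length_code; omega))
  have hst : ((nextState S.nin S.nout (seq (2 ^ N) (inputOf Q₀ Q₁)))^[len (2 ^ N)]
      (S.start (2 ^ N) (inputOf Q₀ Q₁) q)).2 = m := by
    rw [start_inputOf hS Q₀ Q₁ hN, len_two_pow, hS.nin, hS.nout]
    split_ifs
    · exact (Q₀.iterate_nextState 1 (codeAt_fst Q₀ Q₁ hN) N (by omega)).2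
    · exact (Q₁.iterate_nextState _ (codeAt_snd Q₀ Q₁ hN) N (by omega)).2
  have key := sum_range_amp (B := 2 ^ S.c) (z := bitsToNat z) S.ent (S.den : GaussianInt)
    _ hx (by have := Q₀.lt_length_code'; omega) hst
    (fun y => star (S.ampInt (2 ^ N) (inputOf Q₀ Q₁) q' (bitsToNat x') y (bitsToNat z')))
  have key' := congrArg GaussianInt.toComplex key
  simp only [map_sum, map_mul] at key'
  refine key'.trans ?_
  rw [Finset.mul_sum]
  refine Finset.sum_congr rfl fun y _ => ?_
  have h1 := toComplex_ampInt hS Q₀ Q₁ hN q x y z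
  have h2 := toComplex_ampInt hS Q₀ Q₁ hN q' x' y z'
  rw [ampInt] at h1
  rw [h1, GaussianInt.toComplex_star, h2, two_mul, pow_add]
  simp only [map_mul, map_pow, map_natCast, starRingEnd_apply]
  ring

theorem toComplex_entryInt (hS : S.Describes 𝒢) (Q₀ Q₁ : QCircuit 𝒢 n m)
    (hN : N = (encodeInstance Q₀ Q₁).length) (x₀ x₁ x₀' x₁' : Bits n) (z z' : Bits (S.c * N))
    (q q' : Fin 2) :
    GaussianInt.toComplex (S.entryInt (2 ^ N) (inputOf Q₀ Q₁) (bitsToNat x₀) (bitsToNat x₁)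
        (bitsToNat x₀') (bitsToNat x₁') (bitsToNat z) q (bitsToNat z') q') =
      S.den ^ (2 * N) * (2 * xiMap (S.isometry Q₀ N (S.c * N)) (S.isometry Q₁ N (S.c * N))
        (Matrix.single (x₀, x₁) (x₀', x₁') 1) (z, q) (z', q')) := by
  rw [two_mul_xiMap_single, entryInt, map_xiSum]
  unfold xiSum
  rw [sum_ampInt hS Q₀ Q₁ hN, sum_ampInt hS Q₀ Q₁ hN]
  simp only [bitsToNat_injective.eq_iff, Fin.val_eq_zero_iff, Fin.val_inj]
  rw [mul_add]
  congr 1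
  · split_ifs <;> simp
  · split_ifs <;> simp

end GateTable

/-! ### Decoding the output of the circuit family -/

namespace GateTable

variable {S : GateTable} {s : ℕ} {𝒢 : Fin s → QGate} {n m N : ℕ}

theorem toComplex_re_im (a : GaussianInt) :
    (a.re : ℝ) = (GaussianInt.toComplex a).re ∧ (a.im : ℝ) = (GaussianInt.toComplex a).im := by
  simp

theorem entryInt_bound (hS : S.Describes 𝒢) (Q₀ Q₁ : QCircuit 𝒢 n m)
    (hN : N = (encodeInstance Q₀ Q₁).length)
    (h₀ : (S.isometry Q₀ N (S.c * N))ᴴ * S.isometry Q₀ N (S.c * N) = 1)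
    (h₁ : (S.isometry Q₁ N (S.c * N))ᴴ * S.isometry Q₁ N (S.c * N) = 1)
    (x₀ x₁ x₀' x₁' : Bits n) (z z' : Bits (S.c * N)) (q q' : Fin 2) {G : GaussianInt}
    (hG : G = S.entryInt (2 ^ N) (inputOf Q₀ Q₁) (bitsToNat x₀) (bitsToNat x₁)
        (bitsToNat x₀') (bitsToNat x₁') (bitsToNat z) q (bitsToNat z') q') :
    |G.re| ≤ 2 * S.den ^ (2 * N) ∧ |G.im| ≤ 2 * S.den ^ (2 * N) := by
  have h := toComplex_entryInt hS Q₀ Q₁ hN x₀ x₁ x₀' x₁' z z' q q'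
  rw [← hG] at h
  have hn : ‖GaussianInt.toComplex G‖ ≤ 2 * S.den ^ (2 * N) := by
    rw [h, norm_mul, norm_pow, Complex.norm_natCast, mul_comm]
    exact mul_le_mul_of_nonneg_right
      (norm_two_mul_xiMap_single_le h₀ h₁ x₀ x₁ x₀' x₁' z z' q q') (by positivity)
  have h1 := (Complex.abs_re_le_norm _).trans hn
  have h2 := (Complex.abs_im_le_norm _).trans hn
  rw [← (toComplex_re_im G).1] at h1
  rw [← (toComplex_re_im G).2] at h2
  exact ⟨by exact_mod_cast h1, by exact_mod_cast h2⟩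

theorem digit_address {W x₀ x₁ x₂ x₃ x₄ x₅ x₆ x₇ : ℕ} (h₀ : x₀ < 2 ^ S.width W)
    (h₁ : x₁ < 2 ^ S.width W) (h₂ : x₂ < 2 ^ S.width W) (h₃ : x₃ < 2 ^ S.width W)
    (h₄ : x₄ < 2 ^ S.width W) (h₅ : x₅ < 2 ^ S.width W) (h₆ : x₆ < 2 ^ S.width W)
    (h₇ : x₇ < 2 ^ S.width W) :
    let a := address (S.width W) [x₀, x₁, x₂, x₃, x₄, x₅, x₆, x₇]
    S.digit W a 7 = x₀ ∧ S.digit W a 6 = x₁ ∧ S.digit W a 5 = x₂ ∧ S.digit W a 4 = x₃ ∧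
      S.digit W a 3 = x₄ ∧ S.digit W a 2 = x₅ ∧ S.digit W a 1 = x₆ ∧ S.digit W a 0 = x₇ := by
  have hd : ∀ v d i, d < 2 ^ S.width W → S.digit W (v * 2 ^ S.width W + d) (i + 1) =
      S.digit W v i := fun v d i h => by
    rw [digit, pow_succ', ← Nat.div_div_eq_div_mul, mul_comm, Nat.mul_add_div (by positivity),
      Nat.div_eq_of_lt h, add_zero, digit]
  have h0 : ∀ v d, d < 2 ^ S.width W → S.digit W (v * 2 ^ S.width W + d) 0 = d := fun v d h => by
    rw [digit, pow_zero, Nat.div_one, mul_comm, Nat.mul_add_mod, Nat.mod_eq_of_lt h]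
  simp only [address, List.foldl_cons, List.foldl_nil]
  refine ⟨?_, ?_, ?_, ?_, ?_, ?_, ?_, ?_⟩ <;> simp only [*]

/-- The integers of a record of the table. -/
def fieldInt (S : GateTable) (N : ℕ) (G : GaussianInt) (t : ℕ) : ℤ :=
  if t = 0 then 2 * G.re else if t = 2 then 2 * G.im else 4 * S.den ^ (2 * N)

/-- The stored integers are at most `4 * den ^ (2 * N)` in absolute value, so twice their size has
to lie below the modulus `T ^ 2 + 1`. The choice `T = 2 ^ (c * N + 2)` gives `T ^ 2 = 16 * 2 ^ (2 *
c * N)`, which is enough as `den ≤ 2 ^ c`. -/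
theorem den_pow_le (S : GateTable) (N : ℕ) : 8 * S.den ^ (2 * N) < S.modulus (2 ^ N) ∧
    S.modulus (2 ^ N) ≤ 2 ^ S.digits (2 ^ N) := by
  have h1 : S.den ^ (2 * N) ≤ 2 ^ (S.c * (2 * N)) := by
    rw [pow_mul 2]; exact Nat.pow_le_pow_left S.den_le _
  have h2 : S.unit (2 ^ N) * S.unit (2 ^ N) = 16 * 2 ^ (S.c * (2 * N)) := by
    rw [unit, len_two_pow, ← pow_add, show (16 : ℕ) = 2 ^ 4 by norm_num, ← pow_add]
    congr 1; ring
  have h3 : 2 ^ S.digits (2 ^ N) = 2 * (S.unit (2 ^ N) * S.unit (2 ^ N)) := by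
    rw [unit, digits, len_two_pow, ← pow_add, ← pow_succ']
    congr 1; ring
  have h4 : 0 < 2 ^ (S.c * (2 * N)) := by positivity
  rw [h3, modulus, h2]
  omega

/-- Evaluating the entry `G` at the two roots gives `re + im T` and `re - im T`. Their sum is `2
re`, and their difference times `-T` is `2 im`, because `T ^ 2 = -1` modulo the modulus. -/
theorem fieldRes_eq (Q₀ Q₁ : QCircuit 𝒢 n m)
    (hN : N = (encodeInstance Q₀ Q₁).length) {a t : ℕ} (ht : t < 4) (hn : n ≤ N)
    (x₀ x₁ x₀' x₁' : Bits n) (z z' : Bits (S.c * N)) (q q' : Fin 2)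
    (ha : a = address (S.width (2 ^ N)) [bitsToNat x₀, bitsToNat x₁, bitsToNat x₀', bitsToNat x₁',
      bitsToNat z, (q : ℕ), bitsToNat z', (q' : ℕ)]) {G : GaussianInt}
    (hG : G = S.entryInt (2 ^ N) (inputOf Q₀ Q₁) (bitsToNat x₀) (bitsToNat x₁)
        (bitsToNat x₀') (bitsToNat x₁') (bitsToNat z) q (bitsToNat z') q') :
    S.fieldRes (2 ^ N) (inputOf Q₀ Q₁) (4 * a + t) < S.modulus (2 ^ N) ∧
      (S.fieldRes (2 ^ N) (inputOf Q₀ Q₁) (4 * a + t) : ZMod (S.modulus (2 ^ N))) =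
        (S.fieldInt N G t : ZMod (S.modulus (2 ^ N))) := by
  have hx : ∀ x : Bits n, bitsToNat x < 2 ^ N := fun x =>
    (bitsToNat_lt x).trans_le (Nat.pow_le_pow_right (by norm_num) hn)
  have hle : ∀ {i j}, i < 2 ^ j → j ≤ S.c * N + N + 1 → i < 2 ^ S.width (2 ^ N) := fun h hj =>
    h.trans_le (Nat.pow_le_pow_right (by norm_num) (by rw [width, len_two_pow]; exact hj))
  have hq : ∀ q : Fin 2, (q : ℕ) < 2 ^ S.width (2 ^ N) := fun q =>
    hle (j := 1) (by simpa using q.2) (by omega)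
  have hx' : ∀ x : Bits n, bitsToNat x < 2 ^ S.width (2 ^ N) := fun x => hle (hx x) (by omega)
  have hz : ∀ z : Bits (S.c * N), bitsToNat z < 2 ^ S.width (2 ^ N) := fun z =>
    hle (bitsToNat_lt z) (by omega)
  obtain ⟨d7, d6, d5, d4, d3, d2, d1, d0⟩ := digit_address (S := S) (W := 2 ^ N)
    (hx' x₀) (hx' x₁) (hx' x₀') (hx' x₁') (hz z) (hq q) (hz z') (hq q')
  rw [← ha] at d7 d6 d5 d4 d3 d2 d1 d0
  have e1 : (S.entryRes (S.unit (2 ^ N)) (S.modulus (2 ^ N) - S.unit (2 ^ N)) (2 ^ N)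
      (inputOf Q₀ Q₁) a : ZMod (S.modulus (2 ^ N))) = G.re + G.im * S.unit (2 ^ N) := by
    rw [entryRes, d7, d6, d5, d4, d3, d2, d1, d0, S.xiNat_ampRes_cast rfl
      (S.cast_modulus_sub_unit _) (S.unit_mul_self _) _ _ _ _ _ (hx _) (hx _) (hx _) (hx _), ← hG,
      gaussianLift_apply]
  have e2 : (S.entryRes (S.modulus (2 ^ N) - S.unit (2 ^ N)) (S.unit (2 ^ N)) (2 ^ N)
      (inputOf Q₀ Q₁) a : ZMod (S.modulus (2 ^ N))) = G.re - G.im * S.unit (2 ^ N) := by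
    rw [entryRes, d7, d6, d5, d4, d3, d2, d1, d0, S.xiNat_ampRes_cast
      (S.cast_modulus_sub_unit _) (neg_neg _).symm (S.neg_unit_mul_self _) _ _ _ _ _ (hx _) (hx _)
      (hx _) (hx _), ← hG, gaussianLift_apply]
    ring
  have hdiv : (4 * a + t) / 4 = a := by omega
  have hmod : (4 * a + t) % 4 = t := by omega
  rw [fieldRes, hdiv, hmod, fieldInt]
  split_ifs with h h'
  · refine ⟨Nat.mod_lt _ (S.modulus_pos _), ?_⟩
    rw [ZMod.natCast_mod, Nat.cast_add, e1, e2]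
    push_cast
    ring
  · refine ⟨Nat.mod_lt _ (S.modulus_pos _), ?_⟩
    rw [ZMod.natCast_mod, Nat.cast_mul, Nat.cast_add, Nat.cast_mul, e1, e2,
      Nat.cast_sub (S.modulus_pos _), S.cast_modulus_sub_unit]
    have := S.unit_mul_self (2 ^ N)
    simp only [ZMod.natCast_self]
    push_cast
    linear_combination (-2 * (G.im : ZMod (S.modulus (2 ^ N)))) * this
  · have := (S.den_pow_le N).1
    rw [len_two_pow]
    exact ⟨by omega, by push_cast; rfl⟩

theorem readInt_circuit (hS : S.Describes 𝒢) (Q₀ Q₁ : QCircuit 𝒢 n m)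
    (hN : N = (encodeInstance Q₀ Q₁).length)
    (h₀ : (S.isometry Q₀ N (S.c * N))ᴴ * S.isometry Q₀ N (S.c * N) = 1)
    (h₁ : (S.isometry Q₁ N (S.c * N))ᴴ * S.isometry Q₁ N (S.c * N) = 1)
    {a t : ℕ} (ht : t < 4) (hn : n ≤ N)
    (x₀ x₁ x₀' x₁' : Bits n) (z z' : Bits (S.c * N)) (q q' : Fin 2)
    (ha : a = address (S.width (2 ^ N)) [bitsToNat x₀, bitsToNat x₁, bitsToNat x₀', bitsToNat x₁',
      bitsToNat z, (q : ℕ), bitsToNat z', (q' : ℕ)]) (ha' : a < 2 ^ (8 * S.width (2 ^ N)))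
    {G : GaussianInt}
    (hG : G = S.entryInt (2 ^ N) (inputOf Q₀ Q₁) (bitsToNat x₀) (bitsToNat x₁)
        (bitsToNat x₀') (bitsToNat x₁') (bitsToNat z) q (bitsToNat z') q') :
    readInt ((S.circuit N).output (encodeInstance Q₀ Q₁)) (S.digits (2 ^ N))
      ((4 * a + t) * (S.digits (2 ^ N) + 1)) = S.fieldInt N G t := by
  obtain ⟨hlt, hres⟩ := fieldRes_eq Q₀ Q₁ hN ht hn x₀ x₁ x₀' x₁' z z' q q' ha hG
  obtain ⟨hb1, hb2⟩ := entryInt_bound hS Q₀ Q₁ hN h₀ h₁ x₀ x₁ x₀' x₁' z z' q q' hG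
  obtain ⟨hm1, hm2⟩ := S.den_pow_le N
  have hm1' : (8 * S.den ^ (2 * N) : ℤ) < S.modulus (2 ^ N) := by exact_mod_cast hm1
  have hb : 2 * |S.fieldInt N G t| < S.modulus (2 ^ N) := by
    have hp : (0 : ℤ) ≤ S.den ^ (2 * N) := by positivity
    unfold fieldInt
    split_ifs
    · rw [abs_mul, abs_two]; linarith
    · rw [abs_mul, abs_two]; linarith
    · rw [abs_of_nonneg (by positivity)]; linarith
  have hmag : S.magnitude (2 ^ N) (inputOf Q₀ Q₁) (4 * a + t) < 2 ^ S.digits (2 ^ N) := by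
    unfold magnitude
    split_ifs <;> omega
  have hf : (4 * a + t) * (S.digits (2 ^ N) + 1) + S.digits (2 ^ N) < S.total (2 ^ N) := by
    rw [total, ← mul_assoc]
    calc (4 * a + t) * (S.digits (2 ^ N) + 1) + S.digits (2 ^ N)
        < (4 * a + t + 1) * (S.digits (2 ^ N) + 1) := by rw [add_mul (4 * a + t)]; omega
      _ ≤ _ := Nat.mul_le_mul_right _ (by omega)
  have hout : (S.circuit N).output (encodeInstance Q₀ Q₁) =
      (List.range (S.total (2 ^ N))).map fun j => decide (tableBit (S.digits (2 ^ N))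
        (S.sign (2 ^ N) (inputOf Q₀ Q₁)) (S.magnitude (2 ^ N) (inputOf Q₀ Q₁)) j ≠ 0) := by
    rw [circuit, DecisionTree.output_circuit, inputOf, ← hN]
    rfl
  rw [hout, readInt_table hf hmag, ← eq_of_residue hlt hres hb, sign, magnitude]
  congr 1
  split_ifs <;> simp_all

theorem representsMap (hS : S.Describes 𝒢) (Q₀ Q₁ : QCircuit 𝒢 n m)
    (hN : N = (encodeInstance Q₀ Q₁).length)
    (h₀ : (S.isometry Q₀ N (S.c * N))ᴴ * S.isometry Q₀ N (S.c * N) = 1)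
    (h₁ : (S.isometry Q₁ N (S.c * N))ᴴ * S.isometry Q₁ N (S.c * N) = 1) :
    RepresentsMap ((S.circuit N).output (encodeInstance Q₀ Q₁)) (S.width (2 ^ N))
      (S.digits (2 ^ N)) (xiMap (S.isometry Q₀ N (S.c * N)) (S.isometry Q₁ N (S.c * N))) := by
  have hn : n ≤ N := by
    have := length_code_add_le Q₀ Q₁ hN
    have := Q₀.lt_length_code
    omega
  have hw : S.width (2 ^ N) = S.c * N + N + 1 := by rw [width, len_two_pow]
  refine ⟨by omega, by omega, by omega, ?_, fun x₀ x₁ x₀' x₁' z z' q q' => ?_⟩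
  · rw [circuit, DecisionTree.output_circuit, List.length_map, List.length_range, total]
  · have hle : ∀ {i j}, i < 2 ^ j → j ≤ S.c * N + N + 1 → i < 2 ^ S.width (2 ^ N) := fun h hj =>
      h.trans_le (Nat.pow_le_pow_right (by norm_num) (by omega))
    have hq : ∀ q : Fin 2, (q : ℕ) < 2 ^ S.width (2 ^ N) := fun q =>
      hle (j := 1) (by simpa using q.2) (by omega)
    have ha' : address (S.width (2 ^ N)) [bitsToNat x₀, bitsToNat x₁, bitsToNat x₀', bitsToNat x₁',
        bitsToNat z, (q : ℕ), bitsToNat z', (q' : ℕ)] < 2 ^ (8 * S.width (2 ^ N)) := by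
      refine address_lt fun d hd => ?_
      simp only [List.mem_cons, List.not_mem_nil, or_false] at hd
      rcases hd with rfl | rfl | rfl | rfl | rfl | rfl | rfl | rfl
      any_goals exact hq _
      all_goals exact hle (bitsToNat_lt _) (by omega)
    have key := fun {t} (ht : t < 4) => readInt_circuit hS Q₀ Q₁ hN h₀ h₁ ht hn x₀ x₁ x₀' x₁' z z'
      q q' rfl ha' rfl
    have hG := toComplex_entryInt hS Q₀ Q₁ hN x₀ x₁ x₀' x₁' z z' q q'
    generalize S.entryInt (2 ^ N) (inputOf Q₀ Q₁) (bitsToNat x₀) (bitsToNat x₁) (bitsToNat x₀')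
      (bitsToNat x₁') (bitsToNat z) q (bitsToNat z') q' = G at key hG
    have hd : (S.den : ℂ) ^ (2 * N) ≠ 0 := pow_ne_zero _ (Nat.cast_ne_zero.2 hS.den_pos.ne')
    have hd' : (4 * S.den ^ (2 * N) : ℤ) ≠ 0 := by
      have := hS.den_pos
      positivity
    have f0 := key (t := 0) (by norm_num)
    have f1 := key (t := 1) (by norm_num)
    have f2 := key (t := 2) (by norm_num)
    have f3 := key (t := 3) (by norm_num)
    simp only [fieldInt, if_true, if_false, one_ne_zero, OfNat.one_ne_ofNat, OfNat.ofNat_ne_zero,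
      show ¬ (3 : ℕ) = 2 by norm_num] at f0 f1 f2 f3
    unfold StoresComplex
    simp only [f0, f1, f2, f3]
    refine ⟨hd', hd', ?_⟩
    -- Since `G` is `2 * den ^ (2 * N)` times the entry of `Ξ`, this entry has real part `2 re / (4
    -- den ^ (2 * N))`, as stored; the same holds for the imaginary part.
    rw [GaussianInt.toComplex_def] at hG
    push_cast
    field_simp
    linear_combination (-2 : ℂ) * hG

end GateTable

/-! ### Positive semidefinite matrices and polar decompositions -/

namespace Matrix

section
open scoped MatrixOrder
variable {J : Type*} [Fintype J] [DecidableEq J]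

/-- The spectrum is finite, so the functional calculus accepts discontinuous functions such as
indicators and `x ↦ (√x)⁻¹`. -/
theorem continuousOn_spectrum (A : Matrix J J ℂ) (f : ℝ → ℝ) : ContinuousOn f (spectrum ℝ A) :=
  A.finite_real_spectrum.continuousOn f

theorem cfc_mul' (A : Matrix J J ℂ) (f g : ℝ → ℝ) :
    cfc (fun x => f x * g x) A = cfc f A * cfc g A :=
  cfc_mul f g A (A.continuousOn_spectrum f) (A.continuousOn_spectrum g)

theorem isHermitian_cfc (A : Matrix J J ℂ) (f : ℝ → ℝ) : (cfc f A).IsHermitian :=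
  cfc_predicate (p := IsSelfAdjoint) f A

theorem posSemidef_cfc (A : Matrix J J ℂ) {f : ℝ → ℝ} (h : ∀ x, 0 ≤ f x) : (cfc f A).PosSemidef :=
  nonneg_iff_posSemidef.1 (cfc_nonneg fun x _ => h x)

theorem posSemidef_one_sub_cfc {A : Matrix J J ℂ} (hA : A.IsHermitian) {f : ℝ → ℝ}
    (h : ∀ x, f x ≤ 1) : (1 - cfc f A).PosSemidef := by
  have h1 := cfc_sub (fun _ : ℝ => (1 : ℝ)) f A (A.continuousOn_spectrum _) (A.continuousOn_spectrum f)
  rw [cfc_const_one ℝ A hA.isSelfAdjoint] at h1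
  rw [← h1]
  exact posSemidef_cfc A fun x => sub_nonneg.2 (h x)

theorem PosSemidef.cfc_congr {A : Matrix J J ℂ} (hA : A.PosSemidef) {f g : ℝ → ℝ}
    (h : ∀ x, 0 ≤ x → f x = g x) : cfc f A = cfc g A :=
  _root_.cfc_congr fun x hx => h x (spectrum_nonneg_of_nonneg (nonneg_iff_posSemidef.2 hA) hx)

theorem PosSemidef.exists_sqrt {A : Matrix J J ℂ} (hA : A.PosSemidef) :
    ∃ B : Matrix J J ℂ, B.PosSemidef ∧ B * B = A := by
  refine ⟨cfc Real.sqrt A, posSemidef_cfc A Real.sqrt_nonneg, ?_⟩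
  rw [← cfc_mul', hA.cfc_congr (g := fun x => x) fun x hx => Real.mul_self_sqrt hx]
  exact cfc_id' ℝ A hA.isHermitian.isSelfAdjoint

end

variable {I J : Type*} [Fintype I] [Fintype J]

theorem PosSemidef.trace_mul_nonneg {P Q : Matrix J J ℂ} (hP : P.PosSemidef) (hQ : Q.PosSemidef) :
    0 ≤ (P * Q).trace.re := by
  classical
  obtain ⟨C, hC, rfl⟩ := hQ.exists_sqrt
  have h := (hP.mul_mul_conjTranspose_same C).trace_nonneg
  rw [hC.isHermitian.eq, trace_mul_comm, ← Matrix.mul_assoc, trace_mul_comm] at h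
  exact (Complex.le_def.1 h).1

theorem trace_mul_conjTranspose_self_re (A : Matrix I J ℂ) :
    (A * Aᴴ).trace.re = ∑ i, ∑ j, ‖A i j‖ ^ 2 := by
  simp only [trace, diag_apply, mul_apply, conjTranspose_apply, Complex.re_sum]
  refine Finset.sum_congr rfl fun i _ => Finset.sum_congr rfl fun j _ => ?_
  rw [RCLike.star_def, Complex.mul_conj, Complex.normSq_eq_norm_sq, Complex.ofReal_re]

/-- The Cauchy-Schwarz inequality for the Hilbert-Schmidt inner product. -/
theorem norm_trace_mul_conjTranspose_le (A B : Matrix I J ℂ) :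
    ‖(A * Bᴴ).trace‖ ≤ Real.sqrt (A * Aᴴ).trace.re * Real.sqrt (B * Bᴴ).trace.re := by
  rw [trace_mul_conjTranspose_self_re, trace_mul_conjTranspose_self_re]
  simp only [← Fintype.sum_prod_type']
  have h : (A * Bᴴ).trace = ∑ p : I × J, A p.1 p.2 * star (B p.1 p.2) := by
    rw [Fintype.sum_prod_type]
    simp [trace, mul_apply]
  rw [h]
  refine (norm_sum_le _ _).trans ?_
  simp only [norm_mul, norm_star]
  exact Real.sum_mul_le_sqrt_mul_sqrt _ _ _

variable [DecidableEq J] [DecidableEq I]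

theorem posSemidef_one_sub_of_idempotent {P : Matrix I I ℂ} (hP : P.IsHermitian) (h : P * P = P) :
    (1 - P).PosSemidef := by
  have := posSemidef_conjTranspose_mul_self (1 - P)
  rwa [(isHermitian_one.sub hP).eq, mul_sub, sub_mul, sub_mul, h, one_mul, one_mul, mul_one, sub_self,
    sub_zero] at this

/-- Polar decomposition. -/
theorem exists_polar (N : Matrix I J ℂ) : ∃ V : Matrix I J ℂ,
    (1 - Vᴴ * V).PosSemidef ∧ (1 - V * Vᴴ).PosSemidef ∧ V * cfc Real.sqrt (Nᴴ * N) = N ∧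
      Vᴴ * N = cfc Real.sqrt (Nᴴ * N) := by
  have hH : (Nᴴ * N).PosSemidef := posSemidef_conjTranspose_mul_self N
  set H := Nᴴ * N with hHdef
  have hid : cfc (fun x : ℝ => x) H = H := cfc_id' ℝ H hH.isHermitian.isSelfAdjoint
  -- As `0⁻¹ = 0`, `G` is the pseudo-inverse of `|N|`, and `e` below is the projection onto the
  -- support of `|N|`. The partial isometry of the decomposition is `N * G`.
  set G := cfc (fun x => (Real.sqrt x)⁻¹) H with hG
  have hGH : Gᴴ = G := isHermitian_cfc H _
  set e := cfc (fun x : ℝ => if x = 0 then 0 else 1) H with he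
  have heH : eᴴ = e := isHermitian_cfc H _
  have hee : e * e = e := by
    rw [he, ← cfc_mul']
    congr 1; funext x; split_ifs <;> simp
  have hGS : G * cfc Real.sqrt H = e := by
    rw [hG, he, ← cfc_mul']
    refine hH.cfc_congr fun x hx => ?_
    split_ifs with h
    · simp [h]
    · exact inv_mul_cancel₀ (Real.sqrt_ne_zero'.2 (lt_of_le_of_ne hx (Ne.symm h)))
  have hGHS : G * H = cfc Real.sqrt H := by
    suffices h : G * cfc (fun x : ℝ => x) H = cfc Real.sqrt H by rwa [hid] at h
    rw [hG, ← cfc_mul']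
    refine hH.cfc_congr fun x hx => ?_
    by_cases h : x = 0
    · simp [h]
    · have h' := Real.sqrt_ne_zero'.2 (lt_of_le_of_ne hx (Ne.symm h))
      field_simp
      exact (Real.sq_sqrt hx).symm
  have hSG : cfc Real.sqrt H * G = e := by
    have := congrArg conjTranspose hGS
    rwa [conjTranspose_mul, hGH, heH, (isHermitian_cfc H _).eq] at this
  have hHe : H * e = H := by
    conv_lhs => rw [← hid, he]
    conv_rhs => rw [← hid]
    rw [← cfc_mul']
    congr 1; funext x; split_ifs with h <;> simp [h]
  -- `N` vanishes on the kernel of `Nᴴ * N`: the difference `N * e - N` has zero Gram matrix.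
  have hNe : N * e = N := by
    have h0 : (N * e - N)ᴴ * (N * e - N) = 0 := by
      have heh : e * H = H := by
        have := congrArg conjTranspose hHe
        rwa [conjTranspose_mul, heH, hH.isHermitian.eq] at this
      rw [conjTranspose_sub, conjTranspose_mul, heH, Matrix.sub_mul, Matrix.mul_sub, Matrix.mul_sub, Matrix.mul_assoc,
        ← Matrix.mul_assoc Nᴴ, Matrix.mul_assoc e, ← hHdef, hHe, heh]
      simp
    exact sub_eq_zero.1 (conjTranspose_mul_self_eq_zero.1 h0)
  have hVV : (N * G)ᴴ * (N * G) = e := by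
    rw [conjTranspose_mul, hGH, Matrix.mul_assoc, ← Matrix.mul_assoc Nᴴ, ← hHdef, ← Matrix.mul_assoc,
      hGHS, hSG]
  have heG : G * e = G := by
    rw [hG, he, ← cfc_mul']
    congr 1; funext x; split_ifs with h <;> simp [h]
  refine ⟨N * G, ?_, ?_, ?_, ?_⟩
  · rw [hVV]; exact posSemidef_one_sub_of_idempotent heH hee
  · refine posSemidef_one_sub_of_idempotent (isHermitian_mul_conjTranspose_self _) ?_
    rw [Matrix.mul_assoc, ← Matrix.mul_assoc _ (N * G), hVV, ← Matrix.mul_assoc, Matrix.mul_assoc N,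
      heG]
  · rw [Matrix.mul_assoc, hGS, hNe]
  · rw [conjTranspose_mul, hGH, Matrix.mul_assoc, ← hHdef, hGHS]

end Matrix

/-! ### The trace norm -/

section
variable {I J K : Type*} [Fintype I] [Fintype J] [Fintype K]
open Matrix

theorem trace_conj_le_of_contraction [DecidableEq I] {U : Matrix J I ℂ} (hU : (1 - Uᴴ * U).PosSemidef)
    (A : Matrix I K ℂ) : ((U * A) * (U * A)ᴴ).trace.re ≤ (A * Aᴴ).trace.re := by
  have h := (hU.trace_mul_nonneg (posSemidef_self_mul_conjTranspose A))
  rw [sub_mul, one_mul, trace_sub, Complex.sub_re, sub_nonneg] at h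
  rwa [conjTranspose_mul, trace_mul_comm, Matrix.mul_assoc, ← Matrix.mul_assoc Uᴴ, trace_mul_comm,
    Matrix.mul_assoc]

variable [DecidableEq I]

theorem traceNorm_nonneg (T : Matrix I I ℂ) : 0 ≤ traceNorm T :=
  (Complex.le_def.1 (posSemidef_cfc _ Real.sqrt_nonneg).trace_nonneg).1

/-- The trace norm is the value of a trace with a contraction. -/
theorem exists_traceNorm_eq (T : Matrix I I ℂ) :
    ∃ U : Matrix I I ℂ, (1 - Uᴴ * U).PosSemidef ∧ traceNorm T = (U * T).trace.re := by
  obtain ⟨V, -, h2, -, h4⟩ := exists_polar T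
  exact ⟨Vᴴ, by rwa [conjTranspose_conjTranspose], by rw [h4, traceNorm]⟩

/-- Write `T = W |T|` and `|T| = S * S`. Cauchy-Schwarz for the factors `U W S` and `S` gives the
bound, since contractions do not increase the Hilbert-Schmidt norm of `S`, whose square is the trace
norm. -/
theorem trace_mul_le_traceNorm {U : Matrix I I ℂ} (hU : (1 - Uᴴ * U).PosSemidef) (T : Matrix I I ℂ) :
    (U * T).trace.re ≤ traceNorm T := by
  obtain ⟨W, h1, -, h3, -⟩ := exists_polar T
  obtain ⟨S, hS, hSS⟩ := (posSemidef_cfc (Tᴴ * T) Real.sqrt_nonneg).exists_sqrt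
  have e : U * T = U * (W * S) * Sᴴ := by
    rw [hS.isHermitian.eq, Matrix.mul_assoc, Matrix.mul_assoc, hSS, h3]
  have hn : traceNorm T = (S * Sᴴ).trace.re := by rw [hS.isHermitian.eq, hSS, traceNorm]
  have h5 := (trace_conj_le_of_contraction hU (W * S)).trans (trace_conj_le_of_contraction h1 S)
  rw [← hn] at h5
  calc (U * T).trace.re ≤ ‖(U * T).trace‖ := Complex.re_le_norm _
    _ ≤ Real.sqrt (U * (W * S) * (U * (W * S))ᴴ).trace.re * Real.sqrt (S * Sᴴ).trace.re := by
        rw [e]; exact norm_trace_mul_conjTranspose_le _ _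
    _ ≤ Real.sqrt (traceNorm T) * Real.sqrt (traceNorm T) := by
        rw [hn] at h5 ⊢
        exact mul_le_mul_of_nonneg_right (Real.sqrt_le_sqrt h5) (Real.sqrt_nonneg _)
    _ = traceNorm T := Real.mul_self_sqrt (traceNorm_nonneg T)

/-- Factorization of a matrix into two factors of equal Hilbert-Schmidt norm. -/
theorem exists_factorization (M : Matrix I I ℂ) : ∃ E F : Matrix I I ℂ, M = E * Fᴴ ∧
    (E * Eᴴ).trace.re = traceNorm M ∧ (F * Fᴴ).trace.re = traceNorm M := by
  obtain ⟨W, -, -, h3, h4⟩ := exists_polar M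
  obtain ⟨S, hS, hSS⟩ := (posSemidef_cfc (Mᴴ * M) Real.sqrt_nonneg).exists_sqrt
  refine ⟨W * S, S, ?_, ?_, ?_⟩
  · rw [hS.isHermitian.eq, Matrix.mul_assoc, hSS, h3]
  · rw [conjTranspose_mul, hS.isHermitian.eq, Matrix.mul_assoc, ← Matrix.mul_assoc S, hSS,
      ← Matrix.mul_assoc, h3, trace_mul_comm, h4, traceNorm]
  · rw [hS.isHermitian.eq, hSS, traceNorm]

end

/-! ### Effects and the Powers-Størmer inequality -/

section
variable {I J : Type*} [Fintype I] [Fintype J] [DecidableEq J]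
open Matrix

/-- A bound for traces with effects. -/
theorem norm_trace_mul_effect_le {P : Matrix J J ℂ} (hP : P.PosSemidef) (A B : Matrix I J ℂ) :
    ‖(A * P * Bᴴ).trace‖ ≤ Real.sqrt (A * P * Aᴴ).trace.re * Real.sqrt (B * P * Bᴴ).trace.re := by
  obtain ⟨S, hS, rfl⟩ := hP.exists_sqrt
  have h := norm_trace_mul_conjTranspose_le (A * S) (B * S)
  simpa only [conjTranspose_mul, hS.isHermitian.eq, Matrix.mul_assoc] using h

/-- The inequality of Powers and Størmer. -/
theorem exists_effect_ge {A B : Matrix J J ℂ} (hA : A.PosSemidef) (hB : B.PosSemidef)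
    (hA1 : (A * A).trace.re = 1) (hB1 : (B * B).trace.re = 1) :
    ∃ P : Matrix J J ℂ, IsEffect P ∧ 1 - (A * B).trace.re ≤ (P * (A * A - B * B)).trace.re := by
  have hD : (A - B).IsHermitian := hA.isHermitian.sub hB.isHermitian
  set D := A - B with hDdef
  have hid : cfc (fun x : ℝ => x) D = D := cfc_id' ℝ D hD.isSelfAdjoint
  -- The effect is the projection onto the positive part of `A - B`; `R` and `R'` are the positive
  -- and negative parts.
  set P := cfc (fun x : ℝ => if 0 < x then 1 else 0) D with hP
  set R := cfc (fun x : ℝ => max x 0) D with hR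
  set R' := cfc (fun x : ℝ => max (-x) 0) D with hR'
  have hPD : P * D = R := by
    suffices h : P * cfc (fun x : ℝ => x) D = R by rwa [hid] at h
    rw [hP, hR, ← cfc_mul']
    congr 1; funext x
    split_ifs with h
    · rw [one_mul, max_eq_left h.le]
    · rw [zero_mul, max_eq_right (not_lt.1 h)]
  have hDP : D * P = R := by
    have := congrArg conjTranspose hPD
    rwa [conjTranspose_mul, hD.eq, (isHermitian_cfc D _).eq, (isHermitian_cfc D _).eq] at this
  have hRR : R - R' = D := by
    rw [hR, hR', ← cfc_sub _ _ D (D.continuousOn_spectrum _) (D.continuousOn_spectrum _)]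
    conv_rhs => rw [← hid]
    congr 1; funext x
    rcases le_total x 0 with h | h
    · rw [max_eq_right h, max_eq_left (by linarith)]; ring
    · rw [max_eq_left h, max_eq_right (by linarith)]; ring
  have hRR' : R * R' = 0 := by
    rw [hR, hR', ← cfc_mul', ← cfc_zero ℝ D]
    congr 1; funext x
    rcases le_total x 0 with h | h
    · rw [max_eq_right h, zero_mul]; rfl
    · rw [max_eq_right (by linarith : -x ≤ 0), mul_zero]; rfl
  have hRpos : R.PosSemidef := posSemidef_cfc D fun x => le_max_right _ _
  have hRpos' : R'.PosSemidef := posSemidef_cfc D fun x => le_max_right _ _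
  refine ⟨P, ⟨posSemidef_cfc D fun x => by split_ifs <;> norm_num,
    posSemidef_one_sub_cfc hD fun x => by split_ifs <;> norm_num⟩, ?_⟩
  have t1 : (P * (A * A - B * B)).trace.re = (R * (A + B)).trace.re := by
    -- Although `A` and `B` need not commute, the difference of squares is a symmetrized product; as
    -- `P` commutes with `D`, its trace against `P` is that of `R * (A + B)`.
    have e : (2 : ℂ) • (A * A - B * B) = D * (A + B) + (A + B) * D := by
      rw [hDdef, two_smul]; noncomm_ring
    have e2 : (2 : ℂ) * (P * (A * A - B * B)).trace = 2 * (R * (A + B)).trace := by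
      rw [← smul_eq_mul, ← trace_smul, ← Matrix.mul_smul, e, Matrix.mul_add, trace_add,
        ← Matrix.mul_assoc, hPD, ← Matrix.mul_assoc, trace_mul_comm (P * (A + B)),
        ← Matrix.mul_assoc, hDP]
      ring
    rw [mul_left_cancel₀ two_ne_zero e2]
  have t2 := hRpos.trace_mul_nonneg hB
  have t3 := hRpos'.trace_mul_nonneg hA
  have a1 : A = R - R' + B := by rw [hRR]; simp [hDdef]
  have t4 : ((A - B) * (A + B)).trace.re = 0 := by
    have : ((A - B) * (A + B)).trace = (A * A).trace - (B * B).trace := by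
      rw [sub_mul, Matrix.mul_add, Matrix.mul_add, trace_sub, trace_add, trace_add,
        trace_mul_comm B A]
      ring
    rw [this, Complex.sub_re, hA1, hB1, sub_self]
  have t5 : ((A - B) * (A - B)).trace.re = 2 - 2 * (A * B).trace.re := by
    have : ((A - B) * (A - B)).trace = (A * A).trace + (B * B).trace - 2 * (A * B).trace := by
      rw [sub_mul, Matrix.mul_sub, Matrix.mul_sub, trace_sub, trace_sub, trace_sub,
        trace_mul_comm B A]
      ring
    rw [this]
    simp [hA1, hB1]; norm_num
  have hR'R : R' * R = 0 := by
    have := congrArg conjTranspose hRR'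
    rwa [conjTranspose_mul, hRpos.isHermitian.eq, hRpos'.isHermitian.eq, conjTranspose_zero] at this
  rw [← hDdef, ← hRR] at t4 t5
  rw [sub_mul, Matrix.mul_sub, Matrix.mul_sub, hRR', hR'R, sub_zero, zero_sub, sub_neg_eq_add,
    trace_add, Complex.add_re] at t5
  rw [sub_mul, trace_sub, Complex.sub_re] at t4
  have t6 : (R * (A + B)).trace.re = (R * R).trace.re + 2 * (R * B).trace.re := by
    conv_lhs => rw [a1]
    rw [Matrix.mul_add, Matrix.mul_add, Matrix.mul_sub, hRR', sub_zero, trace_add, trace_add,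
      Complex.add_re, Complex.add_re]
    ring
  have b1 : B = A - (R - R') := by rw [hRR]; simp [hDdef]
  have t7 : (R' * (A + B)).trace.re = (R' * R').trace.re + 2 * (R' * A).trace.re := by
    conv_lhs => rw [b1]
    rw [Matrix.mul_add, Matrix.mul_sub, Matrix.mul_sub, hR'R, zero_sub, sub_neg_eq_add, trace_add,
      trace_add, Complex.add_re, Complex.add_re]
    ring
  -- By `t4` the traces of `R * (A + B)` and `R' * (A + B)` agree. By `t6` and `t7` they are at
  -- least those of `R * R` and `R' * R'`, whose sum is `2 - 2 tr (A * B)` by `t5`.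
  rw [t1]
  linarith

end

/-! ### The super-operator and pure states -/

section
variable {X Y Z V W K : Type*} [Fintype X] [Fintype K]

/-- The result of applying `C : ℂ^X → ℂ^Y ⊗ ℂ^V` to the first factor of a family of vectors in
`ℂ^X ⊗ ℂ^W`, arranged as a matrix. -/
def spread (C : Matrix (Y × V) X ℂ) (E : Matrix (X × W) K ℂ) : Matrix (Y × W) (V × K) ℂ :=
  Matrix.of fun p r => ∑ x, C (p.1, r.1) x * E (x, p.2) r.2

theorem mul_blocks (C C' : Matrix (Y × V) X ℂ) (E F : Matrix (X × W) K ℂ) (w w' : W) (a b : Y × V) :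
    (C * (Matrix.of fun x x' => (E * Fᴴ) (x, w) (x', w')) * C'ᴴ) a b =
      ∑ k, spread C E (a.1, w) (a.2, k) * star (spread C' F (b.1, w') (b.2, k)) := by
  have h : (Matrix.of fun x x' => (E * Fᴴ) (x, w) (x', w')) =
      (Matrix.of fun x k => E (x, w) k) * (Matrix.of fun x k => F (x, w') k)ᴴ := by
    ext x x'
    simp [Matrix.mul_apply]
  rw [h, ← Matrix.mul_assoc, Matrix.mul_assoc, ← Matrix.conjTranspose_mul, Matrix.mul_apply]
  simp [spread, Matrix.mul_apply]

theorem spread_mul_conjTranspose_spread [Fintype V] (C C' : Matrix (Y × V) X ℂ) (E F : Matrix (X × W) K ℂ)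
    (p p' : Y × W) : (spread C E * (spread C' F)ᴴ) p p' =
      trRight Y V (C * (Matrix.of fun x x' => (E * Fᴴ) (x, p.2) (x', p'.2)) * C'ᴴ) p.1 p'.1 := by
  simp only [trRight, LinearMap.coe_mk, AddHom.coe_mk, Matrix.of_apply, mul_blocks]
  rw [Matrix.mul_apply, Fintype.sum_prod_type]
  rfl

variable [Fintype Y] [Fintype W]

/-- One matrix `N = spread C E` carries both reductions: `N * Nᴴ` lives on the output of the channel
with its auxiliary space, `Nᴴ * N` on the complementary environment. This duality connects `Ξ` with
the diamond norm. -/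
theorem trLeft_conjBy_trRight (C : Matrix (Y × V) X ℂ) (E : Matrix (X × W) K ℂ) :
    trLeft Y V (conjBy C (trRight X W (E * Eᴴ))) =
      (trRight V K ((spread C E)ᴴ * spread C E))ᵀ := by
  have h : trRight X W (E * Eᴴ) = ∑ w, Matrix.of fun x x' => (E * Eᴴ) (x, w) (x', w) := by
    ext x x'
    simp [trRight, Matrix.sum_apply]
  ext v v'
  rw [h, map_sum]
  simp only [trLeft, trRight, conjBy, LinearMap.coe_mk, AddHom.coe_mk, Matrix.of_apply,
    Matrix.sum_apply, Matrix.transpose_apply, mul_blocks]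
  simp only [Matrix.mul_apply, Matrix.conjTranspose_apply, Fintype.sum_prod_type]
  simp only [mul_comm (star _)]
  rw [Finset.sum_congr rfl fun y _ => Finset.sum_comm, Finset.sum_comm]

theorem trace_trRight (M : Matrix (X × W) (X × W) ℂ) : (trRight X W M).trace = M.trace := by
  simp [Matrix.trace, trRight, Fintype.sum_prod_type]

theorem trace_trLeft (M : Matrix (X × W) (X × W) ℂ) : (trLeft X W M).trace = M.trace := by
  simp [Matrix.trace, trLeft, Fintype.sum_prod_type_right]

theorem trace_conjBy [DecidableEq X] {C : Matrix Y X ℂ} (hC : Cᴴ * C = 1) (M : Matrix X X ℂ) :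
    (conjBy C M).trace = M.trace := by
  simp only [conjBy, LinearMap.coe_mk, AddHom.coe_mk]
  rw [Matrix.trace_mul_comm, ← Matrix.mul_assoc, hC, Matrix.one_mul]

theorem trace_spread [Fintype V] [DecidableEq X] {C : Matrix (Y × V) X ℂ} (hC : Cᴴ * C = 1)
    (E : Matrix (X × W) K ℂ) : (spread C E * (spread C E)ᴴ).trace = (E * Eᴴ).trace := by
  have h := congrArg Matrix.trace (trLeft_conjBy_trRight C E)
  rw [trace_trLeft, trace_conjBy hC, trace_trRight, Matrix.trace_transpose, trace_trRight,
    Matrix.trace_mul_comm (spread C E)ᴴ] at h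
  exact h.symm

end

/-! ### The stacked isometries -/

section
variable {X Y Z W K : Type*} [Fintype X]

theorem stack_mul_conjTranspose (A₀ A₁ : Matrix (Y × Z) X ℂ) (M : Matrix X X ℂ) (y y' : Y) (z z' : Z)
    (q q' : Fin 2) : (stackPlus A₀ A₁ * M * (stackMinus A₀ A₁)ᴴ) (y, (z, q)) (y', (z', q')) =
      1 / 2 * ((if q = 0 then A₀ else A₁) * M * (if q' = 0 then A₀ else -A₁)ᴴ) (y, z) (y', z') := by
  simp only [Matrix.mul_apply, Matrix.conjTranspose_apply, Finset.mul_sum, Finset.sum_mul]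
  refine Finset.sum_congr rfl fun x' _ => Finset.sum_congr rfl fun x _ => ?_
  have h : (1 / (Real.sqrt 2 : ℂ)) * star (1 / (Real.sqrt 2 : ℂ)) = 1 / 2 := by
    simp only [star_div₀, star_one, RCLike.star_def, Complex.conj_ofReal]
    rw [div_mul_div_comm, one_mul, ← Complex.ofReal_mul, Real.mul_self_sqrt (by norm_num)]
    simp
  rw [← h]
  simp only [stackMinus, stackPlus, Matrix.of_apply, star_mul']
  split_ifs <;> ring

theorem stackPlus_isometry {X Y Z : Type*} [Fintype Y] [Fintype Z] [DecidableEq X] {A₀ A₁ : Matrix (Y × Z) X ℂ} (h₀ : A₀ᴴ * A₀ = 1)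
    (h₁ : A₁ᴴ * A₁ = 1) : (stackPlus A₀ A₁)ᴴ * stackPlus A₀ A₁ = 1 := by
  ext x x'
  have e₀ := congrFun (congrFun h₀ x) x'
  have e₁ := congrFun (congrFun h₁ x) x'
  simp only [Matrix.mul_apply, Matrix.conjTranspose_apply] at e₀ e₁ ⊢
  have hs : ∀ p : Y × Z × Fin 2, star (stackPlus A₀ A₁ p x) * stackPlus A₀ A₁ p x' =
      1 / 2 * (star (if p.2.2 = 0 then A₀ (p.1, p.2.1) x else A₁ (p.1, p.2.1) x) *
        (if p.2.2 = 0 then A₀ (p.1, p.2.1) x' else A₁ (p.1, p.2.1) x')) := fun p => by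
    rw [mul_comm, mul_comm (star _), ← stackPlus_mul_star A₀ A₁ p.1 p.1 p.2.1 p.2.1 p.2.2 p.2.2]
  rw [Finset.sum_congr rfl fun p _ => hs p, ← Finset.mul_sum]
  simp only [Fintype.sum_prod_type, Fin.sum_univ_two, if_true, one_ne_zero, if_false,
    Finset.sum_add_distrib] at e₀ e₁ ⊢
  rw [e₀, e₁]
  ring

theorem stackMinus_isometry {X Y Z : Type*} [Fintype Y] [Fintype Z] [DecidableEq X] {A₀ A₁ : Matrix (Y × Z) X ℂ} (h₀ : A₀ᴴ * A₀ = 1)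
    (h₁ : A₁ᴴ * A₁ = 1) : (stackMinus A₀ A₁)ᴴ * stackMinus A₀ A₁ = 1 :=
  stackPlus_isometry h₀ (by simpa using h₁)

/-- The trace over the extra qubit keeps the two diagonal blocks of `C₀ M C₁ᴴ`, which are `A₀ M A₀ᴴ
/ 2` and `-A₁ M A₁ᴴ / 2`. This identity is the reason for the construction of `C₀` and `C₁`. -/
theorem tensorId_sub_mul_conjTranspose [Fintype Y] [Fintype Z] [Fintype K] [DecidableEq X] {Q₀ Q₁ : Matrix X X ℂ →ₗ[ℂ] Matrix Y Y ℂ}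
    {A₀ A₁ : Matrix (Y × Z) X ℂ} (h₀ : IsStinespring Q₀ A₀) (h₁ : IsStinespring Q₁ A₁)
    (E F : Matrix (X × W) K ℂ) : tensorId W (Q₀ - Q₁) (E * Fᴴ) =
      (2 : ℂ) • (spread (stackPlus A₀ A₁) E * (spread (stackMinus A₀ A₁) F)ᴴ) := by
  ext p p'
  rw [Matrix.smul_apply, spread_mul_conjTranspose_spread]
  simp only [tensorId, LinearMap.coe_mk, AddHom.coe_mk, Matrix.of_apply, LinearMap.sub_apply, h₀.2,
    h₁.2]
  generalize (Matrix.of fun x x' => (E * Fᴴ) (x, p.2) (x', p'.2)) = M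
  simp only [trRight, LinearMap.coe_mk, AddHom.coe_mk, Matrix.of_apply, Matrix.sub_apply,
    Fintype.sum_prod_type, stack_mul_conjTranspose, Fin.sum_univ_two, if_true, one_ne_zero, if_false,
    smul_eq_mul, ← Finset.sum_sub_distrib, Finset.mul_sum]
  refine Finset.sum_congr rfl fun z _ => ?_
  rw [Matrix.conjTranspose_neg, Matrix.mul_neg, Matrix.neg_apply]
  ring

end

/-! ### Upper bound for the equilibrium value -/

/-- With `√p = cos α` and `√q = cos β` the hypothesis reads `c ≤ cos (α - β)`, and `p - q = sin (β -
α) sin (β + α)`. -/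
theorem sub_le_sqrt_one_sub_sq {p q c : ℝ} (hp : 0 ≤ p) (hp' : p ≤ 1) (hq : 0 ≤ q) (hq' : q ≤ 1)
    (hc : 0 ≤ c) (h : c ≤ Real.sqrt p * Real.sqrt q + Real.sqrt (1 - p) * Real.sqrt (1 - q)) :
    p - q ≤ Real.sqrt (1 - c ^ 2) := by
  refine Real.le_sqrt_of_sq_le ?_
  have a1 := Real.sq_sqrt hp
  have a2 := Real.sq_sqrt hq
  have a3 := Real.sq_sqrt (sub_nonneg.2 hp')
  have a4 := Real.sq_sqrt (sub_nonneg.2 hq')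
  generalize Real.sqrt p = P at *
  generalize Real.sqrt q = Q at *
  generalize Real.sqrt (1 - p) = P' at *
  generalize Real.sqrt (1 - q) = Q' at *
  have h1 : c ^ 2 ≤ (P * Q + P' * Q') ^ 2 := pow_le_pow_left₀ hc h 2
  have h2 : (P * Q + P' * Q') ^ 2 + (P * Q' - P' * Q) ^ 2 = 1 := by
    calc _ = (P ^ 2 + P' ^ 2) * (Q ^ 2 + Q' ^ 2) := by ring
      _ = 1 := by rw [a1, a2, a3, a4]; ring
  have h3 : (P * Q' + P' * Q) ^ 2 ≤ 1 := by
    have : (P * Q' + P' * Q) ^ 2 + (P * Q - P' * Q') ^ 2 = 1 := by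
      calc _ = (P ^ 2 + P' ^ 2) * (Q ^ 2 + Q' ^ 2) := by ring
        _ = 1 := by rw [a1, a2, a3, a4]; ring
    nlinarith [sq_nonneg (P * Q - P' * Q')]
  have h4 : p - q = (P * Q' - P' * Q) * (P * Q' + P' * Q) := by
    calc p - q = P ^ 2 * Q' ^ 2 - P' ^ 2 * Q ^ 2 := by rw [a1, a2, a3, a4]; ring
      _ = _ := by ring
  rw [h4, mul_pow]
  nlinarith [sq_nonneg (P * Q' - P' * Q)]

section
variable {X Y Z V W K : Type*} [Fintype X] [Fintype Y] [Fintype Z] [Fintype V] [Fintype W] [Fintype K]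
open Matrix
open scoped Kronecker

/-- Measuring the reduced operator by `P` is the same as measuring the unreduced one by `Pᵀ ⊗ 1`;
the transpose comes from `trLeft_conjBy_trRight`. -/
theorem hsInner_trLeft_conjBy [DecidableEq K] (C : Matrix (Y × V) X ℂ) (E : Matrix (X × W) K ℂ)
    {P : Matrix V V ℂ} (hP : P.IsHermitian) :
    hsInner P (trLeft Y V (conjBy C (trRight X W (E * Eᴴ)))) =
      (spread C E * (Pᵀ ⊗ₖ (1 : Matrix K K ℂ)) * (spread C E)ᴴ).trace.re := by
  rw [trLeft_conjBy_trRight, hsInner, hP.eq, Matrix.mul_assoc, Matrix.trace_mul_comm (spread C E),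
    Matrix.mul_assoc]
  generalize (spread C E)ᴴ * spread C E = G
  congr 1
  simp only [trace, diag_apply, mul_apply, transpose_apply, trRight, LinearMap.coe_mk, AddHom.coe_mk,
    of_apply, kroneckerMap_apply, one_apply, Fintype.sum_prod_type, Finset.mul_sum, mul_ite, mul_one,
    mul_zero, ite_mul, zero_mul, Finset.sum_ite_eq, Finset.mem_univ, if_true]
  rw [Finset.sum_comm]
  exact Finset.sum_congr rfl fun x _ => Finset.sum_comm

theorem hsInner_sub {J : Type*} [Fintype J] (P A B : Matrix J J ℂ) :
    hsInner P (A - B) = hsInner P A - hsInner P B := by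
  simp [hsInner, Matrix.mul_sub]

theorem trRight_kronecker {I J : Type*} [Fintype J] (A : Matrix I I ℂ) (B : Matrix J J ℂ) :
    trRight I J (A ⊗ₖ B) = B.trace • A := by
  ext i i'
  simp [trRight, Matrix.trace, ← Finset.mul_sum, mul_comm]

theorem trLeft_kronecker {I J : Type*} [Fintype I] (A : Matrix I I ℂ) (B : Matrix J J ℂ) :
    trLeft I J (A ⊗ₖ B) = A.trace • B := by
  ext i i'
  simp [trLeft, Matrix.trace, ← Finset.sum_mul]

theorem posSemidef_trRight {E : Matrix (X × W) K ℂ} : (trRight X W (E * Eᴴ)).PosSemidef := by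
  have h : trRight X W (E * Eᴴ) =
      ∑ w, (Matrix.of fun x k => E (x, w) k) * (Matrix.of fun x k => E (x, w) k)ᴴ := by
    ext x x'
    simp [trRight, Matrix.sum_apply, Matrix.mul_apply]
  rw [h]
  exact posSemidef_sum _ fun w _ => posSemidef_self_mul_conjTranspose _

theorem trace_mul_conjTranspose_self_eq {I J : Type*} [Fintype I] [Fintype J] (A : Matrix I J ℂ) :
    (A * Aᴴ).trace = ((A * Aᴴ).trace.re : ℂ) := by
  have := (Complex.le_def.1 (posSemidef_self_mul_conjTranspose A).trace_nonneg).2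
  exact Complex.ext rfl this.symm

theorem isDensity_kronecker [DecidableEq X] {E F : Matrix (X × W) K ℂ}
    (hE : (E * Eᴴ).trace.re = 1) (hF : (F * Fᴴ).trace.re = 1) :
    IsDensity (trRight X W (E * Eᴴ) ⊗ₖ trRight X W (F * Fᴴ)) := by
  refine ⟨posSemidef_trRight.kronecker posSemidef_trRight, ?_⟩
  rw [trace_kronecker, trace_trRight, trace_trRight, trace_mul_conjTranspose_self_eq, hE,
    trace_mul_conjTranspose_self_eq, hF]
  simp

variable [DecidableEq X] [DecidableEq Y] [DecidableEq W] [DecidableEq K]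
  {Q₀ Q₁ : Matrix X X ℂ →ₗ[ℂ] Matrix Y Y ℂ} {A₀ A₁ : Matrix (Y × Z) X ℂ}

/-- Let `p` and `q` be the probabilities of the effect in the two outputs. Half of the trace norm is
the real part of `tr (U N₀ N₁ᴴ)` for a contraction `U`. Inserting `R + (1 - R)` between `N₀` and
`N₁ᴴ` and applying Cauchy-Schwarz to both terms gives `√p √q + √(1 - p) √(1 - q)` as a bound. -/
theorem hsInner_xiMap_kronecker_le [DecidableEq Z] (h₀ : IsStinespring Q₀ A₀) (h₁ : IsStinespring Q₁ A₁)
    {E F : Matrix (X × W) K ℂ} (hE : (E * Eᴴ).trace.re = 1) (hF : (F * Fᴴ).trace.re = 1)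
    {P : Matrix (Z × Fin 2) (Z × Fin 2) ℂ} (hP : IsEffect P) :
    hsInner P (xiMap A₀ A₁ (trRight X W (E * Eᴴ) ⊗ₖ trRight X W (F * Fᴴ))) ≤
      Real.sqrt (1 - (traceNorm (tensorId W (Q₀ - Q₁) (E * Fᴴ)) / 2) ^ 2) := by
  have hR : (Pᵀ ⊗ₖ (1 : Matrix K K ℂ)).PosSemidef := hP.1.transpose.kronecker .one
  have hR' : (1 - Pᵀ ⊗ₖ (1 : Matrix K K ℂ)).PosSemidef := by
    have := hP.2.transpose.kronecker (PosSemidef.one (n := K) (R := ℂ))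
    have e : (1 - P)ᵀ ⊗ₖ (1 : Matrix K K ℂ) = 1 - Pᵀ ⊗ₖ (1 : Matrix K K ℂ) := by
      rw [eq_sub_iff_add_eq, ← add_kronecker, transpose_sub, transpose_one, sub_add_cancel,
        one_kronecker_one]
    rwa [e] at this
  have e1 : xiMap A₀ A₁ (trRight X W (E * Eᴴ) ⊗ₖ trRight X W (F * Fᴴ)) =
      trLeft Y (Z × Fin 2) (conjBy (stackPlus A₀ A₁) (trRight X W (E * Eᴴ))) -
        trLeft Y (Z × Fin 2) (conjBy (stackMinus A₀ A₁) (trRight X W (F * Fᴴ))) := by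
    simp only [xiMap, LinearMap.sub_apply, LinearMap.comp_apply, trRight_kronecker,
      trLeft_kronecker, trace_trRight]
    rw [trace_mul_conjTranspose_self_eq, hF, trace_mul_conjTranspose_self_eq E, hE]
    simp
  rw [e1, hsInner_sub, hsInner_trLeft_conjBy _ _ hP.1.isHermitian,
    hsInner_trLeft_conjBy _ _ hP.1.isHermitian, tensorId_sub_mul_conjTranspose h₀ h₁]
  have t0 : (spread (stackPlus A₀ A₁) E * (spread (stackPlus A₀ A₁) E)ᴴ).trace.re = 1 := by
    rw [trace_spread (stackPlus_isometry h₀.1 h₁.1), hE]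
  have t1 : (spread (stackMinus A₀ A₁) F * (spread (stackMinus A₀ A₁) F)ᴴ).trace.re = 1 := by
    rw [trace_spread (stackMinus_isometry h₀.1 h₁.1), hF]
  generalize spread (stackPlus A₀ A₁) E = N₀ at *
  generalize spread (stackMinus A₀ A₁) F = N₁ at *
  generalize Pᵀ ⊗ₖ (1 : Matrix K K ℂ) = R at *
  obtain ⟨U, hU, hUT⟩ := exists_traceNorm_eq ((2 : ℂ) • (N₀ * N₁ᴴ))
  have hnn := traceNorm_nonneg ((2 : ℂ) • (N₀ * N₁ᴴ))
  have hpos : ∀ {R : Matrix ((Z × Fin 2) × K) ((Z × Fin 2) × K) ℂ}, R.PosSemidef →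
      ∀ N : Matrix (Y × W) ((Z × Fin 2) × K) ℂ, 0 ≤ (N * R * Nᴴ).trace.re := fun hR N =>
    (Complex.le_def.1 (hR.mul_mul_conjTranspose_same N).trace_nonneg).1
  have hone : ∀ N : Matrix (Y × W) ((Z × Fin 2) × K) ℂ,
      (N * (1 - R) * Nᴴ).trace.re = (N * Nᴴ).trace.re - (N * R * Nᴴ).trace.re := fun N => by
    rw [Matrix.mul_sub, Matrix.mul_one, Matrix.sub_mul, trace_sub, Complex.sub_re]
  have hcon : ∀ {R : Matrix ((Z × Fin 2) × K) ((Z × Fin 2) × K) ℂ}, R.PosSemidef →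
      ‖(U * N₀ * R * N₁ᴴ).trace‖ ≤
        Real.sqrt (N₀ * R * N₀ᴴ).trace.re * Real.sqrt (N₁ * R * N₁ᴴ).trace.re := fun {R} hR => by
    refine (norm_trace_mul_effect_le hR (U * N₀) N₁).trans
      (mul_le_mul_of_nonneg_right (Real.sqrt_le_sqrt ?_) (Real.sqrt_nonneg _))
    obtain ⟨S, hS, rfl⟩ := hR.exists_sqrt
    have := trace_conj_le_of_contraction hU (N₀ * S)
    simpa only [conjTranspose_mul, hS.isHermitian.eq, Matrix.mul_assoc] using this
  have hc : traceNorm ((2 : ℂ) • (N₀ * N₁ᴴ)) / 2 ≤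
      ‖(U * N₀ * R * N₁ᴴ).trace‖ + ‖(U * N₀ * (1 - R) * N₁ᴴ).trace‖ := by
    have e2 : U * N₀ * R * N₁ᴴ + U * N₀ * (1 - R) * N₁ᴴ = U * (N₀ * N₁ᴴ) := by
      rw [← Matrix.add_mul, ← Matrix.mul_add, add_sub_cancel, Matrix.mul_one, Matrix.mul_assoc]
    have e3 : traceNorm ((2 : ℂ) • (N₀ * N₁ᴴ)) / 2 = (U * (N₀ * N₁ᴴ)).trace.re := by
      rw [hUT, Matrix.mul_smul, trace_smul]
      simp
    rw [e3, ← e2, trace_add]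
    exact (Complex.re_le_norm _).trans (norm_add_le _ _)
  have c0 := hcon hR
  have c1 := hcon hR'
  have p0 := hpos hR N₀
  have p1 := hpos hR N₁
  have p2 := hpos hR' N₀
  have p3 := hpos hR' N₁
  rw [hone] at p2 p3
  rw [hone, hone] at c1
  rw [t0] at p2 c1
  rw [t1] at p3 c1
  exact sub_le_sqrt_one_sub_sq p0 (by linarith) p1 (by linarith) (by linarith) (by linarith)

theorem traceNorm_tensorId_le (h₀ : IsStinespring Q₀ A₀) (h₁ : IsStinespring Q₁ A₁)
    (M : Matrix (X × W) (X × W) ℂ) :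
    traceNorm (tensorId W (Q₀ - Q₁) M) ≤ 2 * traceNorm M := by
  obtain ⟨E, F, hM, hE, hF⟩ := exists_factorization M
  rw [← trace_spread (stackPlus_isometry h₀.1 h₁.1)] at hE
  rw [← trace_spread (stackMinus_isometry h₀.1 h₁.1)] at hF
  conv_lhs => rw [hM, tensorId_sub_mul_conjTranspose h₀ h₁]
  generalize spread (stackPlus A₀ A₁) E = N₀ at *
  generalize spread (stackMinus A₀ A₁) F = N₁ at *
  obtain ⟨U, hU, hUT⟩ := exists_traceNorm_eq ((2 : ℂ) • (N₀ * N₁ᴴ))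
  rw [hUT, Matrix.mul_smul, trace_smul, ← Matrix.mul_assoc]
  have h1 := norm_trace_mul_conjTranspose_le (U * N₀) N₁
  have h2 := trace_conj_le_of_contraction hU N₀
  have h3 := Complex.re_le_norm (U * N₀ * N₁ᴴ).trace
  rw [hE] at h2
  rw [hF] at h1
  have h4 := mul_le_mul_of_nonneg_right (Real.sqrt_le_sqrt h2) (Real.sqrt_nonneg (traceNorm M))
  rw [Real.mul_self_sqrt (traceNorm_nonneg M)] at h4
  simp only [smul_eq_mul, Complex.mul_re, Complex.re_ofNat, Complex.im_ofNat, zero_mul, sub_zero]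
  linarith

/-- `diamondNorm` is a real supremum, which dominates the individual values only if they are
bounded. -/
theorem bddAbove_traceNorm_tensorId (h₀ : IsStinespring Q₀ A₀) (h₁ : IsStinespring Q₁ A₁) :
    BddAbove ((fun M => traceNorm (tensorId X (Q₀ - Q₁) M)) ''
      {M : Matrix (X × X) (X × X) ℂ | traceNorm M ≤ 1}) := by
  refine ⟨2, ?_⟩
  rintro _ ⟨M, hM, rfl⟩
  have := traceNorm_tensorId_le h₀ h₁ M
  simp only [Set.mem_ofPred_eq] at hM
  simp only
  linarith

theorem mul_traceNorm_le {c : ℝ} (T : Matrix X X ℂ) : c * traceNorm T ≤ traceNorm ((c : ℂ) • T) := by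
  obtain ⟨U, hU, h⟩ := exists_traceNorm_eq T
  refine le_of_eq_of_le ?_ (trace_mul_le_traceNorm hU ((c : ℂ) • T))
  rw [h, Matrix.mul_smul, trace_smul]
  simp

theorem traceNorm_zero : traceNorm (0 : Matrix X X ℂ) = 0 := by
  obtain ⟨U, -, h⟩ := exists_traceNorm_eq (0 : Matrix X X ℂ)
  simpa using h

/-- Normalized vectors on which a super-operator has a large norm. -/
theorem exists_lt_traceNorm_tensorId {Ψ : Matrix X X ℂ →ₗ[ℂ] Matrix Y Y ℂ} {r : ℝ} (hr : 0 ≤ r)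
    (h : r < diamondNorm Ψ) : ∃ E F : Matrix (X × X) (X × X) ℂ, (E * Eᴴ).trace.re = 1 ∧
      (F * Fᴴ).trace.re = 1 ∧ r < traceNorm (tensorId X Ψ (E * Fᴴ)) := by
  have hne : ((fun M => traceNorm (tensorId X Ψ M)) ''
      {M : Matrix (X × X) (X × X) ℂ | traceNorm M ≤ 1}).Nonempty :=
    ⟨_, 0, traceNorm_zero.trans_le zero_le_one, rfl⟩
  obtain ⟨_, ⟨M, hM, rfl⟩, hlt⟩ := exists_lt_of_lt_csSup hne h
  simp only [Set.mem_ofPred_eq] at hM hlt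
  obtain ⟨E, F, hEF, hE, hF⟩ := exists_factorization M
  set μ := traceNorm M with hμ
  have hpos : 0 < μ := by
    -- If the trace norm of `M` were zero, then `E`, hence `M` and its image, would vanish,
    -- contradicting `0 ≤ r`.
    refine lt_of_le_of_ne (traceNorm_nonneg M) fun h0 => ?_
    have hE0 : E = 0 := by
      rw [← trace_mul_conjTranspose_self_eq_zero_iff, trace_mul_conjTranspose_self_eq, hE, ← h0,
        Complex.ofReal_zero]
    rw [hEF, hE0, Matrix.zero_mul, map_zero, traceNorm_zero] at hlt
    linarith
  have hs : Real.sqrt μ⁻¹ * Real.sqrt μ⁻¹ = μ⁻¹ := Real.mul_self_sqrt (by positivity)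
  have hsc : ∀ A B : Matrix (X × X) (X × X) ℂ, ((Real.sqrt μ⁻¹ : ℂ) • A) * ((Real.sqrt μ⁻¹ : ℂ) • B)ᴴ =
      ((μ⁻¹ : ℝ) : ℂ) • (A * Bᴴ) := fun A B => by
    rw [conjTranspose_smul, RCLike.star_def, Complex.conj_ofReal, Matrix.smul_mul, Matrix.mul_smul,
      smul_smul, ← Complex.ofReal_mul, hs]
  -- Normalizing both factors multiplies `M` by `μ⁻¹ ≥ 1`, so the norm of the image does not
  -- decrease.
  refine ⟨(Real.sqrt μ⁻¹ : ℂ) • E, (Real.sqrt μ⁻¹ : ℂ) • F, ?_, ?_, ?_⟩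
  · rw [hsc, trace_smul, smul_eq_mul, Complex.re_ofReal_mul, hE, inv_mul_cancel₀ hpos.ne']
  · rw [hsc, trace_smul, smul_eq_mul, Complex.re_ofReal_mul, hF, inv_mul_cancel₀ hpos.ne']
  · rw [hsc, ← hEF, map_smul]
    refine hlt.trans_le ((le_mul_of_one_le_left (traceNorm_nonneg _) ?_).trans (mul_traceNorm_le _))
    exact (one_le_inv₀ hpos).2 hM

end

/-! ### Lower bound for the equilibrium value -/

section
variable {X Y Z : Type*} [Fintype X] [DecidableEq X] [Fintype Y] [DecidableEq Y] [Fintype Z]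
  [DecidableEq Z]
open Matrix
open scoped Kronecker

theorem isDensity_trRight {ρ : Matrix (X × X) (X × X) ℂ} (hρ : IsDensity ρ) :
    IsDensity (trRight X X ρ) := by
  obtain ⟨S, hS, hSS⟩ := hρ.1.exists_sqrt
  refine ⟨?_, by rw [trace_trRight, hρ.2]⟩
  have := posSemidef_trRight (E := S)
  rwa [hS.isHermitian.eq, hSS] at this

theorem isDensity_trLeft {ρ : Matrix (X × X) (X × X) ℂ} (hρ : IsDensity ρ) :
    IsDensity (trLeft X X ρ) :=
  isDensity_trRight (ρ := ρ.submatrix Prod.swap Prod.swap)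
    ⟨hρ.1.submatrix _, by
      rw [← hρ.2]; exact Fintype.sum_equiv (Equiv.prodComm X X) _ _ fun _ => rfl⟩

/-- Every density operator is the reduced state of a pure state. -/
theorem IsDensity.exists_purification {σ : Matrix X X ℂ} (hσ : IsDensity σ) :
    ∃ E : Matrix (X × X) Unit ℂ, trRight X X (E * Eᴴ) = σ ∧ (E * Eᴴ).trace.re = 1 := by
  -- The purifying vector lists the entries of `S = √σ`; its partial trace is `S * Sᴴ`.
  obtain ⟨S, hS, hSS⟩ := hσ.1.exists_sqrt
  have h : trRight X X ((of fun p _ => S p.1 p.2 : Matrix (X × X) Unit ℂ) *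
      (of fun p _ => S p.1 p.2 : Matrix (X × X) Unit ℂ)ᴴ) = σ := by
    conv_rhs => rw [← hSS]
    conv_rhs => enter [2]; rw [← hS.isHermitian.eq]
    ext x x'
    simp [trRight, mul_apply]
  exact ⟨_, h, by rw [← trace_trRight, h, hσ.2, Complex.one_re]⟩

variable {Q₀ Q₁ : Matrix X X ℂ →ₗ[ℂ] Matrix Y Y ℂ} {A₀ A₁ : Matrix (Y × Z) X ℂ}

/-- With purified marginals the two outputs are, up to a transpose, `|N₀| ^ 2` and `|N₁| ^ 2`.
Powers-Størmer gives an effect of payoff at least `1 - tr (|N₀| |N₁|)`, and this trace is at most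
the trace norm of `N₀ N₁ᴴ`, hence at most half of the diamond norm. -/
theorem exists_effect_hsInner_xiMap_ge (h₀ : IsStinespring Q₀ A₀) (h₁ : IsStinespring Q₁ A₁)
    {ρ : Matrix (X × X) (X × X) ℂ} (hρ : IsDensity ρ) :
    ∃ P : Matrix (Z × Fin 2) (Z × Fin 2) ℂ, IsEffect P ∧
      1 - diamondNorm (Q₀ - Q₁) / 2 ≤ hsInner P (xiMap A₀ A₁ ρ) := by
  obtain ⟨E, hE, hE1⟩ := (isDensity_trRight hρ).exists_purification
  obtain ⟨F, hF, hF1⟩ := (isDensity_trLeft hρ).exists_purification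
  have hxi : xiMap A₀ A₁ ρ = trLeft Y (Z × Fin 2) (conjBy (stackPlus A₀ A₁) (trRight X X (E * Eᴴ))) -
      trLeft Y (Z × Fin 2) (conjBy (stackMinus A₀ A₁) (trRight X X (F * Fᴴ))) := by
    rw [hE, hF]; rfl
  have hd : traceNorm (tensorId X (Q₀ - Q₁) (E * Fᴴ)) ≤ diamondNorm (Q₀ - Q₁) := by
    refine le_csSup (bddAbove_traceNorm_tensorId h₀ h₁) ⟨_, ?_, rfl⟩
    obtain ⟨U, hU, hUT⟩ := exists_traceNorm_eq (E * Fᴴ)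
    have h1 := norm_trace_mul_conjTranspose_le (U * E) F
    have h2 := trace_conj_le_of_contraction hU E
    rw [hE1] at h2
    rw [hF1, Real.sqrt_one, mul_one] at h1
    rw [Set.mem_ofPred_eq, hUT, ← Matrix.mul_assoc]
    exact (Complex.re_le_norm _).trans (h1.trans (Real.sqrt_le_one.2 h2))
  rw [tensorId_sub_mul_conjTranspose h₀ h₁] at hd
  rw [← trace_spread (stackPlus_isometry h₀.1 h₁.1)] at hE1
  rw [← trace_spread (stackMinus_isometry h₀.1 h₁.1)] at hF1
  have k0 := fun P (hP : P.IsHermitian) => hsInner_trLeft_conjBy (stackPlus A₀ A₁) E (P := P) hP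
  have k1 := fun P (hP : P.IsHermitian) => hsInner_trLeft_conjBy (stackMinus A₀ A₁) F (P := P) hP
  generalize spread (stackPlus A₀ A₁) E = N₀ at *
  generalize spread (stackMinus A₀ A₁) F = N₁ at *
  obtain ⟨V₀, a1, a2, a3, a4⟩ := exists_polar N₀
  obtain ⟨V₁, b1, b2, b3, b4⟩ := exists_polar N₁
  have hA := posSemidef_cfc (N₀ᴴ * N₀) Real.sqrt_nonneg
  have hB := posSemidef_cfc (N₁ᴴ * N₁) Real.sqrt_nonneg
  have hAA : cfc Real.sqrt (N₀ᴴ * N₀) * cfc Real.sqrt (N₀ᴴ * N₀) = N₀ᴴ * N₀ := by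
    rw [← cfc_mul', (posSemidef_conjTranspose_mul_self N₀).cfc_congr (g := fun x => x) fun x hx =>
      Real.mul_self_sqrt hx]
    exact cfc_id' ℝ _ (posSemidef_conjTranspose_mul_self N₀).isHermitian.isSelfAdjoint
  have hBB : cfc Real.sqrt (N₁ᴴ * N₁) * cfc Real.sqrt (N₁ᴴ * N₁) = N₁ᴴ * N₁ := by
    rw [← cfc_mul', (posSemidef_conjTranspose_mul_self N₁).cfc_congr (g := fun x => x) fun x hx =>
      Real.mul_self_sqrt hx]
    exact cfc_id' ℝ _ (posSemidef_conjTranspose_mul_self N₁).isHermitian.isSelfAdjoint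
  generalize cfc Real.sqrt (N₀ᴴ * N₀) = A at *
  generalize cfc Real.sqrt (N₁ᴴ * N₁) = B at *
  obtain ⟨P, hP, hge⟩ := exists_effect_ge hA hB (by rw [hAA, trace_mul_comm, hE1])
    (by rw [hBB, trace_mul_comm, hF1])
  -- The polar factors combine to a contraction `V₁ * V₀ᴴ` whose trace against `N₀ * N₁ᴴ` is that of
  -- `A * B`.
  have hAB : (A * B).trace.re ≤ diamondNorm (Q₀ - Q₁) / 2 := by
    have hU : (1 - (V₁ * V₀ᴴ)ᴴ * (V₁ * V₀ᴴ)).PosSemidef := by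
      have h1 := b1.mul_mul_conjTranspose_same V₀
      have h2 := a2.add h1
      have e : 1 - V₀ * V₀ᴴ + V₀ * (1 - V₁ᴴ * V₁) * V₀ᴴ = 1 - (V₁ * V₀ᴴ)ᴴ * (V₁ * V₀ᴴ) := by
        rw [conjTranspose_mul, conjTranspose_conjTranspose, Matrix.mul_sub, Matrix.sub_mul,
          Matrix.mul_one]
        simp only [Matrix.mul_assoc]
        abel
      rwa [e] at h2
    have h3 := trace_mul_le_traceNorm hU ((2 : ℂ) • (N₀ * N₁ᴴ))
    have e4 : (V₁ * V₀ᴴ * (N₀ * N₁ᴴ)).trace = (A * B).trace := by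
      have : N₁ᴴ * V₁ = B := by
        have := congrArg conjTranspose b4
        rwa [conjTranspose_mul, conjTranspose_conjTranspose, hB.isHermitian.eq] at this
      rw [Matrix.mul_assoc, ← Matrix.mul_assoc V₀ᴴ, a4, trace_mul_comm, Matrix.mul_assoc, this]
    rw [Matrix.mul_smul, trace_smul, e4] at h3
    simp only [smul_eq_mul, Complex.mul_re, Complex.re_ofNat, Complex.im_ofNat, zero_mul,
      sub_zero] at h3
    linarith
  -- The purifications are single vectors, so the index `K` is `Unit` and only has to be dropped;
  -- transposing undoes the transpose in `hsInner_trLeft_conjBy`.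
  set G : Matrix (Z × Fin 2) (Z × Fin 2) ℂ := (P.submatrix (fun v => (v, ())) fun v => (v, ()))ᵀ
    with hG
  have hGe : IsEffect G := by
    refine ⟨(hP.1.submatrix _).transpose, ?_⟩
    have e : 1 - G = ((1 - P).submatrix (fun v => (v, ())) fun v => (v, ()))ᵀ := by
      ext v v'
      simp [hG, one_apply, eq_comm]
    rw [e]
    exact (hP.2.submatrix _).transpose
  have hGP : Gᵀ ⊗ₖ (1 : Matrix Unit Unit ℂ) = P := by
    ext ⟨v, _⟩ ⟨v', _⟩
    simp [hG, kroneckerMap_apply]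
  refine ⟨G, hGe, ?_⟩
  rw [hxi, hsInner_sub, k0 G hGe.1.isHermitian, k1 G hGe.1.isHermitian, hGP]
  rw [hAA, hBB, Matrix.mul_sub, trace_sub, Complex.sub_re, ← Matrix.mul_assoc, ← Matrix.mul_assoc,
    trace_mul_comm (P * N₀ᴴ), trace_mul_comm (P * N₁ᴴ), ← Matrix.mul_assoc, ← Matrix.mul_assoc] at hge
  linarith

end

/-! ### Existence of the equilibrium value -/

section
variable {J : Type*} [Fintype J]
open Matrix

theorem Matrix.PosSemidef.norm_apply_le {P : Matrix J J ℂ} (hP : P.PosSemidef) (i j : J) :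
    ‖P i j‖ ≤ P.trace.re := by
  classical
  obtain ⟨S, hS, rfl⟩ := hP.exists_sqrt
  have h : (S * S).trace.re = ∑ i, ∑ j, ‖S i j‖ ^ 2 := by
    rw [← trace_mul_conjTranspose_self_re, hS.isHermitian.eq]
  have hle : ∀ i, ∑ k, ‖S i k‖ ^ 2 ≤ (S * S).trace.re := fun i => by
    rw [h]
    exact Finset.single_le_sum (f := fun i => ∑ k, ‖S i k‖ ^ 2)
      (fun _ _ => Finset.sum_nonneg fun _ _ => by positivity) (Finset.mem_univ i)
  calc ‖(S * S) i j‖ ≤ ∑ k, ‖S i k * S k j‖ := by rw [mul_apply]; exact norm_sum_le _ _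
    _ ≤ ∑ k, (‖S i k‖ ^ 2 / 2 + ‖S j k‖ ^ 2 / 2) := by
        refine Finset.sum_le_sum fun k _ => ?_
        rw [norm_mul, ← hS.isHermitian.apply k j, norm_star]
        nlinarith [sq_nonneg (‖S i k‖ - ‖S j k‖)]
    _ ≤ (S * S).trace.re := by
        rw [Finset.sum_add_distrib, ← Finset.sum_div, ← Finset.sum_div]
        linarith [hle i, hle j]

theorem isClosed_posSemidef : IsClosed {P : Matrix J J ℂ | P.PosSemidef} := by
  have : {P : Matrix J J ℂ | P.PosSemidef} =
      {P | Pᴴ = P} ∩ ⋂ x : J → ℂ, {P | 0 ≤ star x ⬝ᵥ (P *ᵥ x)} := by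
    ext P
    simp only [Set.mem_ofPred_eq, Set.mem_inter_iff, Set.mem_iInter]
    exact posSemidef_iff_dotProduct_mulVec
  rw [this]
  refine IsClosed.inter (isClosed_eq (continuous_id.matrix_conjTranspose) continuous_id)
    (isClosed_iInter fun x => ?_)
  have hc : Continuous fun P : Matrix J J ℂ => star x ⬝ᵥ (P *ᵥ x) := by fun_prop
  exact isClosed_le continuous_const hc

theorem isCompact_of_isClosed_of_norm_le {J : Type*} {s : Set (Matrix J J ℂ)} (hs : IsClosed s) (r : ℝ)
    (h : ∀ P ∈ s, ∀ i j, ‖P i j‖ ≤ r) : IsCompact s := by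
  have hc : IsCompact (Set.univ.pi fun _ : J => Set.univ.pi fun _ : J => Metric.closedBall (0 : ℂ) r) :=
    isCompact_univ_pi fun _ => isCompact_univ_pi fun _ => isCompact_closedBall _ _
  exact hc.of_isClosed_subset hs fun P hP i _ j _ => by simpa using h P hP i j

theorem isCompact_densities : IsCompact {ρ : Matrix J J ℂ | IsDensity ρ} := by
  refine isCompact_of_isClosed_of_norm_le (isClosed_posSemidef.inter
    (isClosed_eq (Continuous.matrix_trace continuous_id) continuous_const)) 1 fun P hP i j => ?_
  have := hP.1.norm_apply_le i j
  rwa [hP.2, Complex.one_re] at this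

theorem convex_posSemidef {J : Type*} : Convex ℝ {P : Matrix J J ℂ | P.PosSemidef} := by
  intro P hP Q hQ a b ha hb _
  have h : ∀ (c : ℝ) (R : Matrix J J ℂ), c • R = (c : ℂ) • R := fun c R => by
    ext; simp
  rw [h, h]
  exact (hP.smul (Complex.zero_le_real.2 ha)).add (hQ.smul (Complex.zero_le_real.2 hb))

theorem convex_densities : Convex ℝ {ρ : Matrix J J ℂ | IsDensity ρ} := by
  refine convex_posSemidef.inter (t := {ρ : Matrix J J ℂ | ρ.trace = 1}) ?_
  intro P (hP : P.trace = 1) Q (hQ : Q.trace = 1) a b _ _ hab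
  change (a • P + b • Q).trace = 1
  rw [trace_add, trace_smul, trace_smul, hP, hQ, ← add_smul, hab, one_smul]

variable [DecidableEq J]

theorem isCompact_effects : IsCompact {P : Matrix J J ℂ | IsEffect P} := by
  refine isCompact_of_isClosed_of_norm_le (isClosed_posSemidef.inter
    (isClosed_posSemidef.preimage (continuous_const.sub continuous_id))) (Fintype.card J)
    fun P hP i j => ?_
  have h1 := hP.1.norm_apply_le i j
  have h2 := (Complex.le_def.1 hP.2.trace_nonneg).1
  rw [trace_sub, trace_one] at h2
  simp at h2
  linarith

theorem convex_effects : Convex ℝ {P : Matrix J J ℂ | IsEffect P} := by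
  refine convex_posSemidef.inter (t := {P : Matrix J J ℂ | (1 - P).PosSemidef}) ?_
  intro P (hP : (1 - P).PosSemidef) Q (hQ : (1 - Q).PosSemidef) a b ha hb hab
  have h := convex_posSemidef hP hQ ha hb hab
  have h1 : (1 : Matrix J J ℂ) = a • 1 + b • 1 := by rw [← add_smul, hab, one_smul]
  have e : a • (1 - P) + b • (1 - Q) = 1 - (a • P + b • Q) := by
    conv_rhs => rw [h1]
    rw [smul_sub, smul_sub]
    abel
  change (1 - (a • P + b • Q)).PosSemidef
  rw [← e]
  exact h

variable {I : Type*} [Fintype I] [DecidableEq I]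

/-- The equilibrium value exists. -/
theorem exists_isEquilibriumValue [Nonempty I] (Ξ : Matrix I I ℂ →ₗ[ℂ] Matrix J J ℂ) :
    ∃ v, IsEquilibriumValue Ξ v := by
  have hlin1 : ∀ P : Matrix J J ℂ, ∃ g : Matrix I I ℂ →ₗ[ℝ] ℝ, ∀ ρ, hsInner P (Ξ ρ) = g ρ := fun P =>
    ⟨{ toFun := fun ρ => hsInner P (Ξ ρ)
       map_add' := fun a b => by simp [hsInner, Matrix.mul_add]
       map_smul' := fun c a => by
        have : c • a = (c : ℂ) • a := by ext; simp
        change hsInner P (Ξ (c • a)) = c * hsInner P (Ξ a)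
        rw [this]
        simp [hsInner] }, fun _ => rfl⟩
  have hlin2 : ∀ A : Matrix J J ℂ, ∃ g : Matrix J J ℂ →ₗ[ℝ] ℝ, ∀ P, hsInner P A = g P := fun A =>
    ⟨{ toFun := fun P => hsInner P A
       map_add' := fun a b => by simp [hsInner, Matrix.add_mul]
       map_smul' := fun c a => by
        have : c • a = (c : ℂ) • a := by ext; simp
        change hsInner (c • a) A = c * hsInner a A
        rw [this]
        simp [hsInner] }, fun _ => rfl⟩
  have hΞ : Continuous Ξ := LinearMap.continuous_of_finiteDimensional Ξ
  have hc1 : ∀ P : Matrix J J ℂ, Continuous fun ρ => hsInner P (Ξ ρ) := fun P =>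
    Complex.continuous_re.comp ((continuous_const.matrix_mul hΞ).matrix_trace)
  have hc2 : ∀ A : Matrix J J ℂ, Continuous fun P => hsInner P A := fun A =>
    Complex.continuous_re.comp ((continuous_id.matrix_conjTranspose.matrix_mul
      continuous_const).matrix_trace)
  -- The payoff is continuous and real-linear in each argument, and both strategy sets are compact,
  -- convex and nonempty. A saddle point attains all the extrema at once.
  obtain ⟨ρ, hρ, P, hP, h⟩ := Sion.exists_isSaddlePointOn
    (X := {ρ : Matrix I I ℂ | IsDensity ρ}) (Y := {P : Matrix J J ℂ | IsEffect P})
    (f := fun ρ P => hsInner P (Ξ ρ))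
    ⟨Matrix.single (Classical.arbitrary I) (Classical.arbitrary I) 1, by
      refine ⟨?_, by simp⟩
      have := posSemidef_vecMulVec_self_star (Pi.single (Classical.arbitrary I) (1 : ℂ))
      convert this using 1
      ext i j
      simp [Matrix.single_apply, vecMulVec_apply, Pi.single_apply, ite_and, eq_comm]
      split_ifs <;> rfl⟩
    convex_densities isCompact_densities (fun P _ => (hc1 P).lowerSemicontinuous.lowerSemicontinuousOn _)
    (fun P _ => by
      obtain ⟨g, hg⟩ := hlin1 P
      simp only [hg]
      exact (g.convexOn convex_densities).quasiconvexOn)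
    convex_effects ⟨0, ⟨PosSemidef.zero, by rw [sub_zero]; exact PosSemidef.one⟩⟩ isCompact_effects
    (fun ρ _ => (hc2 _).upperSemicontinuous.upperSemicontinuousOn _)
    (fun ρ _ => by
      obtain ⟨g, hg⟩ := hlin2 (Ξ ρ)
      simp only [hg]
      exact (g.concaveOn convex_effects).quasiconcaveOn)
  have hmax : IsGreatest ((fun P => hsInner P (Ξ ρ)) '' {P | IsEffect P}) (hsInner P (Ξ ρ)) :=
    ⟨⟨P, hP, rfl⟩, by rintro _ ⟨P', hP', rfl⟩; exact h ρ hρ P' hP'⟩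
  have hmin : IsLeast ((fun ρ => hsInner P (Ξ ρ)) '' {ρ | IsDensity ρ}) (hsInner P (Ξ ρ)) :=
    ⟨⟨ρ, hρ, rfl⟩, by rintro _ ⟨ρ', hρ', rfl⟩; exact h ρ' hρ' P hP⟩
  refine ⟨hsInner P (Ξ ρ), ⟨⟨ρ, hρ, hmax⟩, ?_⟩, ⟨⟨P, hP, hmin⟩, ?_⟩⟩
  · rintro u ⟨ρ', hρ', hu⟩
    exact (h ρ' hρ' P hP).trans (hu.2 ⟨P, hP, rfl⟩)
  · rintro u ⟨P', hP', hu⟩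
    exact (hu.2 ⟨ρ, hρ, rfl⟩).trans (h ρ hρ P' hP')

end

/-! ### Stinespring representations -/

section
variable {X Y Z : Type*} [Fintype X] [DecidableEq X] [Fintype Y] [Fintype Z]
open Matrix

/-- Fixing the environment index `z` gives a Kraus operator, and `Ψ ⊗ 𝟙` is a sum of conjugations by
Kraus operators tensored with the identity. -/
theorem IsStinespring.isAdmissible {Ψ : Matrix X X ℂ →ₗ[ℂ] Matrix Y Y ℂ}
    {A : Matrix (Y × Z) X ℂ} (h : IsStinespring Ψ A) : IsAdmissible Ψ := by
  refine ⟨fun d M hM => ?_, fun M => ?_⟩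
  · have key : tensorId (Fin d) Ψ M =
        ∑ z, (Matrix.of fun (p : Y × Fin d) (q : X × Fin d) =>
          if p.2 = q.2 then A (p.1, z) q.1 else 0) * M *
          (Matrix.of fun (p : Y × Fin d) (q : X × Fin d) =>
            if p.2 = q.2 then A (p.1, z) q.1 else 0)ᴴ := by
      ext ⟨y, w⟩ ⟨y', w'⟩
      rw [Matrix.sum_apply]
      simp only [tensorId, LinearMap.coe_mk, AddHom.coe_mk, of_apply, h.2, trRight]
      refine Finset.sum_congr rfl fun z _ => ?_
      simp only [mul_apply, conjTranspose_apply, of_apply, Fintype.sum_prod_type, ite_mul, zero_mul,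
        Finset.sum_ite_eq, Finset.mem_univ, if_true, apply_ite star, star_zero, mul_ite, mul_zero]
    rw [key]
    exact posSemidef_sum _ fun z _ => hM.mul_mul_conjTranspose_same _
  · rw [h.2, trace_trRight, Matrix.mul_assoc, Matrix.trace_mul_comm, Matrix.mul_assoc, h.1,
      Matrix.mul_one]

/-- The Choi matrix, the auxiliary factor being indexed through an equivalence. -/
theorem IsAdmissible.exists_choi_factor [DecidableEq Y] {Ψ : Matrix X X ℂ →ₗ[ℂ] Matrix Y Y ℂ}
    (h : IsAdmissible Ψ) {d : ℕ} (e : X ≃ Fin d) :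
    ∃ S : Matrix (Y × Fin d) (Y × Fin d) ℂ, ∀ x x' y y',
      Ψ (Matrix.single x x' 1) y y' = ∑ k, S (y, e x) k * star (S (y', e x') k) := by
  -- `v` is the unnormalized maximally entangled vector; complete positivity makes the image of its
  -- rank-one operator, the Choi matrix, positive semidefinite.
  set v : X × Fin d → ℂ := fun p => if e p.1 = p.2 then 1 else 0 with hv
  obtain ⟨S, hS, hE⟩ := (h.1 d _ (posSemidef_vecMulVec_self_star v)).exists_sqrt
  refine ⟨S, fun x x' y y' => ?_⟩
  have hx : Ψ (Matrix.single x x' 1) y y' =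
      tensorId (Fin d) Ψ (vecMulVec v (star v)) (y, e x) (y', e x') := by
    simp only [tensorId, LinearMap.coe_mk, AddHom.coe_mk, of_apply]
    refine congrFun (congrFun (congrArg Ψ (Matrix.ext fun i i' => ?_)) y) y'
    simp only [Matrix.single_apply, vecMulVec_apply, hv, Pi.star_apply, of_apply, e.apply_eq_iff_eq,
      apply_ite star, star_one, star_zero, eq_comm (a := x), eq_comm (a := x')]
    split_ifs <;> simp_all
  rw [hx, ← hE, mul_apply]
  exact Finset.sum_congr rfl fun k _ => by rw [hS.isHermitian.apply]

/-- The columns of a square root of the Choi matrix, reshaped, are Kraus operators. There are `|Y| *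
|X|` of them for every channel, so two channels can use the same environment. -/
theorem IsAdmissible.exists_isStinespring [DecidableEq Y] {Ψ : Matrix X X ℂ →ₗ[ℂ] Matrix Y Y ℂ}
    (h : IsAdmissible Ψ) {D : ℕ} (f : Fin D ≃ Y × Fin (Fintype.card X)) :
    ∃ A : Matrix (Y × Fin D) X ℂ, IsStinespring Ψ A := by
  obtain ⟨S, hS⟩ := h.exists_choi_factor (Fintype.equivFin X)
  set e := Fintype.equivFin X
  set A : Matrix (Y × Fin D) X ℂ := Matrix.of fun p x => S (p.1, e x) (f p.2) with hA
  have hsum : ∀ x x' y y', ∑ z, A (y, z) x * star (A (y', z) x') = Ψ (Matrix.single x x' 1) y y' := by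
    intro x x' y y'
    rw [hS]
    exact f.sum_comp fun k => S (y, e x) k * star (S (y', e x') k)
  refine ⟨A, ?_, ?_⟩
  · ext x x'
    have h1 := h.2 (Matrix.single x' x 1)
    rw [trace] at h1
    simp only [diag_apply, ← hsum] at h1
    rw [mul_apply, Fintype.sum_prod_type]
    simp only [conjTranspose_apply, mul_comm (star _)]
    rw [h1, one_apply]
    by_cases hx : x = x'
    · subst hx; simp
    · rw [if_neg hx, trace_single_eq_of_ne _ _ _ (Ne.symm hx)]
  · have : Ψ = trRight Y (Fin D) ∘ₗ conjBy A := by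
      refine LinearMap.ext fun M => ?_
      induction M using Matrix.induction_on' with
      | h_zero => simp
      | h_add p q hp hq => rw [map_add, map_add, hp, hq]
      | h_std_basis x x' c =>
        have : Matrix.single x x' c = c • Matrix.single x x' (1 : ℂ) := by simp
        rw [this, map_smul, map_smul]
        congr 1
        ext y y'
        rw [← hsum]
        simp only [LinearMap.comp_apply, trRight, conjBy, LinearMap.coe_mk, AddHom.coe_mk, of_apply]
        refine Finset.sum_congr rfl fun z _ => ?_
        simp [mul_apply, Matrix.single_apply, ite_and]
    exact fun M => by rw [this]; rfl

theorem exists_isStinespring_pair [DecidableEq Y] {Q₀ Q₁ : Matrix X X ℂ →ₗ[ℂ] Matrix Y Y ℂ}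
    (h₀ : IsAdmissible Q₀) (h₁ : IsAdmissible Q₁) :
    ∃ (d : ℕ) (A₀ A₁ : Matrix (Y × Fin d) X ℂ), IsStinespring Q₀ A₀ ∧ IsStinespring Q₁ A₁ := by
  have f := (Fintype.equivFin (Y × Fin (Fintype.card X))).symm
  obtain ⟨A₀, hA₀⟩ := h₀.exists_isStinespring f
  obtain ⟨A₁, hA₁⟩ := h₁.exists_isStinespring f
  exact ⟨_, A₀, A₁, hA₀, hA₁⟩

end

/-! ### The equilibrium value in terms of the diamond norm -/

section
variable {X Y Z : Type*} [Fintype X] [DecidableEq X] [Fintype Y] [DecidableEq Y] [Fintype Z]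
  [DecidableEq Z]
open Matrix

/-- The equilibrium value of `xiMap A₀ A₁` and the diamond norm. -/
theorem exists_isEquilibriumValue_xiMap [Nonempty X] {Q₀ Q₁ : Matrix X X ℂ →ₗ[ℂ] Matrix Y Y ℂ}
    {A₀ A₁ : Matrix (Y × Z) X ℂ} (h₀ : IsStinespring Q₀ A₀) (h₁ : IsStinespring Q₁ A₁) :
    ∃ v : ℝ, IsEquilibriumValue (xiMap A₀ A₁) v ∧
      ∀ a b : ℝ, 0 ≤ b → b < a → a ≤ 2 →
        (a ≤ diamondNorm (Q₀ - Q₁) → v ≤ Real.sqrt (4 - a ^ 2) / 2) ∧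
        (diamondNorm (Q₀ - Q₁) ≤ b → (2 - b) / 2 ≤ v) := by
  obtain ⟨v, hv⟩ := exists_isEquilibriumValue (xiMap A₀ A₁)
  refine ⟨v, hv, fun a b hb hba ha => ⟨fun had => ?_, fun hdb => ?_⟩⟩
  · obtain ⟨P, hP, hmin⟩ := hv.2.1
    -- The supremum in the diamond norm is only approximated, never assumed to be attained; the
    -- bound for `a` follows from those for all `r < a` by continuity.
    have key : ∀ r, 0 ≤ r → r < a → v ≤ Real.sqrt (4 - r ^ 2) / 2 := by
      intro r hr hra
      obtain ⟨E, F, hE, hF, hlt⟩ := exists_lt_traceNorm_tensorId hr (hra.trans_le had)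
      refine (hmin.2 ⟨_, isDensity_kronecker hE hF, rfl⟩).trans
        ((hsInner_xiMap_kronecker_le h₀ h₁ hE hF hP).trans ?_)
      have h2 : Real.sqrt (4 - r ^ 2) / 2 = Real.sqrt (1 - (r / 2) ^ 2) := by
        rw [show 1 - (r / 2) ^ 2 = (4 - r ^ 2) / 2 ^ 2 by ring, Real.sqrt_div' _ (by norm_num),
          Real.sqrt_sq (by norm_num)]
      rw [h2]
      exact Real.sqrt_le_sqrt (by gcongr)
    have hc : Continuous fun r : ℝ => Real.sqrt (4 - r ^ 2) / 2 := by fun_prop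
    refine ge_of_tendsto (hc.continuousWithinAt (s := Set.Iio a) (x := a)) ?_
    filter_upwards [Ioo_mem_nhdsLT (hb.trans_lt hba)] with r hr
    exact key r hr.1.le hr.2
  · obtain ⟨ρ, hρ, hmax⟩ := hv.1.1
    obtain ⟨P, hP, hle⟩ := exists_effect_hsInner_xiMap_ge h₀ h₁ hρ
    have := hmax.2 ⟨P, hP, rfl⟩
    simp only at this
    linarith

end

theorem GateTable.isStinespring_isometry {s : ℕ} {𝒢 : Fin s → QGate} {S : GateTable} {n m N : ℕ}
    (hS : S.Describes 𝒢) (Q : QCircuit 𝒢 n m) (hQ : Q.length ≤ N) :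
    IsStinespring Q.channel (S.isometry Q N (S.c * N)) :=
  Q.isStinespring_kraus (fun g => Nat.pow_le_pow_right (by norm_num) (hS.nenv_le g))
    (by positivity) hQ (pow_mul _ _ _)

theorem mainTheorem2 :
    -- Stinespring isometries exist, and the super-operator built from them has the stated values
    (∀ (X Y : Type*) [Fintype X] [DecidableEq X] [Nonempty X] [Fintype Y] [DecidableEq Y]
        (Q₀ Q₁ : Matrix X X ℂ →ₗ[ℂ] Matrix Y Y ℂ), IsAdmissible Q₀ → IsAdmissible Q₁ →
      (∃ (d : ℕ) (A₀ A₁ : Matrix (Y × Fin d) X ℂ), IsStinespring Q₀ A₀ ∧ IsStinespring Q₁ A₁) ∧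
      ∀ (Z : Type*) [Fintype Z] [DecidableEq Z] (A₀ A₁ : Matrix (Y × Z) X ℂ),
        IsStinespring Q₀ A₀ → IsStinespring Q₁ A₁ →
        ∃ v : ℝ, IsEquilibriumValue (xiMap A₀ A₁) v ∧
          ∀ a b : ℝ, 0 ≤ b → b < a → a ≤ 2 →
            (a ≤ diamondNorm (Q₀ - Q₁) → v ≤ Real.sqrt (4 - a ^ 2) / 2) ∧
            (diamondNorm (Q₀ - Q₁) ≤ b → (2 - b) / 2 ≤ v)) ∧
    -- from the description of two circuits, such a super-operator is computed in `NC(poly)`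
    (∀ (s : ℕ) (𝒢 : Fin s → QGate),
      ∃ (C : (N : ℕ) → BoolCircuit N) (k L e : Polynomial ℕ), IsNCPoly C ∧
        ∀ (n m : ℕ) (Q₀ Q₁ : QCircuit 𝒢 n m) (N : ℕ), N = (encodeInstance Q₀ Q₁).length →
          IsAdmissible Q₀.channel ∧ IsAdmissible Q₁.channel ∧
          ∃ A₀ A₁ : Matrix (Bits m × Bits (e.eval N)) (Bits n) ℂ,
            IsStinespring Q₀.channel A₀ ∧ IsStinespring Q₁.channel A₁ ∧
            RepresentsMap ((C N).output (encodeInstance Q₀ Q₁)) (k.eval N) (L.eval N) (xiMap A₀ A₁) ∧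
            ∃ v : ℝ, IsEquilibriumValue (xiMap A₀ A₁) v ∧
              ∀ a b : ℝ, 0 ≤ b → b < a → a ≤ 2 →
                (a ≤ diamondNorm (Q₀.channel - Q₁.channel) → v ≤ Real.sqrt (4 - a ^ 2) / 2) ∧
                (diamondNorm (Q₀.channel - Q₁.channel) ≤ b → (2 - b) / 2 ≤ v)) := by
  refine ⟨fun X Y _ _ _ _ _ Q₀ Q₁ h₀ h₁ => ⟨exists_isStinespring_pair h₀ h₁,
    fun Z _ _ A₀ A₁ hA₀ hA₁ => exists_isEquilibriumValue_xiMap hA₀ hA₁⟩, fun s 𝒢 => ?_⟩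
  obtain ⟨S, hS⟩ := GateTable.exists_describes 𝒢
  -- The three polynomials are the width of an address digit, the number of digits of a stored
  -- integer, and the number of environment qubits, which is `c` for each of the `N` steps.
  refine ⟨S.circuit, .C S.c * .X + .X + 1, 2 * (.C S.c * .X + 2) + 1, .C S.c * .X,
    S.isNCPoly_circuit, fun n m Q₀ Q₁ N hN => ?_⟩
  have hk : (.C S.c * .X + .X + 1 : Polynomial ℕ).eval N = S.width (2 ^ N) := by
    simp [GateTable.width, GateTable.len_two_pow]
  have hL : (2 * (.C S.c * .X + 2) + 1 : Polynomial ℕ).eval N = S.digits (2 ^ N) := by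
    simp [GateTable.digits, GateTable.len_two_pow]
  have he : (.C S.c * .X : Polynomial ℕ).eval N = S.c * N := by simp
  have hlt := GateTable.length_code_add_le Q₀ Q₁ hN
  have l₀ := Q₀.length_le_length_code
  have l₁ := Q₁.length_le_length_code
  have h₀ := GateTable.isStinespring_isometry hS Q₀ (N := N) (by omega)
  have h₁ := GateTable.isStinespring_isometry hS Q₁ (N := N) (by omega)
  rw [hk, hL, he]
  exact ⟨h₀.isAdmissible, h₁.isAdmissible, _, _, h₀, h₁,
    GateTable.representsMap hS Q₀ Q₁ hN h₀.1 h₁.1, exists_isEquilibriumValue_xiMap h₀ h₁⟩
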